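/- A (Čech) closure space is a set $X$ with an operation $c$ on its subsets such that $c(\emptyset)=\emptyset$, $A\subseteq c(A)$ and $c(A\cup B)=c(A)\cup c(B)$; a map $f:(X,c)\to(Y,d)$ is continuous if $f(c(A))\subseteq d(f(A))$ for all $A\subseteq X$. Let $J$ be one of the following intervals: $I=[0,1]$ with its topology; $J_+=\{0,1\}$ with $c(0)=\{0,1\}$, $c(1)=\{1\}$; $J_1=\{0,1\}$ with the indiscrete closure. Let $|\Delta^n|^J$ be, respectively, the standard topological $n$-simplex; $\{0,\dots,n\}$ with $c(i)=\{j: i\le j\}$; $\{0,\dots,n\}$ with the indiscrete closure. Let $J^{n}$ be the $n$-fold product of $J$ with the product closure. For a closure space $X$ let $C^J_\bullet(X)$ be the complex of free abelian groups on the continuous maps $\sigma:|\Delta^n|^J\to X$, with boundary $\sum_i(-1)^id_i$, and let $C^{J}_{N,\bullet}(X)$ be its quotient by the subcomplex generated by the degenerate simplices. Let $Q^{J}_\bullet(X)$ be the complex of free abelian groups on the continuous maps $\tau:J^{n}\to X$, with boundary $\sum_{i=1}^n(-1)^i(A_i-B_i)$, where $A_i\tau$ and $B_i\tau$ are the faces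 of $\tau$ with $i$-th coordinate $0$ and $1$, modulo the subcomplex generated by the degenerate cubes, i.e. those that are independent of one of their coordinates. A tilde denotes the complex augmented by $\mathbb{Z}$ in degree $-1$ through $\sum n_i\sigma_i\mapsto\sum n_i$ (the reduced complex). Let $\pi:\tilde C^J_\bullet\to\tilde C^J_{N,\bullet}$ be the quotient map. **Theorem 1.2.** For each such $J$ there exist chain maps $f:\tilde C^J_{N,\bullet}(X)\to\tilde Q^J_\bullet(X)$ and $g:\tilde Q^J_\bullet(X)\to\tilde C^J_{N,\bullet}(X)$ and chain homotopies $H:gf\simeq\mathrm{id}$ and $G:fg\simeq\mathrm{id}$, all natural in the closure space $X$, such that $f$ and $g$ are the identity in degrees $<2$ (for the canonical identifications $J^0\cong|\Delta^0|^J$ and $J^1\cong|\Delta^1|^J$, which for $J=I$ sends $t$ to $(1-t)v_0+tv_1$), while $H$ and $G$ are $0$ in degrees $<2$. Moreover $g$ lifts along $\pi$ to a natural chain map $g':\tilde Q^J_\bullet\to\tilde C^J_\bullet$ with $g'f\pi\simeq\mathrm{id}$ by a natural chain homotopy. Hence $f\pi$ induces isomorphisms from the reduced singular simplicial homology to the reduced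 $(J,\times)$ singular cubical homology. The restriction $f_0:C^J_\bullet\to Q^J_\bullet$ of $f\pi$ to degrees $\ge 0$ is a natural chain homotopy equivalence, and it induces isomorphisms from the singular simplicial homology to the $(J,\times)$ singular cubical homology in every degree. -/

import Mathlib

open CategoryTheory

universe u v w

/-! ### Closure spaces -/

/-- A Čech closure operation on a type. It need not be idempotent. -/
class ClosureSpace (X : Type u) where
  /-- the closure operation -/
  cl : Set X → Set X
  cl_empty : cl ∅ = ∅
  subset_cl : ∀ A : Set X, A ⊆ cl A
  cl_union : ∀ A B : Set X, cl (A ∪ B) = cl A ∪ cl B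

namespace ClosureSpace

theorem cl_mono {X : Type u} [ClosureSpace X] {A B : Set X} (h : A ⊆ B) : cl A ⊆ cl B := by
  have h1 := cl_union A B
  rw [Set.union_eq_self_of_subset_left h] at h1
  rw [h1]
  exact Set.subset_union_left

/-- `V` is a neighborhood of `x`, i.e. `x` lies in the interior `X \ c (X \ V)` of `V`. -/
def IsNhd {X : Type u} [ClosureSpace X] (V : Set X) (x : X) : Prop :=
  x ∈ (cl Vᶜ)ᶜ

theorem IsNhd.mem {X : Type u} [ClosureSpace X] {V : Set X} {x : X} (h : IsNhd V x) : x ∈ V := by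
  by_contra hx
  exact h (subset_cl _ hx)

theorem isNhd_univ {X : Type u} [ClosureSpace X] (x : X) : IsNhd Set.univ x := by
  simp [IsNhd, cl_empty]

theorem IsNhd.inter {X : Type u} [ClosureSpace X] {V W : Set X} {x : X}
    (hV : IsNhd V x) (hW : IsNhd W x) : IsNhd (V ∩ W) x := by
  unfold IsNhd at *
  rw [Set.compl_inter, cl_union]
  rintro (h | h)
  · exact hV h
  · exact hW h

theorem mem_cl_iff {X : Type u} [ClosureSpace X] {A : Set X} {x : X} :
    x ∈ cl A ↔ ∀ V : Set X, IsNhd V x → (V ∩ A).Nonempty := by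
  constructor
  · intro hx V hV
    by_contra hne
    apply hV
    refine cl_mono ?_ hx
    intro a ha haV
    exact hne ⟨a, haV, ha⟩
  · intro h
    by_contra hx
    obtain ⟨a, ha, ha'⟩ := h Aᶜ (by simpa [IsNhd] using hx)
    exact ha ha'

/-- The closure operation of a topological space. -/
@[reducible]
def ofTopology (X : Type u) [TopologicalSpace X] : ClosureSpace X where
  cl := closure
  cl_empty := closure_empty
  subset_cl _ := subset_closure
  cl_union _ _ := closure_union

/-- The closure operation on a preordered set determined by `c(i) = {j | i ≤ j}`. -/
@[reducible]
def ofPreorder (X : Type u) [Preorder X] : ClosureSpace X where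
  cl A := {j | ∃ i ∈ A, i ≤ j}
  cl_empty := by simp
  subset_cl _ a ha := ⟨a, ha, le_refl a⟩
  cl_union A B := by
    ext j
    simp only [Set.mem_union, Set.mem_ofPred_eq]
    constructor
    · rintro ⟨i, hi | hi, hij⟩
      · exact Or.inl ⟨i, hi, hij⟩
      · exact Or.inr ⟨i, hi, hij⟩
    · rintro (⟨i, hi, hij⟩ | ⟨i, hi, hij⟩)
      · exact ⟨i, Or.inl hi, hij⟩
      · exact ⟨i, Or.inr hi, hij⟩

/-- The indiscrete closure operation: `c(A)` is everything when `A` is nonempty. -/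
@[reducible]
def indiscrete (X : Type u) : ClosureSpace X where
  cl A := {_x | A.Nonempty}
  cl_empty := by simp
  subset_cl _ a ha := ⟨a, ha⟩
  cl_union A B := by
    ext j
    simp [Set.union_nonempty]

/-- The product closure: the sets `⋂ i ∈ F, πᵢ⁻¹(Vᵢ)`, with `F` finite and `Vᵢ` a neighborhood of
`x i`, form a local base at `x`; hence `x` lies in the closure of `A` iff each of them meets `A`. -/
@[reducible]
def pi {ι : Type v} (X : ι → Type u) [∀ i, ClosureSpace (X i)] : ClosureSpace (∀ i, X i) where
  cl A := {x | ∀ (F : Finset ι) (V : ∀ i, Set (X i)), (∀ i ∈ F, IsNhd (V i) (x i)) →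
    ∃ y ∈ A, ∀ i ∈ F, y i ∈ V i}
  cl_empty := by
    ext x
    simp only [Set.mem_ofPred_eq, Set.mem_empty_iff_false, iff_false]
    intro h
    obtain ⟨y, hy, -⟩ := h ∅ (fun _ => Set.univ) (by simp)
    exact hy
  subset_cl A x hx F V hV := ⟨x, hx, fun i hi => (hV i hi).mem⟩
  cl_union A B := by
    classical
    ext x
    simp only [Set.mem_union, Set.mem_ofPred_eq]
    constructor
    · intro h
      by_contra hcon
      push Not at hcon
      obtain ⟨⟨F, V, hV, hA⟩, ⟨G, W, hW, hB⟩⟩ := hcon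
      obtain ⟨y, hy, hyVW⟩ := h (F ∪ G)
        (fun i => (if i ∈ F then V i else Set.univ) ∩ (if i ∈ G then W i else Set.univ)) (by
          intro i _
          apply IsNhd.inter
          · split_ifs with hi
            · exact hV i hi
            · exact isNhd_univ _
          · split_ifs with hi
            · exact hW i hi
            · exact isNhd_univ _)
      rcases hy with hy | hy
      · obtain ⟨i, hi, hi'⟩ := hA y hy
        have := (hyVW i (Finset.mem_union_left _ hi)).1
        rw [if_pos hi] at this
        exact hi' this
      · obtain ⟨i, hi, hi'⟩ := hB y hy
        have := (hyVW i (Finset.mem_union_right _ hi)).2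
        rw [if_pos hi] at this
        exact hi' this
    · rintro (h | h) F V hV
      · obtain ⟨y, hy, hy'⟩ := h F V hV
        exact ⟨y, Or.inl hy, hy'⟩
      · obtain ⟨y, hy, hy'⟩ := h F V hV
        exact ⟨y, Or.inr hy, hy'⟩

end ClosureSpace

/-- Continuous maps of closure spaces: `f (c A) ⊆ d (f A)` for every `A`. -/
@[ext]
structure ContMap (X : Type u) (Y : Type v) [ClosureSpace X] [ClosureSpace Y] where
  /-- the underlying map -/
  toFun : X → Y
  image_cl_subset : ∀ A : Set X, toFun '' ClosureSpace.cl A ⊆ ClosureSpace.cl (toFun '' A)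

namespace ContMap

open ClosureSpace

/-- The identity map. -/
@[simps]
def id (X : Type u) [ClosureSpace X] : ContMap X X where
  toFun x := x
  image_cl_subset A := by simp

/-- Composition of continuous maps. -/
@[simps]
def comp {X : Type u} {Y : Type v} {Z : Type w} [ClosureSpace X] [ClosureSpace Y] [ClosureSpace Z]
    (g : ContMap Y Z) (f : ContMap X Y) : ContMap X Z where
  toFun x := g.toFun (f.toFun x)
  image_cl_subset A := by
    rintro _ ⟨x, hx, rfl⟩
    have h1 := f.image_cl_subset A ⟨x, hx, rfl⟩
    have h2 := g.image_cl_subset _ ⟨_, h1, rfl⟩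
    rwa [Set.image_image] at h2

/-- Constant maps are continuous. -/
@[simps]
def const (X : Type u) {Y : Type v} [ClosureSpace X] [ClosureSpace Y] (y : Y) : ContMap X Y where
  toFun _ := y
  image_cl_subset A := by
    rintro _ ⟨x, hx, rfl⟩
    rcases A.eq_empty_or_nonempty with rfl | ⟨a, ha⟩
    · simp [cl_empty] at hx
    · exact subset_cl _ ⟨a, ha, rfl⟩

theorem isNhd_preimage {X : Type u} {Y : Type v} [ClosureSpace X] [ClosureSpace Y]
    (f : ContMap X Y) {V : Set Y} {x : X} (h : IsNhd V (f.toFun x)) :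
    IsNhd (f.toFun ⁻¹' V) x := by
  intro hx
  apply h
  refine cl_mono ?_ (f.image_cl_subset _ ⟨x, hx, rfl⟩)
  rintro _ ⟨a, ha, rfl⟩
  exact ha

/-- The projections of a product are continuous. -/
@[simps]
def proj {ι : Type v} (X : ι → Type u) [∀ i, ClosureSpace (X i)] (i : ι) :
    letI := ClosureSpace.pi X
    ContMap (∀ i, X i) (X i) :=
  letI := ClosureSpace.pi X
  { toFun := fun x => x i
    image_cl_subset := by
      rintro A _ ⟨x, hx, rfl⟩
      classical
      rw [mem_cl_iff]
      intro V hV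
      obtain ⟨y, hy, hy'⟩ := hx {i} (fun j => if h : j = i then h ▸ V else Set.univ) (by
        intro j hj
        obtain rfl := Finset.mem_singleton.mp hj
        simpa using hV)
      refine ⟨y i, ?_, y, hy, rfl⟩
      simpa using hy' i (Finset.mem_singleton_self i) }

/-- A map into a product is continuous when all its coordinates are. -/
@[simps]
def piLift {ι : Type v} {Y : Type w} (X : ι → Type u) [∀ i, ClosureSpace (X i)] [ClosureSpace Y]
    (f : ∀ i, ContMap Y (X i)) :
    letI := ClosureSpace.pi X
    ContMap Y (∀ i, X i) :=
  letI := ClosureSpace.pi X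
  { toFun := fun y i => (f i).toFun y
    image_cl_subset := by
      classical
      rintro A _ ⟨y, hy, rfl⟩ F V hV
      have key : ∀ G : Finset ι, G ⊆ F →
          IsNhd {z : Y | ∀ i ∈ G, (f i).toFun z ∈ V i} y := by
        intro G
        induction G using Finset.induction_on with
        | empty =>
          intro _
          simpa using isNhd_univ y
        | insert j G hj ih =>
          intro hG
          have h1 := ih (fun i hi => hG (Finset.mem_insert_of_mem hi))
          have h2 := (f j).isNhd_preimage (hV j (hG (Finset.mem_insert_self j G)))
          have h3 := h2.inter h1
          convert h3 using 1
          ext z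
          simp
      obtain ⟨z, hz, hzA⟩ := mem_cl_iff.mp hy _ (key F subset_rfl)
      exact ⟨_, ⟨z, hzA, rfl⟩, hz⟩ }

/-- A continuous map of topological spaces is continuous as a map of closure spaces. -/
@[simps]
def ofContinuous {X : Type u} {Y : Type v} [TopologicalSpace X] [TopologicalSpace Y] (f : X → Y)
    (hf : Continuous f) :
    letI := ClosureSpace.ofTopology X
    letI := ClosureSpace.ofTopology Y
    ContMap X Y :=
  letI := ClosureSpace.ofTopology X
  letI := ClosureSpace.ofTopology Y
  { toFun := f
    image_cl_subset := fun _ => image_closure_subset_closure_image hf }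

/-- Monotone maps are continuous for the closure operations `ClosureSpace.ofPreorder`. -/
@[simps]
def ofMonotone {X : Type u} {Y : Type v} [Preorder X] [Preorder Y] (f : X → Y) (hf : Monotone f) :
    letI := ClosureSpace.ofPreorder X
    letI := ClosureSpace.ofPreorder Y
    ContMap X Y :=
  letI := ClosureSpace.ofPreorder X
  letI := ClosureSpace.ofPreorder Y
  { toFun := f
    image_cl_subset := by
      rintro A _ ⟨x, ⟨a, ha, hax⟩, rfl⟩
      exact ⟨f a, ⟨a, ha, rfl⟩, hf hax⟩ }

/-- Every map into an indiscrete space is continuous. -/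
@[simps]
def toIndiscrete {X : Type u} {Y : Type v} [ClosureSpace X] (f : X → Y) :
    letI := ClosureSpace.indiscrete Y
    ContMap X Y :=
  letI := ClosureSpace.indiscrete Y
  { toFun := f
    image_cl_subset := by
      rintro A _ ⟨x, hx, rfl⟩
      rcases A.eq_empty_or_nonempty with rfl | ⟨a, ha⟩
      · simp [cl_empty] at hx
      · exact ⟨f a, a, ha, rfl⟩ }

end ContMap

/-- The type of (bundled) closure spaces. -/
structure ClCat where
  /-- the underlying set -/
  carrier : Type u
  [str : ClosureSpace carrier]

instance : CoeSort ClCat.{u} (Type u) := ⟨ClCat.carrier⟩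

instance (X : ClCat.{u}) : ClosureSpace X := X.str

/-- The category of closure spaces and continuous maps. -/
instance : Category ClCat.{u} where
  Hom X Y := ContMap X Y
  id X := ContMap.id X
  comp f g := ContMap.comp g f

/-! ### Intervals, simplices and cubes -/

/-- The three intervals: the unit interval `I`, and the two-point spaces `J₊` and `J₁`. -/
inductive IntervalKind where
  | I
  | Jplus
  | J1

namespace IntervalKind

/-- The interval as a closure space: `[0,1]` with its topology; `J₊ = {0,1}` with `c(0) = {0,1}`
and `c(1) = {1}`; `J₁ = {0,1}` with the indiscrete closure. -/
def space : IntervalKind → ClCat.{0}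
  | I => @ClCat.mk unitInterval (ClosureSpace.ofTopology _)
  | Jplus => @ClCat.mk (Fin 2) (ClosureSpace.ofPreorder _)
  | J1 => @ClCat.mk (Fin 2) (ClosureSpace.indiscrete _)

/-- The initial point of the interval. -/
def zero : (J : IntervalKind) → J.space
  | I => (0 : unitInterval)
  | Jplus => (0 : Fin 2)
  | J1 => (0 : Fin 2)

/-- The final point of the interval. -/
def one : (J : IntervalKind) → J.space
  | I => (1 : unitInterval)
  | Jplus => (1 : Fin 2)
  | J1 => (1 : Fin 2)

/-- The `J`-simplex `|Δⁿ|`: the standard topological simplex for `I`; the set `{0, …, n}` with the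
closure `c(i) = {j | i ≤ j}` for `J₊`; the set `{0, …, n}` with the indiscrete closure for `J₁`. -/
def simplex : IntervalKind → ℕ → ClCat.{0}
  | I, n => @ClCat.mk (stdSimplex ℝ (Fin (n + 1))) (ClosureSpace.ofTopology _)
  | Jplus, n => @ClCat.mk (Fin (n + 1)) (ClosureSpace.ofPreorder _)
  | J1, n => @ClCat.mk (Fin (n + 1)) (ClosureSpace.indiscrete _)

/-- The `J`-cube: the `n`-fold product of the interval, with the product closure. -/
def cube (J : IntervalKind) (n : ℕ) : ClCat.{0} :=
  @ClCat.mk (Fin n → J.space) (ClosureSpace.pi _)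

/-- The map of `J`-simplices induced by an order preserving map of vertices. -/
noncomputable def simplexMap : (J : IntervalKind) → {m n : ℕ} → (Fin (m + 1) →o Fin (n + 1)) →
    ContMap (J.simplex m) (J.simplex n)
  | I, m, n, α => ContMap.ofContinuous (X := stdSimplex ℝ (Fin (m + 1)))
      (Y := stdSimplex ℝ (Fin (n + 1))) (stdSimplex.map α) (stdSimplex.continuous_map α)
  | Jplus, m, n, α => ContMap.ofMonotone (X := Fin (m + 1)) (Y := Fin (n + 1)) α α.monotone
  | J1, m, n, α => ContMap.toIndiscrete (X := J1.simplex m) (Y := Fin (n + 1)) α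

theorem simplexMap_id (J : IntervalKind) (n : ℕ) :
    J.simplexMap (OrderHom.id (α := Fin (n + 1))) = ContMap.id _ := by
  cases J
  · apply ContMap.ext
    funext x
    exact stdSimplex.map_id_apply x
  · rfl
  · rfl

theorem simplexMap_comp (J : IntervalKind) {m n k : ℕ} (β : Fin (n + 1) →o Fin (k + 1))
    (α : Fin (m + 1) →o Fin (n + 1)) :
    J.simplexMap (β.comp α) = (J.simplexMap β).comp (J.simplexMap α) := by
  cases J
  · apply ContMap.ext
    funext x
    exact (stdSimplex.map_comp_apply α β x).symm
  · rfl
  · rfl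

/-- The coordinate projections of a cube. -/
def cubeProj (J : IntervalKind) {n : ℕ} (j : Fin n) : ContMap (J.cube n) J.space :=
  ContMap.proj (fun _ : Fin n => (J.space : Type)) j

/-- The continuous map into a cube with prescribed coordinates. -/
def cubeLift (J : IntervalKind) {n : ℕ} {Y : Type u} [ClosureSpace Y]
    (f : Fin n → ContMap Y J.space) : ContMap Y (J.cube n) :=
  ContMap.piLift (fun _ : Fin n => (J.space : Type)) f

/-- The face inclusion `(a₁, …, aₙ) ↦ (a₁, …, aᵢ₋₁, t, aᵢ, …, aₙ)` of cubes. -/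
def cubeFace (J : IntervalKind) {n : ℕ} (i : Fin (n + 1)) (t : J.space) :
    ContMap (J.cube n) (J.cube (n + 1)) :=
  J.cubeLift (Fin.insertNth (α := fun _ => ContMap (J.cube n) J.space) i
    (ContMap.const (J.cube n) t) (fun j => J.cubeProj j))

theorem cube_ext (J : IntervalKind) {n : ℕ} {a b : J.cube n}
    (h : ∀ j, (J.cubeProj j).toFun a = (J.cubeProj j).toFun b) : a = b :=
  funext (β := fun _ => (J.space : Type)) h

theorem cubeProj_cubeFace_self (J : IntervalKind) {n : ℕ} (i : Fin (n + 1)) (t : J.space)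
    (a : J.cube n) : (J.cubeProj i).toFun ((J.cubeFace i t).toFun a) = t := by
  change ContMap.toFun (Fin.insertNth (α := fun _ => ContMap (J.cube n) J.space) i
    (ContMap.const (J.cube n) t) (fun j => J.cubeProj j) i) a = _
  rw [Fin.insertNth_apply_same]
  rfl

theorem cubeProj_cubeFace_succAbove (J : IntervalKind) {n : ℕ} (i : Fin (n + 1)) (t : J.space)
    (k : Fin n) (a : J.cube n) :
    (J.cubeProj (i.succAbove k)).toFun ((J.cubeFace i t).toFun a) = (J.cubeProj k).toFun a := by
  change ContMap.toFun (Fin.insertNth (α := fun _ => ContMap (J.cube n) J.space) i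
    (ContMap.const (J.cube n) t) (fun j => J.cubeProj j) (i.succAbove k)) a = _
  rw [Fin.insertNth_apply_succAbove]

theorem cubeFace_comp (J : IntervalKind) {n : ℕ} {i j : Fin (n + 1)} (h : i ≤ j)
    (s t : J.space) :
    (J.cubeFace j.succ s).comp (J.cubeFace i t) =
      (J.cubeFace i.castSucc t).comp (J.cubeFace j s) := by
  apply ContMap.ext
  funext a
  change (J.cubeFace j.succ s).toFun ((J.cubeFace i t).toFun a) =
    (J.cubeFace i.castSucc t).toFun ((J.cubeFace j s).toFun a)
  refine J.cube_ext fun m => ?_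
  refine Fin.succAboveCases i.castSucc ?_ (fun l => ?_) m
  · rw [cubeProj_cubeFace_self]
    have e : i.castSucc = j.succ.succAbove i := by
      simp only [Fin.ext_iff, Fin.succAbove, Fin.lt_def, Fin.le_def] at h ⊢
      grind
    rw [e, cubeProj_cubeFace_succAbove, cubeProj_cubeFace_self]
  · rw [cubeProj_cubeFace_succAbove]
    refine Fin.succAboveCases j ?_ (fun p => ?_) l
    · rw [cubeProj_cubeFace_self]
      have e : i.castSucc.succAbove j = j.succ := by
        simp only [Fin.ext_iff, Fin.succAbove, Fin.lt_def, Fin.le_def] at h ⊢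
        grind
      rw [e, cubeProj_cubeFace_self]
    · rw [cubeProj_cubeFace_succAbove]
      have e : i.castSucc.succAbove (j.succAbove p) = j.succ.succAbove (i.succAbove p) := by
        simp only [Fin.ext_iff, Fin.succAbove, Fin.lt_def, Fin.le_def] at h ⊢
        grind
      rw [e, cubeProj_cubeFace_succAbove, cubeProj_cubeFace_succAbove]

/-- The projection `(a₁, …, aₙ₊₁) ↦ (a₁, …, aᵢ₋₁, aᵢ₊₁, …, aₙ₊₁)` of cubes. -/
def cubeDegen (J : IntervalKind) {n : ℕ} (i : Fin (n + 1)) :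
    ContMap (J.cube (n + 1)) (J.cube n) :=
  J.cubeLift (fun j => J.cubeProj (i.succAbove j))

theorem cubeProj_cubeDegen (J : IntervalKind) {n : ℕ} (i : Fin (n + 1)) (j : Fin n)
    (a : J.cube (n + 1)) :
    (J.cubeProj j).toFun ((J.cubeDegen i).toFun a) = (J.cubeProj (i.succAbove j)).toFun a := rfl

theorem cubeDegen_comp_cubeFace_self (J : IntervalKind) {n : ℕ} (i : Fin (n + 1)) (t : J.space) :
    (J.cubeDegen i).comp (J.cubeFace i t) = ContMap.id (J.cube n) := by
  apply ContMap.ext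
  funext a
  refine J.cube_ext fun m => ?_
  exact J.cubeProj_cubeFace_succAbove i t m a

theorem cubeDegen_comp_cubeFace (J : IntervalKind) {n : ℕ} {i k : Fin (n + 2)} (h : i ≠ k) :
    ∃ i' k' : Fin (n + 1), ∀ t : J.space, (J.cubeDegen k).comp (J.cubeFace i t) =
      (J.cubeFace i' t).comp (J.cubeDegen k') := by
  obtain ⟨i', hi⟩ := Fin.exists_succAbove_eq h
  obtain ⟨k', hk⟩ := Fin.exists_succAbove_eq h.symm
  refine ⟨i', k', fun t => ?_⟩
  apply ContMap.ext
  funext a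
  change (J.cubeDegen k).toFun ((J.cubeFace i t).toFun a) =
    (J.cubeFace i' t).toFun ((J.cubeDegen k').toFun a)
  refine J.cube_ext fun m => ?_
  rw [cubeProj_cubeDegen]
  refine Fin.succAboveCases i' ?_ (fun l => ?_) m
  · rw [hi, cubeProj_cubeFace_self, cubeProj_cubeFace_self]
  · have e : k.succAbove (i'.succAbove l) = i.succAbove (k'.succAbove l) := by
      simp only [Fin.ext_iff, Fin.succAbove, Fin.lt_def] at hi hk h ⊢
      grind
    rw [e, cubeProj_cubeFace_succAbove, cubeProj_cubeFace_succAbove, cubeProj_cubeDegen]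

/-- The canonical homeomorphism between the one-point spaces `J⁰` and `|Δ⁰|`. -/
noncomputable def cubeIsoSimplexZero : (J : IntervalKind) → (J.cube 0 ≅ J.simplex 0)
  | I =>
    { hom := ContMap.const (I.cube 0) (Y := I.simplex 0) (default : stdSimplex ℝ (Fin 1))
      inv := ContMap.const (I.simplex 0) (Y := I.cube 0) Fin.elim0
      hom_inv_id := by
        apply ContMap.ext; funext a; exact Subsingleton.elim (α := Fin 0 → I.space) _ _
      inv_hom_id := by
        apply ContMap.ext; funext a; exact Subsingleton.elim (α := stdSimplex ℝ (Fin 1)) _ _ }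
  | Jplus =>
    { hom := ContMap.const (Jplus.cube 0) (Y := Jplus.simplex 0) (0 : Fin 1)
      inv := ContMap.const (Jplus.simplex 0) (Y := Jplus.cube 0) Fin.elim0
      hom_inv_id := by
        apply ContMap.ext; funext a; exact Subsingleton.elim (α := Fin 0 → Jplus.space) _ _
      inv_hom_id := by
        apply ContMap.ext; funext a; exact Subsingleton.elim (α := Fin 1) _ _ }
  | J1 =>
    { hom := ContMap.const (J1.cube 0) (Y := J1.simplex 0) (0 : Fin 1)
      inv := ContMap.const (J1.simplex 0) (Y := J1.cube 0) Fin.elim0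
      hom_inv_id := by
        apply ContMap.ext; funext a; exact Subsingleton.elim (α := Fin 0 → J1.space) _ _
      inv_hom_id := by
        apply ContMap.ext; funext a; exact Subsingleton.elim (α := Fin 1) _ _ }

/-- The canonical homeomorphism between the interval and `|Δ¹|`: the point `t` of `[0,1]`
corresponds to `(1 - t) v₀ + t v₁`, and the points `0`, `1` of `J₊` and `J₁` to the vertices. -/
noncomputable def spaceIsoSimplexOne : (J : IntervalKind) → (J.space ≅ J.simplex 1)
  | I =>
    { hom := ContMap.ofContinuous (X := unitInterval) (Y := stdSimplex ℝ (Fin 2))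
        (fun t => ⟨![1 - (t : ℝ), t], by
          constructor
          · intro i
            fin_cases i
            · simpa using t.2.2
            · simpa using t.2.1
          · simp [Fin.sum_univ_two]⟩)
        (by
          refine Continuous.subtype_mk (continuous_pi fun i => ?_) _
          fin_cases i
          · exact (continuous_const.sub continuous_subtype_val : Continuous fun t : unitInterval => 1 - (t : ℝ))
          · simpa using continuous_subtype_val)
      inv := ContMap.ofContinuous (X := stdSimplex ℝ (Fin 2)) (Y := unitInterval)
        (fun s => ⟨s.1 1, s.2.1 1, by
          have h := s.2.2
          have h0 := s.2.1 0
          rw [Fin.sum_univ_two] at h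
          linarith⟩)
        (by
          refine Continuous.subtype_mk ?_ _
          exact (continuous_apply 1).comp continuous_subtype_val)
      hom_inv_id := by
        apply ContMap.ext
        funext t
        rfl
      inv_hom_id := by
        apply ContMap.ext
        funext (s : stdSimplex ℝ (Fin 2))
        apply Subtype.ext
        funext i
        have h := s.2.2
        rw [Fin.sum_univ_two] at h
        fin_cases i
        · change 1 - s.1 1 = s.1 0
          linarith
        · rfl }
  | Jplus => Iso.refl _
  | J1 => Iso.refl _

/-- The canonical homeomorphism between the `1`-cube and the interval. -/
def cubeOneIsoSpace (J : IntervalKind) : J.cube 1 ≅ J.space where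
  hom := J.cubeProj 0
  inv := J.cubeLift (fun _ => ContMap.id J.space)
  hom_inv_id := by
    apply ContMap.ext
    funext (a : Fin 1 → J.space)
    funext i
    obtain rfl := Subsingleton.elim i 0
    rfl
  inv_hom_id := rfl

/-- The canonical homeomorphism between the `1`-cube and `|Δ¹|`. -/
noncomputable def cubeIsoSimplexOne (J : IntervalKind) : J.cube 1 ≅ J.simplex 1 :=
  J.cubeOneIsoSpace ≪≫ J.spaceIsoSimplexOne

end IntervalKind

/-! ### Chain complexes: quotients and augmentations -/

namespace ChainHelpers

/-- The quotient of a chain complex of abelian groups by a subcomplex `D`. -/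
def quotientComplex (C : ChainComplex AddCommGrpCat.{u} ℕ) (D : ∀ n, AddSubgroup (C.X n))
    (hD : ∀ i j, D i ≤ (D j).comap (C.d i j).hom) : ChainComplex AddCommGrpCat.{u} ℕ where
  X n := AddCommGrpCat.of (C.X n ⧸ D n)
  d i j := AddCommGrpCat.ofHom (QuotientAddGroup.map (D i) (D j) (C.d i j).hom (hD i j))
  shape i j h := by
    ext x
    change ((C.d i j x : C.X j) : C.X j ⧸ D j) = 0
    rw [C.shape i j h]
    rfl
  d_comp_d' i j k _ _ := by
    ext x
    change ((C.d j k (C.d i j x) : C.X k) : C.X k ⧸ D k) = 0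
    rw [← ConcreteCategory.comp_apply, C.d_comp_d]
    rfl

/-- The projection of a chain complex onto its quotient by a subcomplex. -/
def quotientProj (C : ChainComplex AddCommGrpCat.{u} ℕ) (D : ∀ n, AddSubgroup (C.X n))
    (hD : ∀ i j, D i ≤ (D j).comap (C.d i j).hom) : C ⟶ quotientComplex C D hD where
  f n := AddCommGrpCat.ofHom (QuotientAddGroup.mk' (D n))
  comm' _ _ _ := rfl

/-- The chain map induced on quotients. -/
def quotientMap {C C' : ChainComplex AddCommGrpCat.{u} ℕ} {D : ∀ n, AddSubgroup (C.X n)}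
    {D' : ∀ n, AddSubgroup (C'.X n)} (hD : ∀ i j, D i ≤ (D j).comap (C.d i j).hom)
    (hD' : ∀ i j, D' i ≤ (D' j).comap (C'.d i j).hom) (φ : C ⟶ C')
    (hφ : ∀ n, D n ≤ (D' n).comap (φ.f n).hom) :
    quotientComplex C D hD ⟶ quotientComplex C' D' hD' where
  f n := AddCommGrpCat.ofHom (QuotientAddGroup.map (D n) (D' n) (φ.f n).hom (hφ n))
  comm' i j _ := by
    refine ConcreteCategory.hom_ext _ _ fun x => ?_
    obtain ⟨x, rfl⟩ := QuotientAddGroup.mk_surjective (s := D i) x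
    change ((C'.d i j (φ.f i x) : C'.X j) : C'.X j ⧸ D' j) =
      ((φ.f j (C.d i j x) : C'.X j) : C'.X j ⧸ D' j)
    rw [← ConcreteCategory.comp_apply, ← ConcreteCategory.comp_apply, φ.comm]

/-- The augmentation induced on a quotient complex. -/
def quotientAug (C : ChainComplex AddCommGrpCat.{u} ℕ) (D : ∀ n, AddSubgroup (C.X n))
    (hD : ∀ i j, D i ≤ (D j).comap (C.d i j).hom) {Z : AddCommGrpCat.{u}} (ε : C.X 0 ⟶ Z)
    (hε : D 0 ≤ ε.hom.ker) : (quotientComplex C D hD).X 0 ⟶ Z :=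
  AddCommGrpCat.ofHom (QuotientAddGroup.lift (D 0) ε.hom hε)

theorem quotientComplex_d_comp_quotientAug (C : ChainComplex AddCommGrpCat.{u} ℕ)
    (D : ∀ n, AddSubgroup (C.X n)) (hD : ∀ i j, D i ≤ (D j).comap (C.d i j).hom)
    {Z : AddCommGrpCat.{u}} (ε : C.X 0 ⟶ Z) (hε : D 0 ≤ ε.hom.ker) (w : C.d 1 0 ≫ ε = 0) :
    (quotientComplex C D hD).d 1 0 ≫ quotientAug C D hD ε hε = 0 := by
  refine ConcreteCategory.hom_ext _ _ fun x => ?_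
  obtain ⟨x, rfl⟩ := QuotientAddGroup.mk_surjective (s := D 1) x
  change (C.d 1 0 ≫ ε).hom x = 0
  rw [w]
  rfl

/-- The chain map induced on augmented complexes, the identity on the augmentation. -/
def augmentMap {C C' : ChainComplex AddCommGrpCat.{u} ℕ} {Z : AddCommGrpCat.{u}}
    (ε : C.X 0 ⟶ Z) (w : C.d 1 0 ≫ ε = 0) (ε' : C'.X 0 ⟶ Z) (w' : C'.d 1 0 ≫ ε' = 0)
    (φ : C ⟶ C') (hφ : φ.f 0 ≫ ε' = ε) : C.augment ε w ⟶ C'.augment ε' w' where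
  f
    | 0 => 𝟙 Z
    | n + 1 => φ.f n
  comm'
    | _, 0, rfl => by
      change φ.f 0 ≫ ε' = ε ≫ 𝟙 Z
      rw [hφ, Category.comp_id]
    | _, j + 1, rfl => φ.comm (j + 1) j

end ChainHelpers

open ChainHelpers

/-- The coefficient group `ℤ` (in the universe of the spaces considered). -/
abbrev intGrp : AddCommGrpCat.{u} := AddCommGrpCat.of (ULift.{u} ℤ)

/-- The map `∑ nᵢ σᵢ ↦ ∑ nᵢ` on a free abelian group. -/
def augHom (S : Type u) : FreeAbelianGroup S →+ ULift.{u} ℤ :=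
  FreeAbelianGroup.lift fun _ => ULift.up 1

/-! ### The singular simplicial complex -/

/-- The singular simplicial set of a closure space: its `n`-simplices are the continuous maps
from the `J`-simplex `|Δⁿ|`. -/
noncomputable def singSSet (J : IntervalKind) : ClCat.{u} ⥤ SSet.{u} where
  obj X :=
    { obj := fun n => ContMap (J.simplex n.unop.len) X
      map := fun α => ↾fun σ => σ.comp (J.simplexMap α.unop.toOrderHom)
      map_id := fun n => by
        refine ConcreteCategory.hom_ext _ _ fun σ => ?_
        change σ.comp (J.simplexMap OrderHom.id) = σ
        rw [J.simplexMap_id]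
        rfl
      map_comp := fun α β => by
        refine ConcreteCategory.hom_ext _ _ fun σ => ?_
        change σ.comp (J.simplexMap (α.unop.toOrderHom.comp β.unop.toOrderHom)) = _
        rw [J.simplexMap_comp]
        rfl }
  map φ := { app := fun _ => ↾fun σ => ContMap.comp φ σ }

/-- The free simplicial abelian group on the singular simplicial set of a closure space. -/
noncomputable def singAb (J : IntervalKind) : ClCat.{u} ⥤ SimplicialObject AddCommGrpCat.{u} :=
  singSSet J ⋙ (SimplicialObject.whiskering _ _).obj AddCommGrpCat.free

/-- The singular simplicial chain complex (the Moore complex of the free simplicial abelian group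
on the singular simplicial set): `∂ = ∑ᵢ (-1)ⁱ dᵢ`. -/
noncomputable def simpMoore (J : IntervalKind) : ClCat.{u} ⥤ ChainComplex AddCommGrpCat.{u} ℕ :=
  singAb J ⋙ AlgebraicTopology.alternatingFaceMapComplex AddCommGrpCat

/-- The subgroups of a simplicial abelian group generated by the degenerate simplices. -/
def degenerateSimplices (A : SimplicialObject AddCommGrpCat.{u}) :
    ∀ n : ℕ, AddSubgroup ((AlgebraicTopology.AlternatingFaceMapComplex.obj A).X n)
  | 0 => ⊥
  | n + 1 => ⨆ i : Fin (n + 1), (A.σ i).hom.range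

theorem degenerateSimplices_le (A : SimplicialObject AddCommGrpCat.{u}) (i j : ℕ) :
    degenerateSimplices A i ≤ (degenerateSimplices A j).comap
      ((AlgebraicTopology.AlternatingFaceMapComplex.obj A).d i j).hom := by
  by_cases hij : (ComplexShape.down ℕ).Rel i j
  swap
  · rw [(AlgebraicTopology.AlternatingFaceMapComplex.obj A).shape i j hij]
    intro x _
    exact AddSubgroup.zero_mem _
  obtain rfl : j + 1 = i := hij
  rw [AlgebraicTopology.AlternatingFaceMapComplex.obj_d_eq]
  refine iSup_le fun k => ?_
  rintro _ ⟨y, rfl⟩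
  have key : A.σ k ≫ (∑ i : Fin (j + 2), (-1 : ℤ) ^ (i : ℕ) • A.δ i) =
      ∑ i ∈ (Finset.univ.erase k.castSucc).erase k.succ,
        (-1 : ℤ) ^ (i : ℕ) • (A.σ k ≫ A.δ i) := by
    rw [Preadditive.comp_sum, ← Finset.add_sum_erase _ _ (Finset.mem_univ k.castSucc),
      ← Finset.add_sum_erase _ _ (Finset.mem_erase.mpr
        ⟨(Fin.castSucc_lt_succ (i := k)).ne', Finset.mem_univ k.succ⟩), ← add_assoc]
    simp only [Preadditive.comp_zsmul, SimplicialObject.δ_comp_σ_self,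
      SimplicialObject.δ_comp_σ_succ]
    simp [pow_succ]
  rw [AddSubgroup.mem_comap]
  change (A.σ k ≫ (∑ i : Fin (j + 2), (-1 : ℤ) ^ (i : ℕ) • A.δ i)).hom y ∈ _
  rw [key]
  change (AddCommGrpCat.homAddEquiv (∑ i ∈ (Finset.univ.erase k.castSucc).erase k.succ,
        (-1 : ℤ) ^ (i : ℕ) • (A.σ k ≫ A.δ i))) y ∈ _
  rw [map_sum, AddMonoidHom.finsetSum_apply]
  refine AddSubgroup.sum_mem _ fun i hi => ?_
  rw [map_zsmul]
  refine AddSubgroup.zsmul_mem _ ?_ _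
  simp only [Finset.mem_erase, Finset.mem_univ, and_true, ne_eq] at hi
  obtain ⟨h1, h2⟩ := hi
  have h1' : (i : ℕ) ≠ k + 1 := fun h => h1 (Fin.ext h)
  have h2' : (i : ℕ) ≠ k := fun h => h2 (Fin.ext h)
  cases j with
  | zero => omega
  | succ m =>
    change (A.σ k ≫ A.δ i).hom y ∈ ⨆ l : Fin (m + 1), (A.σ l).hom.range
    rcases lt_or_ge (i : ℕ) k with hlt | hge
    · obtain ⟨k', rfl⟩ := Fin.exists_succ_eq_of_ne_zero (x := k) (by
        intro h; rw [h] at hlt; simp at hlt)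
      obtain ⟨i', rfl⟩ := Fin.exists_castSucc_eq.mpr (show i ≠ Fin.last _ by
        intro h; rw [h] at hlt; simp at hlt; omega)
      rw [SimplicialObject.δ_comp_σ_of_le]
      · exact AddSubgroup.mem_iSup_of_mem k' ⟨(A.δ i').hom y, rfl⟩
      · rw [Fin.le_def]
        simp at hlt ⊢
        omega
    · have hgt : k.succ < i := by
        rw [Fin.lt_def]
        simp
        omega
      rw [SimplicialObject.δ_comp_σ_of_gt' _ hgt]
      exact AddSubgroup.mem_iSup_of_mem _ ⟨(A.δ _).hom y, rfl⟩

theorem degenerateSimplices_map {A B : SimplicialObject AddCommGrpCat.{u}} (φ : A ⟶ B) (n : ℕ) :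
    degenerateSimplices A n ≤ (degenerateSimplices B n).comap
      ((AlgebraicTopology.AlternatingFaceMapComplex.map φ).f n).hom := by
  cases n with
  | zero => exact bot_le
  | succ n =>
    refine iSup_le fun k => ?_
    rintro _ ⟨y, rfl⟩
    rw [AddSubgroup.mem_comap]
    change (A.σ k ≫ φ.app _).hom y ∈ ⨆ l : Fin (n + 1), (B.σ l).hom.range
    rw [SimplicialObject.σ_naturality]
    exact AddSubgroup.mem_iSup_of_mem k ⟨(φ.app _).hom y, rfl⟩

/-- The normalized singular simplicial complex: singular chains modulo degenerate simplices. -/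
noncomputable def simpNorm (J : IntervalKind) : ClCat.{u} ⥤ ChainComplex AddCommGrpCat.{u} ℕ where
  obj X := quotientComplex ((simpMoore J).obj X) (degenerateSimplices _)
    (degenerateSimplices_le _)
  map φ := quotientMap (degenerateSimplices_le _) (degenerateSimplices_le _)
    ((simpMoore J).map φ) (degenerateSimplices_map _)
  map_id X := by
    ext n : 1
    refine ConcreteCategory.hom_ext _ _ fun x => ?_
    obtain ⟨x, rfl⟩ := QuotientAddGroup.mk_surjective (s := degenerateSimplices _ n) x
    change QuotientAddGroup.mk' (degenerateSimplices _ n) (((simpMoore J).map (𝟙 X)).f n x) = _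
    rw [(simpMoore J).map_id]
    rfl
  map_comp {X Y Z} φ ψ := by
    ext n : 1
    refine ConcreteCategory.hom_ext _ _ fun x => ?_
    obtain ⟨x, rfl⟩ := QuotientAddGroup.mk_surjective (s := degenerateSimplices _ n) x
    change QuotientAddGroup.mk' (degenerateSimplices _ n) (((simpMoore J).map (φ ≫ ψ)).f n x) = _
    rw [(simpMoore J).map_comp]
    rfl

theorem augHom_map {S T : Type u} (p : S → T) (x : FreeAbelianGroup S) :
    augHom T (FreeAbelianGroup.map p x) = augHom S x := by
  have h : (augHom T).comp (FreeAbelianGroup.map p) = augHom S := by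
    ext s
    simp [augHom, FreeAbelianGroup.map_of_apply]
  exact DFunLike.congr_fun h x

/-- The augmentation `∑ nᵢ σᵢ ↦ ∑ nᵢ` of the singular simplicial complex. -/
noncomputable def simpAug (J : IntervalKind) (X : ClCat.{u}) :
    ((simpMoore J).obj X).X 0 ⟶ intGrp.{u} :=
  AddCommGrpCat.ofHom (augHom (ContMap (J.simplex 0) X))

theorem moore_d_comp_eq_zero (A : SimplicialObject AddCommGrpCat.{u}) {Z : AddCommGrpCat.{u}}
    (ε : (AlgebraicTopology.AlternatingFaceMapComplex.obj A).X 0 ⟶ Z)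
    (h : ∀ x : A.obj (Opposite.op (SimplexCategory.mk 1)),
      ε.hom ((A.δ (0 : Fin 2)).hom x) = ε.hom ((A.δ (1 : Fin 2)).hom x)) :
    (AlgebraicTopology.AlternatingFaceMapComplex.obj A).d 1 0 ≫ ε = 0 := by
  have hd : (AlgebraicTopology.AlternatingFaceMapComplex.obj A).d 1 0 =
      ∑ i : Fin 2, (-1 : ℤ) ^ (i : ℕ) • A.δ i :=
    AlgebraicTopology.AlternatingFaceMapComplex.obj_d_eq A 0
  rw [hd, Fin.sum_univ_two]
  refine ConcreteCategory.hom_ext _ _ fun x => ?_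
  change ε.hom (((-1 : ℤ) ^ 0) • (A.δ (0 : Fin 2)).hom x + ((-1 : ℤ) ^ 1) • (A.δ (1 : Fin 2)).hom x)
    = 0
  simp only [pow_zero, pow_one, one_smul, neg_smul]
  erw [map_add, map_neg]
  rw [h x]
  exact add_neg_cancel _

theorem simpMoore_d_comp_simpAug (J : IntervalKind) (X : ClCat.{u}) :
    ((simpMoore J).obj X).d 1 0 ≫ simpAug J X = 0 :=
  moore_d_comp_eq_zero ((singAb J).obj X) (simpAug J X) fun x =>
    (augHom_map _ x).trans (augHom_map _ x).symm

/-- The reduced singular simplicial complex, before normalization: the singular simplicial complex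
augmented by `ℤ`. The group of chains of degree `n` sits in position `n + 1`. -/
noncomputable def simpMooreRed (J : IntervalKind) :
    ClCat.{u} ⥤ ChainComplex AddCommGrpCat.{u} ℕ where
  obj X := ((simpMoore J).obj X).augment (simpAug J X) (simpMoore_d_comp_simpAug J X)
  map {X Y} φ := augmentMap _ _ _ _ ((simpMoore J).map φ) (by
    refine ConcreteCategory.hom_ext _ _ fun x => ?_
    exact augHom_map _ x)
  map_id X := by
    ext (_ | n) : 1
    · rfl
    · exact congrArg (fun ψ => HomologicalComplex.Hom.f ψ n) ((simpMoore J).map_id X)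
  map_comp {X Y Z} φ ψ := by
    ext (_ | n) : 1
    · rfl
    · exact congrArg (fun ψ => HomologicalComplex.Hom.f ψ n) ((simpMoore J).map_comp φ ψ)

/-- The augmentation of the normalized singular simplicial complex. -/
noncomputable def simpNormAug (J : IntervalKind) (X : ClCat.{u}) :
    ((simpNorm J).obj X).X 0 ⟶ intGrp.{u} :=
  quotientAug _ _ _ (simpAug J X) bot_le

/-- The reduced (i.e. augmented) normalized singular simplicial complex.
The group of chains of degree `n` sits in position `n + 1`. -/
noncomputable def simpRed (J : IntervalKind) :
    ClCat.{u} ⥤ ChainComplex AddCommGrpCat.{u} ℕ where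
  obj X := ((simpNorm J).obj X).augment (simpNormAug J X)
    (quotientComplex_d_comp_quotientAug _ _ _ _ _ (simpMoore_d_comp_simpAug J X))
  map {X Y} φ := augmentMap _ _ _ _ ((simpNorm J).map φ) (by
    refine ConcreteCategory.hom_ext _ _ fun x => ?_
    obtain ⟨x, rfl⟩ := QuotientAddGroup.mk_surjective (s := degenerateSimplices _ 0) x
    change augHom (ContMap (J.simplex 0) Y) (FreeAbelianGroup.map _ x) =
      augHom (ContMap (J.simplex 0) X) x
    exact augHom_map _ x)
  map_id X := by
    ext (_ | n) : 1
    · rfl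
    · exact congrArg (fun ψ => HomologicalComplex.Hom.f ψ n) ((simpNorm J).map_id X)
  map_comp {X Y Z} φ ψ := by
    ext (_ | n) : 1
    · rfl
    · exact congrArg (fun ψ => HomologicalComplex.Hom.f ψ n) ((simpNorm J).map_comp φ ψ)

/-- The quotient map from the reduced singular simplicial complex to its normalization. -/
noncomputable def simpRedProj (J : IntervalKind) : simpMooreRed.{u} J ⟶ simpRed.{u} J where
  app X := augmentMap (simpAug J X) (simpMoore_d_comp_simpAug J X) (simpNormAug J X)
    (quotientComplex_d_comp_quotientAug _ _ _ _ _ (simpMoore_d_comp_simpAug J X))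
    (quotientProj ((simpMoore J).obj X) (degenerateSimplices _) (degenerateSimplices_le _)) (by
      refine ConcreteCategory.hom_ext _ _ fun x => ?_
      rfl)
  naturality X Y φ := by
    ext (_ | n) : 1
    · rfl
    · rfl

/-! ### The singular cubical complex -/

/-- The homomorphism `Aᵢ - Bᵢ` on cubical chains, where `Aᵢ` and `Bᵢ` restrict a singular cube to
its faces with `i`-th coordinate `0` and `1`. -/
def cubeFaceDiff (J : IntervalKind) (X : ClCat.{u}) {n : ℕ} (i : Fin (n + 1)) :
    FreeAbelianGroup (ContMap (J.cube (n + 1)) X) →+ FreeAbelianGroup (ContMap (J.cube n) X) :=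
  FreeAbelianGroup.map (fun τ => τ.comp (J.cubeFace i J.zero)) -
    FreeAbelianGroup.map (fun τ => τ.comp (J.cubeFace i J.one))

/-- The boundary `∂ = ∑_{i = 1}^{n + 1} (-1)ⁱ (Aᵢ - Bᵢ)` (the index `i` below starts at `0`). -/
def cubeBoundary (J : IntervalKind) (X : ClCat.{u}) (n : ℕ) :
    FreeAbelianGroup (ContMap (J.cube (n + 1)) X) →+ FreeAbelianGroup (ContMap (J.cube n) X) :=
  ∑ i : Fin (n + 1), (-1 : ℤ) ^ ((i : ℕ) + 1) • cubeFaceDiff J X i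

theorem cubeFaceDiff_comp (J : IntervalKind) (X : ClCat.{u}) {n : ℕ} {i j : Fin (n + 1)}
    (h : i ≤ j) :
    (cubeFaceDiff J X i).comp (cubeFaceDiff J X j.succ) =
      (cubeFaceDiff J X j).comp (cubeFaceDiff J X i.castSucc) := by
  have e : ∀ (τ : ContMap (J.cube (n + 2)) X) (s t : J.space),
      (τ.comp (J.cubeFace j.succ s)).comp (J.cubeFace i t) =
        (τ.comp (J.cubeFace i.castSucc t)).comp (J.cubeFace j s) := by
    intro τ s t
    exact congrArg τ.comp (J.cubeFace_comp h s t)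
  ext τ
  simp only [cubeFaceDiff, AddMonoidHom.comp_apply, AddMonoidHom.sub_apply,
    FreeAbelianGroup.map_of_apply, map_sub, e]
  abel

theorem alternating_double_sum {M : Type u} [AddCommGroup M] {n : ℕ}
    (P : Fin (n + 2) → Fin (n + 1) → M)
    (h : ∀ i j : Fin (n + 1), i ≤ j → P j.succ i = P i.castSucc j) :
    ∑ i : Fin (n + 2), ∑ j : Fin (n + 1), (-1 : ℤ) ^ ((i : ℕ) + j) • P i j = 0 := by
  rw [← Finset.sum_product']
  let S : Finset (Fin (n + 2) × Fin (n + 1)) := {ij | (ij.1 : ℕ) ≤ (ij.2 : ℕ)}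
  rw [Finset.univ_product_univ, ← Finset.sum_add_sum_compl S, ← eq_neg_iff_add_eq_zero,
    ← Finset.sum_neg_distrib]
  let φ : ∀ ij : Fin (n + 2) × Fin (n + 1), ij ∈ S → Fin (n + 2) × Fin (n + 1) := fun ij hij =>
    (ij.2.succ, ij.1.castLT (lt_of_le_of_lt (Finset.mem_filter.mp hij).2 ij.2.is_lt))
  apply Finset.sum_bij φ
  · intro ij hij
    simp_rw [S, φ, Finset.compl_filter, Finset.mem_filter_univ, Fin.val_succ,
      Fin.val_castLT] at hij ⊢
    omega
  · rintro ⟨i, j⟩ hij ⟨i', j'⟩ hij' hh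
    simp only [φ, Prod.mk.injEq, Fin.ext_iff, Fin.val_succ, Fin.val_castLT] at hh ⊢
    omega
  · rintro ⟨i', j'⟩ hij'
    simp_rw [S, Finset.compl_filter, Finset.mem_filter_univ, not_le] at hij'
    refine ⟨(j'.castSucc, i'.pred ?_), ?_, ?_⟩
    · rintro rfl
      simp at hij'
    · simp only [S, Finset.mem_filter_univ, Fin.val_castSucc, Fin.val_pred]
      omega
    · simp [φ]
  · rintro ⟨i, j⟩ hij
    simp only [S, Finset.mem_filter_univ] at hij
    have := h (i.castLT (lt_of_le_of_lt hij j.is_lt)) j hij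
    simp only [φ, this, Fin.castSucc_castLT, Fin.val_succ, Fin.val_castLT, ← neg_smul]
    congr 1
    ring

theorem cubeBoundary_comp (J : IntervalKind) (X : ClCat.{u}) (n : ℕ) :
    (cubeBoundary J X n).comp (cubeBoundary J X (n + 1)) = 0 := by
  ext τ
  have := alternating_double_sum (n := n)
    (fun i j => cubeFaceDiff J X j (cubeFaceDiff J X i (FreeAbelianGroup.of τ)))
    (fun i j h => DFunLike.congr_fun (cubeFaceDiff_comp J X h) (FreeAbelianGroup.of τ))
  rw [AddMonoidHom.zero_apply, ← this]
  simp only [cubeBoundary, AddMonoidHom.comp_apply, AddMonoidHom.finsetSum_apply, map_sum,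
    AddMonoidHom.smul_apply, map_zsmul, Finset.smul_sum, smul_smul]
  refine Finset.sum_congr rfl fun i _ => Finset.sum_congr rfl fun j _ => ?_
  congr 1
  ring

/-- The unnormalized singular cubical complex. -/
def cubeComplex (J : IntervalKind) (X : ClCat.{u}) : ChainComplex AddCommGrpCat.{u} ℕ :=
  ChainComplex.of (fun n => AddCommGrpCat.of (FreeAbelianGroup (ContMap (J.cube n) X)))
    (fun n => AddCommGrpCat.ofHom (cubeBoundary J X n))
    (fun n => by
      ext1
      exact cubeBoundary_comp J X n)

theorem cubeComplex_d (J : IntervalKind) (X : ClCat.{u}) (n : ℕ) :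
    (cubeComplex J X).d (n + 1) n = AddCommGrpCat.ofHom (cubeBoundary J X n) :=
  ChainComplex.of_d (fun n => AddCommGrpCat.of (FreeAbelianGroup (ContMap (J.cube n) X)))
    (fun n => AddCommGrpCat.ofHom (cubeBoundary J X n)) n

theorem cubeBoundary_map (J : IntervalKind) {X Y : ClCat.{u}} (φ : ContMap X Y) (n : ℕ)
    (x : FreeAbelianGroup (ContMap (J.cube (n + 1)) X)) :
    cubeBoundary J Y n (FreeAbelianGroup.map (fun τ => φ.comp τ) x) =
      FreeAbelianGroup.map (fun τ => φ.comp τ) (cubeBoundary J X n x) := by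
  have h : (cubeBoundary J Y n).comp (FreeAbelianGroup.map (fun τ => φ.comp τ)) =
      (FreeAbelianGroup.map (fun τ => φ.comp τ)).comp (cubeBoundary J X n) := by
    ext τ
    simp only [cubeBoundary, cubeFaceDiff, AddMonoidHom.comp_apply, AddMonoidHom.finsetSum_apply,
      map_sum, AddMonoidHom.smul_apply, map_zsmul, AddMonoidHom.sub_apply, map_sub,
      FreeAbelianGroup.map_of_apply]
    rfl
  exact DFunLike.congr_fun h x

/-- The map induced by a continuous map on unnormalized cubical complexes. -/
def cubeComplexMap (J : IntervalKind) {X Y : ClCat.{u}} (φ : X ⟶ Y) :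
    cubeComplex J X ⟶ cubeComplex J Y where
  f n := AddCommGrpCat.ofHom (FreeAbelianGroup.map fun τ => ContMap.comp φ τ)
  comm' := by
    rintro _ n rfl
    rw [cubeComplex_d, cubeComplex_d]
    refine ConcreteCategory.hom_ext _ _ fun x => ?_
    exact cubeBoundary_map J φ n x

/-- The subgroups generated by the degenerate singular cubes, i.e. those which are independent of
one of their coordinates. -/
def degenerateCubes (J : IntervalKind) (X : ClCat.{u}) :
    ∀ n : ℕ, AddSubgroup ((cubeComplex J X).X n)
  | 0 => ⊥
  | n + 1 => AddSubgroup.closure (G := FreeAbelianGroup (ContMap (J.cube (n + 1)) X))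
      {x | ∃ (i : Fin (n + 1)) (τ : ContMap (J.cube n) X),
        x = FreeAbelianGroup.of (τ.comp (J.cubeDegen i))}

theorem degenerateCubes_le (J : IntervalKind) (X : ClCat.{u}) (i j : ℕ) :
    degenerateCubes J X i ≤ (degenerateCubes J X j).comap ((cubeComplex J X).d i j).hom := by
  by_cases hij : (ComplexShape.down ℕ).Rel i j
  swap
  · rw [(cubeComplex J X).shape i j hij]
    intro x _
    exact AddSubgroup.zero_mem _
  obtain rfl : j + 1 = i := hij
  rw [cubeComplex_d]
  refine (AddSubgroup.closure_le _).mpr ?_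
  rintro _ ⟨k, τ, rfl⟩
  change cubeBoundary J X j (FreeAbelianGroup.of (τ.comp (J.cubeDegen k))) ∈ degenerateCubes J X j
  rw [cubeBoundary, AddMonoidHom.finsetSum_apply]
  refine AddSubgroup.sum_mem _ fun l _ => ?_
  rw [AddMonoidHom.smul_apply]
  refine AddSubgroup.zsmul_mem _ ?_ _
  rw [cubeFaceDiff, AddMonoidHom.sub_apply, FreeAbelianGroup.map_of_apply,
    FreeAbelianGroup.map_of_apply]
  by_cases hlk : l = k
  · subst hlk
    have e : ∀ t : J.space, (τ.comp (J.cubeDegen l)).comp (J.cubeFace l t) = τ := fun t =>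
      congrArg τ.comp (J.cubeDegen_comp_cubeFace_self l t)
    rw [e, e, sub_self]
    exact AddSubgroup.zero_mem _
  · cases j with
    | zero => exact absurd (Subsingleton.elim (α := Fin 1) l k) hlk
    | succ m =>
      obtain ⟨i', k', h⟩ := J.cubeDegen_comp_cubeFace hlk
      refine AddSubgroup.sub_mem _ ?_ ?_ <;> refine AddSubgroup.subset_closure ?_
      · exact ⟨k', τ.comp (J.cubeFace i' J.zero),
          congrArg (fun ψ => FreeAbelianGroup.of (τ.comp ψ)) (h J.zero)⟩
      · exact ⟨k', τ.comp (J.cubeFace i' J.one),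
          congrArg (fun ψ => FreeAbelianGroup.of (τ.comp ψ)) (h J.one)⟩

theorem degenerateCubes_map (J : IntervalKind) {X Y : ClCat.{u}} (φ : X ⟶ Y) (n : ℕ) :
    degenerateCubes J X n ≤ (degenerateCubes J Y n).comap ((cubeComplexMap J φ).f n).hom := by
  cases n with
  | zero => exact bot_le
  | succ n =>
    refine (AddSubgroup.closure_le _).mpr ?_
    rintro _ ⟨k, τ, rfl⟩
    refine AddSubgroup.subset_closure ⟨k, ContMap.comp φ τ, ?_⟩
    exact FreeAbelianGroup.map_of_apply _

/-- The (normalized) singular cubical complex: singular cubical chains modulo degenerate cubes. -/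
def cubeNorm (J : IntervalKind) : ClCat.{u} ⥤ ChainComplex AddCommGrpCat.{u} ℕ where
  obj X := quotientComplex (cubeComplex J X) (degenerateCubes J X) (degenerateCubes_le J X)
  map φ := quotientMap (degenerateCubes_le J _) (degenerateCubes_le J _)
    (cubeComplexMap J φ) (degenerateCubes_map J φ)
  map_id X := by
    ext n : 1
    refine ConcreteCategory.hom_ext _ _ fun x => ?_
    obtain ⟨x, rfl⟩ := QuotientAddGroup.mk_surjective (s := degenerateCubes J X n) x
    exact congrArg (QuotientAddGroup.mk' (degenerateCubes J X n))
      (FreeAbelianGroup.map_id_apply (α := ContMap (J.cube n) X) x)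
  map_comp {X Y Z} φ ψ := by
    ext n : 1
    refine ConcreteCategory.hom_ext _ _ fun x => ?_
    obtain ⟨x, rfl⟩ := QuotientAddGroup.mk_surjective (s := degenerateCubes J X n) x
    exact congrArg (QuotientAddGroup.mk' (degenerateCubes J Z n))
      (FreeAbelianGroup.map_comp_apply (α := ContMap (J.cube n) X)
        (f := fun τ => ContMap.comp φ τ) (g := fun τ => ContMap.comp ψ τ) x)

/-- The augmentation `∑ nᵢ τᵢ ↦ ∑ nᵢ` of the unnormalized singular cubical complex. -/
def cubeAug (J : IntervalKind) (X : ClCat.{u}) : (cubeComplex J X).X 0 ⟶ intGrp.{u} :=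
  AddCommGrpCat.ofHom (augHom (ContMap (J.cube 0) X))

theorem augHom_cubeBoundary (J : IntervalKind) (X : ClCat.{u})
    (x : FreeAbelianGroup (ContMap (J.cube 1) X)) :
    augHom (ContMap (J.cube 0) X) (cubeBoundary J X 0 x) = 0 := by
  rw [cubeBoundary, AddMonoidHom.finsetSum_apply, map_sum]
  refine Finset.sum_eq_zero fun i _ => ?_
  rw [AddMonoidHom.smul_apply, map_zsmul, cubeFaceDiff, AddMonoidHom.sub_apply, map_sub,
    augHom_map, augHom_map, sub_self, smul_zero]

theorem cubeComplex_d_comp_cubeAug (J : IntervalKind) (X : ClCat.{u}) :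
    (cubeComplex J X).d 1 0 ≫ cubeAug J X = 0 := by
  have h : (cubeComplex J X).d 1 0 = AddCommGrpCat.ofHom (cubeBoundary J X 0) :=
    cubeComplex_d J X 0
  rw [h]
  exact ConcreteCategory.hom_ext _ _ fun x => augHom_cubeBoundary J X x

/-- The augmentation of the singular cubical complex. -/
def cubeNormAug (J : IntervalKind) (X : ClCat.{u}) : ((cubeNorm J).obj X).X 0 ⟶ intGrp.{u} :=
  quotientAug _ _ _ (cubeAug J X) bot_le

/-- The reduced (i.e. augmented) singular cubical complex, modulo degenerate cubes.
The group of chains of degree `n` sits in position `n + 1`. -/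
def cubeRed (J : IntervalKind) : ClCat.{u} ⥤ ChainComplex AddCommGrpCat.{u} ℕ where
  obj X := ((cubeNorm J).obj X).augment (cubeNormAug J X)
    (quotientComplex_d_comp_quotientAug _ _ _ _ _ (cubeComplex_d_comp_cubeAug J X))
  map {X Y} φ := augmentMap _ _ _ _ ((cubeNorm J).map φ) (by
    refine ConcreteCategory.hom_ext _ _ fun x => ?_
    obtain ⟨x, rfl⟩ := QuotientAddGroup.mk_surjective (s := degenerateCubes J X 0) x
    change augHom (ContMap (J.cube 0) Y) (FreeAbelianGroup.map _ x) =
      augHom (ContMap (J.cube 0) X) x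
    exact augHom_map _ x)
  map_id X := by
    ext (_ | n) : 1
    · rfl
    · exact congrArg (fun ψ => HomologicalComplex.Hom.f ψ n) ((cubeNorm J).map_id X)
  map_comp {X Y Z} φ ψ := by
    ext (_ | n) : 1
    · rfl
    · exact congrArg (fun ψ => HomologicalComplex.Hom.f ψ n) ((cubeNorm J).map_comp φ ψ)

/-! ### Generators, and natural chain homotopies -/

/-- The class of a singular simplex in the reduced normalized singular simplicial complex. -/
noncomputable def simplexClass (J : IntervalKind) (X : ClCat.{u}) {n : ℕ}
    (σ : ContMap (J.simplex n) X) : ((simpRed J).obj X).X (n + 1) :=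
  QuotientAddGroup.mk' (degenerateSimplices ((singAb J).obj X) n)
    (FreeAbelianGroup.of σ)

/-- The class of a singular cube in the reduced singular cubical complex. -/
def cubeClass (J : IntervalKind) (X : ClCat.{u}) {n : ℕ} (τ : ContMap (J.cube n) X) :
    ((cubeRed J).obj X).X (n + 1) :=
  QuotientAddGroup.mk' (degenerateCubes J X n) (FreeAbelianGroup.of τ)

/-- An integer as an element of degree `-1` of the reduced singular simplicial complex. -/
noncomputable def simpInt (J : IntervalKind) (X : ClCat.{u}) (k : ℤ) :
    ((simpRed J).obj X).X 0 :=
  (ULift.up k : ULift.{u} ℤ)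

/-- An integer as an element of degree `-1` of the reduced singular cubical complex. -/
def cubeInt (J : IntervalKind) (X : ClCat.{u}) (k : ℤ) : ((cubeRed J).obj X).X 0 :=
  (ULift.up k : ULift.{u} ℤ)

/-- `f` is the identity in degrees `-1`, `0` and `1`, for the canonical identifications
`J⁰ ≅ |Δ⁰|` and `J¹ ≅ |Δ¹|`. -/
def SimpToCubeIdBelowTwo (J : IntervalKind) (f : simpRed.{u} J ⟶ cubeRed.{u} J) : Prop :=
  ∀ X : ClCat.{u},
    (∀ k : ℤ, (f.app X).f 0 (simpInt J X k) = cubeInt J X k) ∧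
    (∀ σ : ContMap (J.simplex 0) X,
      (f.app X).f 1 (simplexClass J X σ) = cubeClass J X (σ.comp J.cubeIsoSimplexZero.hom)) ∧
    (∀ σ : ContMap (J.simplex 1) X,
      (f.app X).f 2 (simplexClass J X σ) = cubeClass J X (σ.comp J.cubeIsoSimplexOne.hom))

/-- `g` is the identity in degrees `-1`, `0` and `1`, for the canonical identifications
`J⁰ ≅ |Δ⁰|` and `J¹ ≅ |Δ¹|`. -/
def CubeToSimpIdBelowTwo (J : IntervalKind) (g : cubeRed.{u} J ⟶ simpRed.{u} J) : Prop :=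
  ∀ X : ClCat.{u},
    (∀ k : ℤ, (g.app X).f 0 (cubeInt J X k) = simpInt J X k) ∧
    (∀ τ : ContMap (J.cube 0) X,
      (g.app X).f 1 (cubeClass J X τ) = simplexClass J X (τ.comp J.cubeIsoSimplexZero.inv)) ∧
    (∀ τ : ContMap (J.cube 1) X,
      (g.app X).f 2 (cubeClass J X τ) = simplexClass J X (τ.comp J.cubeIsoSimplexOne.inv))

/-- A natural chain homotopy between two natural chain maps `a` and `b`. -/
structure NaturalHomotopy {F G : ClCat.{u} ⥤ ChainComplex AddCommGrpCat.{u} ℕ} (a b : F ⟶ G) where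
  /-- the chain homotopy at each space -/
  app : ∀ X : ClCat.{u}, Homotopy (a.app X) (b.app X)
  naturality : ∀ {X Y : ClCat.{u}} (φ : X ⟶ Y) (i j : ℕ),
    (F.map φ).f i ≫ (app Y).hom i j = (app X).hom i j ≫ (G.map φ).f j

/-- For augmented complexes: the homotopy vanishes in degrees `-1`, `0` and `1`,
which are the positions `0`, `1` and `2`. -/
def NaturalHomotopy.ZeroBelowTwo {F G : ClCat.{u} ⥤ ChainComplex AddCommGrpCat.{u} ℕ}
    {a b : F ⟶ G} (H : NaturalHomotopy a b) : Prop :=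
  ∀ (X : ClCat.{u}) (i j : ℕ), i < 3 → (H.app X).hom i j = 0

/-! A cube is compared with a simplex through the collapse `J.collapse n` of the `n`-cube onto the
`n`-simplex. Its `k`-th tail coordinate (for `I`, the sum of the barycentric coordinates from `k`
on) is the minimum of the first `k` coordinates of the cube; on vertices it counts leading ones. The
faces of the cube with a coordinate equal to `1`, together with the last face with coordinate `0`,
collapse onto the faces of the simplex. On the other faces with coordinate `0` the collapse does not
depend on the last coordinate, so they vanish in the cubical complex. Hence composition with the
collapse is a chain map on unnormalized simplicial chains (`d_collapseHom`). It does not kill all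
degenerate simplices, so `f` is obtained by first applying the natural Dold-Kan section of the
normalization, given by the idempotent `PInfty`.

In the other direction, `g` triangulates cubes. The nerve of the vertex poset carries a fundamental
chain, defined inductively as the cone from the bottom vertex on the signed sum of the faces; a
singular cube pushes it forward. Its boundary is that signed sum (`posetNerve.d_fundChain`), which
makes `g` a chain map. Degenerate cubes go to zero because a smaller vertex poset has no
nondegenerate chain of the required length (`posetNerve.dropHom_fundChain`).

The composite `gf` is the identity on the nose, so `H` is zero: restricted to the simplices of the
triangulation, the collapse is the simplicial map counting leading ones (`collapse_comp_vert`), and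
this map sends the fundamental chain to the single nondegenerate top simplex
(`posetNerve.leadOnes_fundChain`).

The homotopy `G` comes from acyclic models on the cubes. Normalized cubical chains are not free on
models, but they are a natural direct summand of a free functor: the alternating sum over sets `S`
of coordinates of "put the coordinates in `S` equal to `0`" kills degenerate cubes and is the
identity modulo them. So a chain of the model cube defines a natural operation, and every natural
operation arises in this way (`cubeNorm.operation_modelPoint`). Model cubes are contracted by taking
minima with a new coordinate. The homotopy is then built degree by degree, starting from `0` in
degrees `0` and `1`, where `fg` is already the identity.

Finally `g'` is `g` followed by the section. The remaining homotopies come from the natural homotopy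
between `PInfty` and the identity, and everything extends to the augmented complexes by the identity
or by zero. -/

/-! ### Initial infima of finite sequences -/

/-- The infimum of the first `k` entries of a finite sequence. -/
def leadInf {L : Type u} [LinearOrder L] [OrderTop L] {n : ℕ} (a : Fin n → L) (k : ℕ) : L :=
  (Finset.univ.filter fun j : Fin n => (j : ℕ) < k).inf a

section leadInf

variable {L : Type u} [LinearOrder L] [OrderTop L] {n : ℕ}

theorem le_leadInf_iff (a : Fin n → L) (k : ℕ) (c : L) :
    c ≤ leadInf a k ↔ ∀ j : Fin n, (j : ℕ) < k → c ≤ a j := by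
  simp [leadInf]

theorem leadInf_zero (a : Fin n → L) : leadInf a 0 = ⊤ := by
  simp [leadInf]

theorem leadInf_antitone (a : Fin n → L) : Antitone (leadInf a) := fun _ _ h =>
  Finset.inf_mono (by
    intro j
    simp only [Finset.mem_filter_univ]
    omega)

theorem leadInf_mono {a b : Fin n → L} (h : a ≤ b) (k : ℕ) : leadInf a k ≤ leadInf b k :=
  Finset.inf_mono_fun fun j _ => h j

/-- An entry `⊤` does not change an infimum; it only takes up a place in the initial segments that
contain it, whence the shift of `k` beyond `i`. -/
theorem leadInf_insertNth_top (a : Fin n → L) (i : Fin (n + 1)) (k : ℕ) :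
    leadInf (i.insertNth (α := fun _ => L) ⊤ a) k = leadInf a (if k ≤ i then k else k - 1) := by
  refine eq_of_forall_le_iff fun c => ?_
  rw [le_leadInf_iff, le_leadInf_iff, Fin.forall_iff_succAbove i]
  simp only [Fin.insertNth_apply_same, le_top, implies_true, Fin.insertNth_apply_succAbove,
    true_and]
  refine forall_congr' fun j => ?_
  have : ((i.succAbove j : Fin (n + 1)) : ℕ) < k ↔ (j : ℕ) < if k ≤ i then k else k - 1 := by
    simp only [Fin.succAbove, Fin.lt_def]
    grind
  rw [this]

theorem leadInf_insertNth_bot [OrderBot L] (a : Fin n → L) (i : Fin (n + 1)) (k : ℕ) :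
    leadInf (i.insertNth (α := fun _ => L) ⊥ a) k = if k ≤ i then leadInf a k else ⊥ := by
  refine eq_of_forall_le_iff fun c => ?_
  rw [le_leadInf_iff, Fin.forall_iff_succAbove i]
  simp only [Fin.insertNth_apply_same, le_bot_iff, Fin.insertNth_apply_succAbove]
  split_ifs with h
  · rw [le_leadInf_iff]
    constructor
    · rintro ⟨-, h2⟩ j hj
      refine h2 j ?_
      simp only [Fin.succAbove, Fin.lt_def]
      grind
    · intro h2
      refine ⟨fun h' => by omega, fun j hj => h2 j ?_⟩
      simp only [Fin.succAbove, Fin.lt_def] at hj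
      grind
  · rw [le_bot_iff]
    exact ⟨fun h' => h'.1 (by omega), fun h' => ⟨fun _ => h', fun j _ => h' ▸ bot_le⟩⟩

end leadInf

/-- The number of leading ones of a sequence of zeros and ones. -/
def leadOnes {n : ℕ} : (Fin n → Fin 2) →o Fin (n + 1) where
  toFun a := ⟨Nat.findGreatest (fun k => leadInf a k = ⊤) n,
    Nat.lt_succ_of_le (Nat.findGreatest_le n)⟩
  monotone' a b h := by
    refine Nat.findGreatest_mono_left (fun k hk => ?_) n
    exact top_le_iff.mp (hk ▸ leadInf_mono h k)

/-- Initial infima are antitone in `k`, so the indices with value `⊤` form an initial segment and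
`Nat.findGreatest` finds its end. The bound on `k` is needed because the initial infima are constant
from `n` on. -/
theorem le_leadOnes_iff {n : ℕ} (a : Fin n → Fin 2) {k : ℕ} (hk : k ≤ n) :
    k ≤ (leadOnes a : ℕ) ↔ leadInf a k = ⊤ := by
  constructor
  · intro h
    have h0 : leadInf a (leadOnes a : ℕ) = ⊤ :=
      Nat.findGreatest_spec (P := fun k => leadInf a k = ⊤) (Nat.zero_le n) (leadInf_zero a)
    exact top_le_iff.mp (h0 ▸ leadInf_antitone a h)
  · intro h
    exact Nat.le_findGreatest hk h

/-! ### Continuous maps out of cubes -/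

namespace ContMap

open ClosureSpace

/-- A finite product of topological spaces carries the product topology. -/
theorem isContMap_pi_topology {n : ℕ} {Z : Type} [TopologicalSpace Z] {Y : Type}
    [TopologicalSpace Y] (f : (Fin n → Z) → Y) (hf : Continuous f) (A : Set (Fin n → Z)) :
    f '' (@ClosureSpace.pi (Fin n) (fun _ => Z) (fun _ => ofTopology Z)).cl A ⊆
      closure (f '' A) := by
  let _ : ClosureSpace Z := ofTopology Z
  rintro _ ⟨x, hx, rfl⟩
  refine image_closure_subset_closure_image hf ⟨x, ?_, rfl⟩
  rw [mem_closure_iff_nhds]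
  intro t ht
  rw [nhds_pi, Filter.mem_pi] at ht
  obtain ⟨F, -, V, hV, hVt⟩ := ht
  obtain ⟨y, hy, hyV⟩ := hx Finset.univ V (fun i _ => by
    change x i ∈ (closure (V i)ᶜ)ᶜ
    rw [← interior_eq_compl_closure_compl]
    exact mem_interior_iff_mem_nhds.mpr (hV i))
  exact ⟨y, hVt fun i _ => hyV i (Finset.mem_univ i), hy⟩

/-- A finite product of preorders carries the product preorder. -/
theorem isContMap_pi_preorder {n : ℕ} {Z : Type} [Preorder Z] {Y : Type} [Preorder Y]
    (f : (Fin n → Z) → Y) (hf : Monotone f) (A : Set (Fin n → Z)) :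
    f '' (@ClosureSpace.pi (Fin n) (fun _ => Z) (fun _ => ofPreorder Z)).cl A ⊆
      (ofPreorder Y).cl (f '' A) := by
  let _ : ClosureSpace Z := ofPreorder Z
  rintro _ ⟨x, hx, rfl⟩
  -- In the closure of a preorder, the elements below a point form its smallest neighborhood.
  obtain ⟨y, hy, hyV⟩ := hx Finset.univ (fun i => Set.Iic (x i)) (fun i _ => by
    rintro ⟨j, hj, hji⟩
    exact hj hji)
  exact ⟨f y, ⟨y, hy, rfl⟩, hf fun i => hyV i (Finset.mem_univ i)⟩

end ContMap

/-! ### Tail coordinates on simplices -/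

/-- The truth value of `k ≤ x`. -/
def finTail {n : ℕ} (k : ℕ) (x : Fin (n + 1)) : Fin 2 := if k ≤ x.val then 1 else 0

theorem finTail_antitone {n : ℕ} (x : Fin (n + 1)) : Antitone fun k => finTail k x := by
  intro k l h
  simp only [finTail]
  split_ifs
  · exact le_rfl
  · omega
  · exact Fin.zero_le _
  · exact le_rfl

theorem finTail_ext {n : ℕ} {x y : Fin (n + 1)} (h : ∀ k, finTail k x = finTail k y) : x = y := by
  have key : ∀ k, k ≤ x.val ↔ k ≤ y.val := fun k => by
    have hk := h k
    simp only [finTail] at hk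
    split_ifs at hk
    · omega
    · exact absurd hk (by decide)
    · exact absurd hk (by decide)
    · omega
  exact Fin.ext (le_antisymm ((key _).mp le_rfl) ((key _).mpr le_rfl))

/-- The sum of the barycentric coordinates from the `k`-th on. -/
def barTail {n : ℕ} (k : ℕ) (x : stdSimplex ℝ (Fin (n + 1))) : unitInterval :=
  ⟨∑ j with k ≤ Fin.val j, x.1 j, Finset.sum_nonneg fun j _ => x.2.1 j, by
    rw [← x.2.2]
    exact Finset.sum_le_sum_of_subset_of_nonneg (Finset.subset_univ _) fun j _ _ => x.2.1 j⟩

theorem barTail_zero {n : ℕ} (x : stdSimplex ℝ (Fin (n + 1))) : barTail 0 x = 1 := by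
  refine Subtype.ext (Eq.trans ?_ x.2.2)
  simp [barTail]

theorem barTail_of_lt {n k : ℕ} (hk : n < k) (x : stdSimplex ℝ (Fin (n + 1))) :
    barTail k x = 0 := by
  refine Subtype.ext ?_
  refine Finset.sum_eq_zero (s := Finset.univ.filter fun j => k ≤ Fin.val j) fun j hj => ?_
  have h1 := (Finset.mem_filter.mp hj).2
  omega

theorem barTail_antitone {n : ℕ} (x : stdSimplex ℝ (Fin (n + 1))) :
    Antitone fun k => barTail k x := by
  intro k l h
  change ∑ j with l ≤ Fin.val j, x.1 j ≤ ∑ j with k ≤ Fin.val j, x.1 j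
  refine Finset.sum_le_sum_of_subset_of_nonneg (fun j => ?_) fun j _ _ => x.2.1 j
  simp only [Finset.mem_filter_univ]
  omega

theorem barTail_sub {n : ℕ} (x : stdSimplex ℝ (Fin (n + 1))) (j : Fin (n + 1)) :
    x.1 j = (barTail j.val x : ℝ) - barTail (j.val + 1) x := by
  have e : (Finset.univ.filter fun l : Fin (n + 1) => j.val ≤ l.val) =
      insert j (Finset.univ.filter fun l : Fin (n + 1) => j.val + 1 ≤ l.val) := by
    ext l
    simp only [Finset.mem_filter_univ, Finset.mem_insert, Fin.ext_iff]
    omega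
  simp only [barTail]
  rw [e, Finset.sum_insert (by simp), add_sub_cancel_right]

theorem barTail_ext {n : ℕ} {x y : stdSimplex ℝ (Fin (n + 1))}
    (h : ∀ k, barTail k x = barTail k y) : x = y :=
  Subtype.ext (funext fun j => by rw [barTail_sub x, barTail_sub y, h, h])

/-- The hypothesis says that the preimage of the vertices from `k` on is the set of vertices from
`l` on, so these carry the same mass. -/
theorem barTail_map {m n : ℕ} (α : Fin (m + 1) → Fin (n + 1)) {k l : ℕ}
    (h : ∀ j, k ≤ (α j).val ↔ l ≤ j.val) (x : stdSimplex ℝ (Fin (m + 1))) :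
    barTail k (stdSimplex.map α x) = barTail l x := by
  refine Subtype.ext ?_
  change ∑ i with k ≤ Fin.val i, FunOnFinite.linearMap ℝ ℝ α x i = ∑ j with l ≤ Fin.val j, x j
  simp only [FunOnFinite.linearMap_apply_apply]
  rw [Finset.sum_fiberwise_eq_sum_filter]
  simp [h]

/-- Telescoping. It recovers the tail sums of a point from barycentric coordinates given as
successive differences; `k = 0` gives the total mass. -/
theorem sum_filter_sub_succ (g : ℕ → ℝ) {k m : ℕ} (h : k ≤ m) :
    ∑ j : Fin m with k ≤ Fin.val j, (g j.val - g (j.val + 1)) = g k - g m := by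
  rw [Finset.sum_filter, Fin.sum_univ_eq_sum_range (fun j => if k ≤ j then g j - g (j + 1) else 0)]
  induction m, h using Nat.le_induction with
  | base =>
    rw [sub_self]
    exact Finset.sum_eq_zero fun j hj => if_neg (by simpa using hj)
  | succ m h ih =>
    rw [Finset.sum_range_succ, ih, if_pos h]
    ring

/-- The point of the simplex whose tail coordinates are the initial infima of a sequence. -/
noncomputable def barOfInf {n : ℕ} (a : Fin n → unitInterval) : stdSimplex ℝ (Fin (n + 1)) :=
  -- The tail coordinate of index `n + 1` must be `0`, whereas `leadInf a (n + 1)` is still the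
  -- infimum of all entries; hence the case distinction.
  ⟨fun j => ((leadInf a j.val : unitInterval) : ℝ) - if j.val + 1 ≤ n then ((leadInf a (j.val + 1) : unitInterval) : ℝ) else 0, by
    constructor
    · intro j
      beta_reduce
      split_ifs
      · exact sub_nonneg.mpr (leadInf_antitone a (Nat.le_succ _))
      · simpa using (leadInf a j.val).2.1
    · have key := sum_filter_sub_succ
        (fun k => if k ≤ n then ((leadInf a k : unitInterval) : ℝ) else 0) (Nat.zero_le (n + 1))
      simp only [zero_le, Finset.filter_true, leadInf_zero, if_true] at key
      rw [if_neg (by omega)] at key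
      refine Eq.trans (Finset.sum_congr rfl fun j _ => ?_) (key.trans (sub_zero _))
      rw [if_pos (Nat.le_of_lt_succ j.2)]⟩

theorem barTail_barOfInf {n k : ℕ} (hk : k ≤ n) (a : Fin n → unitInterval) :
    barTail k (barOfInf a) = leadInf a k := by
  have key := sum_filter_sub_succ
    (fun k => if k ≤ n then ((leadInf a k : unitInterval) : ℝ) else 0) (hk.trans (Nat.le_succ n))
  refine Subtype.ext ?_
  change ∑ j with k ≤ Fin.val j, (barOfInf a).1 j = _
  refine Eq.trans (Finset.sum_congr rfl fun j _ => ?_) (key.trans ?_)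
  · rw [if_pos (Nat.le_of_lt_succ j.2)]
    rfl
  · simp [hk]

theorem continuous_barOfInf {n : ℕ} : Continuous (barOfInf (n := n)) := by
  have key : ∀ k, Continuous fun a : Fin n → unitInterval => ((leadInf a k : unitInterval) : ℝ) := fun k =>
    continuous_subtype_val.comp (Continuous.finset_inf_apply fun j _ => continuous_apply j)
  refine Continuous.subtype_mk (continuous_pi fun j => (key _).sub ?_) _
  split_ifs
  · exact key _
  · exact continuous_const

namespace IntervalKind

open ClosureSpace

/-! ### The order on the interval -/

/-- For `J₁` the order is not reflected by the indiscrete closure. It serves to write minima and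
leading ones uniformly for the three intervals. -/
noncomputable instance instLinearOrderSpace : (J : IntervalKind) → LinearOrder J.space
  | I => inferInstanceAs (LinearOrder unitInterval)
  | Jplus => inferInstanceAs (LinearOrder (Fin 2))
  | J1 => inferInstanceAs (LinearOrder (Fin 2))

instance instOrderBotSpace (J : IntervalKind) : OrderBot J.space where
  bot := J.zero
  bot_le := by
    cases J
    · exact fun a => bot_le (α := unitInterval)
    · exact fun a => bot_le (α := Fin 2)
    · exact fun a => bot_le (α := Fin 2)

instance instOrderTopSpace (J : IntervalKind) : OrderTop J.space where
  top := J.one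
  le_top := by
    cases J
    · exact fun a => le_top (α := unitInterval)
    · exact fun a => le_top (α := Fin 2)
    · exact fun a => le_top (α := Fin 2)

theorem bot_eq_zero (J : IntervalKind) : (⊥ : J.space) = J.zero := rfl

theorem top_eq_one (J : IntervalKind) : (⊤ : J.space) = J.one := rfl

/-- The coordinates of a point of a cube. -/
def coords (J : IntervalKind) {n : ℕ} (a : J.cube n) : Fin n → J.space :=
  fun j => (J.cubeProj j).toFun a

theorem coords_cubeFace (J : IntervalKind) {n : ℕ} (i : Fin (n + 1)) (t : J.space)
    (a : J.cube n) :
    J.coords ((J.cubeFace i t).toFun a) = i.insertNth (α := fun _ => (J.space : Type)) t (J.coords a) := by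
  funext j
  refine Fin.succAboveCases i ?_ (fun k => ?_) j
  · rw [Fin.insertNth_apply_same]
    exact J.cubeProj_cubeFace_self i t a
  · rw [Fin.insertNth_apply_succAbove]
    exact J.cubeProj_cubeFace_succAbove i t k a

theorem coords_injective (J : IntervalKind) {n : ℕ} : Function.Injective (J.coords (n := n)) :=
  fun _ _ h => J.cube_ext fun j => congrFun h j

/-- The minimum of two coordinates, as a continuous map on the square. -/
noncomputable def squareInf : (J : IntervalKind) → ContMap (J.cube 2) J.space
  | I =>
    { toFun := fun a : Fin 2 → unitInterval => a 0 ⊓ a 1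
      image_cl_subset := ContMap.isContMap_pi_topology (fun a : Fin 2 → unitInterval => a 0 ⊓ a 1)
        ((continuous_apply 0).inf (continuous_apply 1)) }
  | Jplus =>
    { toFun := fun a : Fin 2 → Fin 2 => a 0 ⊓ a 1
      image_cl_subset := ContMap.isContMap_pi_preorder (fun a : Fin 2 → Fin 2 => a 0 ⊓ a 1)
        (fun _ _ h => inf_le_inf (h 0) (h 1)) }
  | J1 => ContMap.toIndiscrete (X := J1.cube 2) (fun a : Fin 2 → Fin 2 => a 0 ⊓ a 1)

/-- The pointwise minimum of two continuous maps to the interval. -/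
noncomputable def infMap (J : IntervalKind) {Y : Type u} [ClosureSpace Y]
    (a b : ContMap Y J.space) : ContMap Y J.space :=
  J.squareInf.comp (J.cubeLift ![a, b])

theorem infMap_apply (J : IntervalKind) {Y : Type u} [ClosureSpace Y]
    (a b : ContMap Y J.space) (y : Y) : (J.infMap a b).toFun y = a.toFun y ⊓ b.toFun y := by
  cases J <;> rfl

/-! ### Coordinates on simplices -/

/-- The `k`-th tail coordinate of a point of a simplex: the sum of the barycentric coordinates
from `k` on in the topological case, and the truth value of `k ≤ x` in the discrete cases. -/
noncomputable def tail : (J : IntervalKind) → {n : ℕ} → ℕ → J.simplex n → J.space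
  | I, n, k => barTail (n := n) k
  | Jplus, n, k => finTail (n := n) k
  | J1, n, k => finTail (n := n) k

theorem tail_zero (J : IntervalKind) {n : ℕ} (x : J.simplex n) : J.tail 0 x = ⊤ := by
  cases J
  · exact barTail_zero _
  · rfl
  · rfl

theorem tail_of_lt (J : IntervalKind) {n k : ℕ} (hk : n < k) (x : J.simplex n) :
    J.tail k x = ⊥ := by
  cases J
  · exact barTail_of_lt hk _
  · exact if_neg (by have := Fin.is_lt (n := n + 1) x; omega)
  · exact if_neg (by have := Fin.is_lt (n := n + 1) x; omega)

theorem tail_antitone (J : IntervalKind) {n : ℕ} (x : J.simplex n) :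
    Antitone fun k => J.tail k x := by
  cases J
  · exact barTail_antitone _
  · exact finTail_antitone _
  · exact finTail_antitone _

/-- This reduces identities between points of simplices, for all three intervals at once, to
identities of tail coordinates, on which simplicial maps act by reindexing and the collapse by
initial infima. -/
theorem tail_ext (J : IntervalKind) {n : ℕ} {x y : J.simplex n}
    (h : ∀ k, k ≤ n → J.tail k x = J.tail k y) : x = y := by
  have h' : ∀ k, J.tail k x = J.tail k y := fun k => by
    rcases le_or_gt k n with hk | hk
    · exact h k hk
    · rw [J.tail_of_lt hk, J.tail_of_lt hk]
  cases J
  · exact barTail_ext h'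
  · exact finTail_ext h'
  · exact finTail_ext h'

theorem tail_simplexMap (J : IntervalKind) {m n : ℕ} (α : Fin (m + 1) →o Fin (n + 1)) {k l : ℕ}
    (h : ∀ j : Fin (m + 1), k ≤ (α j).val ↔ l ≤ j.val) (x : J.simplex m) :
    J.tail k ((J.simplexMap α).toFun x) = J.tail l x := by
  cases J
  · exact barTail_map α h x
  · exact if_congr (h x) rfl rfl
  · exact if_congr (h x) rfl rfl

/-- A monotone map exceeds a given value from some threshold on. -/
theorem exists_threshold {m n : ℕ} (α : Fin (m + 1) →o Fin (n + 1)) (k : ℕ) :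
    ∃ l : ℕ, ∀ j : Fin (m + 1), k ≤ (α j).val ↔ l ≤ j.val := by
  by_cases h : ∃ j : Fin (m + 1), k ≤ (α j).val
  · obtain ⟨j₀, hj₀, hmin⟩ := WellFounded.has_min wellFounded_lt {j | k ≤ (α j).val} h
    exact ⟨j₀, fun j => ⟨fun hj => le_of_not_gt (hmin j hj), fun hj => hj₀.trans (α.monotone hj)⟩⟩
  · push Not at h
    exact ⟨m + 1, fun j => ⟨fun hj => absurd (h j) (by omega), fun hj => by omega⟩⟩

theorem tail_one_eq_inv (J : IntervalKind) (x : J.simplex 1) :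
    J.tail 1 x = J.spaceIsoSimplexOne.inv.toFun x := by
  have key : ∀ y : Fin 2, finTail 1 y = y := by decide
  cases J
  · refine Subtype.ext (α := ℝ) ?_
    change ∑ j : Fin 2 with 1 ≤ Fin.val j, Subtype.val (p := (· ∈ stdSimplex ℝ (Fin 2))) x j =
      Subtype.val (p := (· ∈ stdSimplex ℝ (Fin 2))) x 1
    rw [Finset.sum_filter, Fin.sum_univ_two]
    simp
  · exact key x
  · exact key x

/-! ### Comparing cubes and simplices -/

/-- The collapse of a cube onto a simplex, whose tail coordinates are the initial infima of the
coordinates. -/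
noncomputable def collapse : (J : IntervalKind) → (n : ℕ) → ContMap (J.cube n) (J.simplex n)
  | I, n =>
    { toFun := barOfInf (n := n)
      image_cl_subset := ContMap.isContMap_pi_topology barOfInf continuous_barOfInf }
  | Jplus, n =>
    { toFun := leadOnes (n := n)
      image_cl_subset := ContMap.isContMap_pi_preorder leadOnes leadOnes.monotone }
  | J1, n => ContMap.toIndiscrete (X := J1.cube n) (leadOnes (n := n))

theorem finTail_leadOnes {n k : ℕ} (hk : k ≤ n) (a : Fin n → Fin 2) :
    finTail k (leadOnes a) = leadInf a k := by
  have h := le_leadOnes_iff a hk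
  by_cases h' : leadInf a k = ⊤
  · rw [h']
    exact if_pos (h.mpr h')
  · rw [show leadInf a k = 0 by
      revert h'
      generalize leadInf a k = b
      revert b
      decide]
    exact if_neg (fun h'' => h' (h.mp h''))

/-- The characterization through which the collapse is used from here on. It stops at `k = n`:
beyond, the tail coordinate is `⊥` while the initial infimum no longer changes. -/
theorem tail_collapse (J : IntervalKind) {n k : ℕ} (hk : k ≤ n) (a : J.cube n) :
    J.tail k ((J.collapse n).toFun a) = leadInf (J.coords a) k := by
  cases J
  · exact barTail_barOfInf hk _
  · exact finTail_leadOnes hk _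
  · exact finTail_leadOnes hk _

/-- The threshold of the value `k` for the face inclusion omitting `i`. -/
theorem le_succAbove_iff {n k : ℕ} (i : Fin (n + 2)) (j : Fin (n + 1)) :
    k ≤ (i.succAbove j).val ↔ (if k ≤ i.val then k else k - 1) ≤ j.val := by
  simp only [Fin.succAbove, Fin.lt_def]
  grind

/-- Inserting a coordinate `1` reindexes the initial infima in the same way as omitting the vertex
`i` reindexes tail coordinates. -/
theorem collapse_comp_cubeFace_one (J : IntervalKind) {n : ℕ} (i : Fin (n + 1)) :
    (J.collapse (n + 1)).comp (J.cubeFace i J.one) =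
      (J.simplexMap (Fin.succAboveOrderEmb i.castSucc).toOrderHom).comp (J.collapse n) := by
  refine ContMap.ext (funext fun a => J.tail_ext fun k hk => ?_)
  change J.tail k ((J.collapse (n + 1)).toFun ((J.cubeFace i J.one).toFun a)) =
    J.tail k ((J.simplexMap _).toFun ((J.collapse n).toFun a))
  rw [J.tail_collapse hk, J.coords_cubeFace, ← top_eq_one, leadInf_insertNth_top,
    J.tail_simplexMap _ (fun j => le_succAbove_iff i.castSucc j), J.tail_collapse]
  · rfl
  · simp only [Fin.val_castSucc]
    split_ifs <;> omega

/-- A final coordinate `0` leaves all initial infima unchanged except the one of index `n + 1`,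
which becomes `⊥`: the last barycentric coordinate vanishes. -/
theorem collapse_comp_cubeFace_last_zero (J : IntervalKind) {n : ℕ} :
    (J.collapse (n + 1)).comp (J.cubeFace (Fin.last n) J.zero) =
      (J.simplexMap (Fin.succAboveOrderEmb (Fin.last (n + 1))).toOrderHom).comp (J.collapse n) := by
  refine ContMap.ext (funext fun a => J.tail_ext fun k hk => ?_)
  change J.tail k ((J.collapse (n + 1)).toFun ((J.cubeFace (Fin.last n) J.zero).toFun a)) =
    J.tail k ((J.simplexMap _).toFun ((J.collapse n).toFun a))
  rw [J.tail_collapse hk, J.coords_cubeFace, ← bot_eq_zero, leadInf_insertNth_bot,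
    J.tail_simplexMap _ (fun j => le_succAbove_iff (Fin.last (n + 1)) j)]
  simp only [Fin.val_last, if_pos hk]
  split_ifs with h
  · rw [J.tail_collapse h]
  · rw [J.tail_of_lt (by omega)]

/-- The idempotent of a cube replacing the `i`-th coordinate by `0`. -/
def cubeZeroAt (J : IntervalKind) {n : ℕ} (i : Fin (n + 1)) :
    ContMap (J.cube (n + 1)) (J.cube (n + 1)) :=
  (J.cubeFace i J.zero).comp (J.cubeDegen i)

/-- With a `0` inserted at `i`, the initial infima of index greater than `i` are `⊥`, and the others
involve only the first `i ≤ n` coordinates of the `(n + 1)`-cube, never the last one. The form of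
the right-hand side exhibits the face as degenerate. -/
theorem collapse_comp_cubeFace_zero (J : IntervalKind) {n : ℕ} (i : Fin (n + 1)) :
    (J.collapse (n + 2)).comp (J.cubeFace i.castSucc J.zero) =
      ((J.collapse (n + 2)).comp (J.cubeFace i.castSucc J.zero)).comp
        (J.cubeZeroAt (Fin.last n)) := by
  refine ContMap.ext (funext fun a => J.tail_ext fun k hk => ?_)
  change J.tail k ((J.collapse (n + 2)).toFun ((J.cubeFace i.castSucc J.zero).toFun a)) =
    J.tail k ((J.collapse (n + 2)).toFun ((J.cubeFace i.castSucc J.zero).toFun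
      ((J.cubeFace (Fin.last n) J.zero).toFun ((J.cubeDegen (Fin.last n)).toFun a))))
  rw [J.tail_collapse hk, J.tail_collapse hk, J.coords_cubeFace, J.coords_cubeFace,
    J.coords_cubeFace, ← bot_eq_zero]
  simp only [leadInf_insertNth_bot, Fin.val_castSucc, Fin.val_last]
  split_ifs with h h'
  · refine eq_of_forall_le_iff fun c => ?_
    rw [le_leadInf_iff, le_leadInf_iff, Fin.forall_fin_succ']
    have e : ∀ j : Fin n, J.coords ((J.cubeDegen (Fin.last n)).toFun a) j =
        J.coords a j.castSucc := fun j => congrArg (J.coords a) (Fin.succAbove_last_apply j)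
    simp only [e]
    constructor
    · exact fun h'' j hj => h''.1 j hj
    · exact fun h'' => ⟨fun j hj => h'' j hj, fun hj => by simp at hj; omega⟩
  · omega
  · rfl

/-! ### Simplices spanned by vertices of a cube, and their collapse -/

/-- The continuous map from a simplex to a cube determined by a monotone map of vertices. -/
noncomputable def vert (J : IntervalKind) {m n : ℕ} (α : Fin (m + 1) →o (Fin n → Fin 2)) :
    ContMap (J.simplex m) (J.cube n) :=
  J.cubeLift fun i => J.spaceIsoSimplexOne.inv.comp
    (J.simplexMap ((Pi.evalOrderHom i).comp α))

theorem vert_comp_simplexMap (J : IntervalKind) {l m n : ℕ} (α : Fin (m + 1) →o (Fin n → Fin 2))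
    (β : Fin (l + 1) →o Fin (m + 1)) :
    (J.vert α).comp (J.simplexMap β) = J.vert (α.comp β) := by
  refine ContMap.ext (funext fun x => J.cube_ext fun i => ?_)
  have h := J.simplexMap_comp ((Pi.evalOrderHom i).comp α) β
  change J.spaceIsoSimplexOne.inv.toFun (((J.simplexMap ((Pi.evalOrderHom i).comp α)).comp
    (J.simplexMap β)).toFun x) = _
  rw [← h]
  rfl

theorem coords_vert (J : IntervalKind) {m n : ℕ} (α : Fin (m + 1) →o (Fin n → Fin 2))
    (x : J.simplex m) (i : Fin n) :
    J.coords ((J.vert α).toFun x) i =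
      J.tail 1 ((J.simplexMap ((Pi.evalOrderHom i).comp α)).toFun x) :=
  (J.tail_one_eq_inv _).symm

/-- The `i`-th coordinate of `J.vert α` is the tail coordinate whose index `t i` is the first place
where `α` has `i`-th entry `1`. Tail coordinates decrease with the index, so the minimum of the
first `k` of them is the tail coordinate at the largest of the thresholds `t i`. That largest
threshold is reached at `j` exactly when the first `k` entries of `α j` are all `1`. -/
theorem collapse_comp_vert (J : IntervalKind) {m n : ℕ} (α : Fin (m + 1) →o (Fin n → Fin 2)) :
    (J.collapse n).comp (J.vert α) = J.simplexMap (leadOnes.comp α) := by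
  refine ContMap.ext (funext fun x => J.tail_ext fun k hk => ?_)
  change J.tail k ((J.collapse n).toFun ((J.vert α).toFun x)) = _
  choose t ht using fun i : Fin n => exists_threshold ((Pi.evalOrderHom i).comp α) 1
  have h : ∀ j : Fin (m + 1), k ≤ (leadOnes.comp α j).val ↔
      (Finset.univ.filter fun i : Fin n => i.val < k).sup t ≤ j.val := by
    intro j
    change k ≤ (leadOnes (α j)).val ↔ _
    rw [le_leadOnes_iff _ hk, Finset.sup_le_iff, ← top_le_iff, le_leadInf_iff]
    refine forall_congr' fun i => ?_
    rw [Finset.mem_filter_univ, ← ht]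
    refine imp_congr_right fun _ => ?_
    change ⊤ ≤ α j i ↔ 1 ≤ (α j i).val
    generalize α j i = b
    revert b
    decide
  rw [J.tail_collapse hk, J.tail_simplexMap _ h]
  refine eq_of_forall_le_iff fun c => ?_
  rw [le_leadInf_iff]
  simp only [coords_vert, fun i => J.tail_simplexMap _ (ht i) x]
  generalize hs : (Finset.univ.filter fun i : Fin n => i.val < k) = s
  have hs' : ∀ i : Fin n, i.val < k ↔ i ∈ s := fun i => by simp [← hs]
  simp only [hs']
  clear hs hs' h
  induction s using Finset.induction_on with
  | empty => simp [tail_zero]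
  | insert i s _ ih =>
    rw [Finset.sup_insert, (J.tail_antitone x).map_sup, le_inf_iff, Finset.forall_mem_insert]
    exact and_congr Iff.rfl ih

end IntervalKind

/-! ### Normalized chains of simplicial sets -/

/-- The normalized chains of a simplicial set. -/
noncomputable def normChains (S : SSet.{u}) : ChainComplex AddCommGrpCat.{u} ℕ :=
  quotientComplex ((AlgebraicTopology.alternatingFaceMapComplex AddCommGrpCat).obj
    (((SimplicialObject.whiskering _ _).obj AddCommGrpCat.free).obj S))
    (degenerateSimplices _) (degenerateSimplices_le _)

namespace normChains

/-- The projection from chains to normalized chains. -/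
noncomputable def proj (S : SSet.{u}) (n : ℕ) :
    FreeAbelianGroup (S.obj (Opposite.op (SimplexCategory.mk n))) →+ (normChains S).X n :=
  QuotientAddGroup.mk' (degenerateSimplices
    (((SimplicialObject.whiskering _ _).obj AddCommGrpCat.free).obj S) n)

/-- The class of a simplex. -/
noncomputable def cls {S : SSet.{u}} {n : ℕ} (x : S.obj (Opposite.op (SimplexCategory.mk n))) :
    (normChains S).X n :=
  proj S n (FreeAbelianGroup.of x)

theorem alternatingFaceMapComplex_d_apply (A : SimplicialObject AddCommGrpCat.{u}) {n : ℕ}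
    (y : A.obj (Opposite.op (SimplexCategory.mk (n + 1)))) :
    ((AlgebraicTopology.AlternatingFaceMapComplex.obj A).d (n + 1) n).hom y =
      ∑ i : Fin (n + 2), (-1 : ℤ) ^ i.val • (A.δ i).hom y := by
  rw [AlgebraicTopology.AlternatingFaceMapComplex.obj_d_eq]
  change (AddCommGrpCat.homAddEquiv (∑ i : Fin (n + 2), (-1 : ℤ) ^ (i : ℕ) • A.δ i)) y = _
  rw [map_sum, AddMonoidHom.finsetSum_apply]
  refine Finset.sum_congr rfl fun i _ => ?_
  rw [map_zsmul]
  rfl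

/-- The map induced on normalized chains by a map of simplicial sets. -/
noncomputable def map {S T : SSet.{u}} (φ : S ⟶ T) : normChains S ⟶ normChains T :=
  quotientMap (degenerateSimplices_le _) (degenerateSimplices_le _)
    ((AlgebraicTopology.alternatingFaceMapComplex AddCommGrpCat).map
      (((SimplicialObject.whiskering _ _).obj AddCommGrpCat.free).map φ))
    (degenerateSimplices_map _)

theorem hom_ext {S : SSet.{u}} {n : ℕ} {A : Type v} [AddCommGroup A]
    {f g : (normChains S).X n →+ A} (h : ∀ x, f (cls x) = g (cls x)) : f = g := by
  refine QuotientAddGroup.addMonoidHom_ext _ ?_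
  exact FreeAbelianGroup.lift_ext (f.comp (proj S n)) (g.comp (proj S n)) h

theorem map_cls {S T : SSet.{u}} (φ : S ⟶ T) {n : ℕ}
    (x : S.obj (Opposite.op (SimplexCategory.mk n))) :
    (map φ).f n (cls x) = cls (φ.app _ x) :=
  congrArg (QuotientAddGroup.mk' (degenerateSimplices
    (((SimplicialObject.whiskering _ _).obj AddCommGrpCat.free).obj T) n))
    (FreeAbelianGroup.map_of_apply x)

theorem d_cls {S : SSet.{u}} {n : ℕ} (x : S.obj (Opposite.op (SimplexCategory.mk (n + 1)))) :
    (normChains S).d (n + 1) n (cls x) = ∑ i : Fin (n + 2), (-1 : ℤ) ^ i.val • cls (S.δ i x) := by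
  have h := alternatingFaceMapComplex_d_apply
    (((SimplicialObject.whiskering _ _).obj AddCommGrpCat.free).obj S) (FreeAbelianGroup.of x)
  refine (congrArg (proj S n) h).trans ?_
  refine (map_sum (proj S n) _ _).trans (Finset.sum_congr rfl fun i _ => ?_)
  refine (map_zsmul (proj S n) _ _).trans (congrArg ((-1 : ℤ) ^ i.val • ·) ?_)
  exact congrArg (proj S n) (FreeAbelianGroup.map_of_apply x)

theorem cls_σ {S : SSet.{u}} {n : ℕ} (i : Fin (n + 1))
    (x : S.obj (Opposite.op (SimplexCategory.mk n))) : cls (S.σ i x) = 0 := by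
  let A := ((SimplicialObject.whiskering _ _).obj AddCommGrpCat.free).obj S
  refine (QuotientAddGroup.eq_zero_iff (N := degenerateSimplices A (n + 1)) _).mpr ?_
  exact AddSubgroup.mem_iSup_of_mem i ⟨FreeAbelianGroup.of x, FreeAbelianGroup.map_of_apply x⟩

theorem degenerateSimplices_le_ker_lift {S : SSet.{u}} {n : ℕ} {A : Type v} [AddCommGroup A]
    (f : S.obj (Opposite.op (SimplexCategory.mk (n + 1))) → A)
    (hf : ∀ (i : Fin (n + 1)) (x : S.obj (Opposite.op (SimplexCategory.mk n))),
      f (S.σ i x) = 0) :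
    degenerateSimplices (((SimplicialObject.whiskering _ _).obj AddCommGrpCat.free).obj S) (n + 1) ≤
      (FreeAbelianGroup.lift f).ker := by
  refine iSup_le fun i => ?_
  rintro _ ⟨y, rfl⟩
  have h : (FreeAbelianGroup.lift f).comp (FreeAbelianGroup.map (S.σ i)) = 0 := by
    ext x
    change FreeAbelianGroup.lift f (FreeAbelianGroup.map _ (FreeAbelianGroup.of x)) = 0
    rw [FreeAbelianGroup.map_of_apply, FreeAbelianGroup.lift_apply_of]
    exact hf i x
  exact DFunLike.congr_fun h y

/-- A function on simplices which vanishes on degenerate simplices extends to normalized chains. -/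
noncomputable def lift {S : SSet.{u}} {n : ℕ} {A : Type v} [AddCommGroup A]
    (f : S.obj (Opposite.op (SimplexCategory.mk (n + 1))) → A)
    (hf : ∀ (i : Fin (n + 1)) (x : S.obj (Opposite.op (SimplexCategory.mk n))),
      f (S.σ i x) = 0) : (normChains S).X (n + 1) →+ A :=
  QuotientAddGroup.lift (degenerateSimplices _ (n + 1)) (FreeAbelianGroup.lift f)
    (degenerateSimplices_le_ker_lift f hf)

theorem lift_cls {S : SSet.{u}} {n : ℕ} {A : Type v} [AddCommGroup A]
    (f : S.obj (Opposite.op (SimplexCategory.mk (n + 1))) → A)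
    (hf : ∀ (i : Fin (n + 1)) (x : S.obj (Opposite.op (SimplexCategory.mk n))),
      f (S.σ i x) = 0) (x) : lift f hf (cls x) = f x :=
  FreeAbelianGroup.lift_apply_of f x

/-- A function on vertices extends to normalized chains. -/
noncomputable def liftZero {S : SSet.{u}} {A : Type v} [AddCommGroup A]
    (f : S.obj (Opposite.op (SimplexCategory.mk 0)) → A) : (normChains S).X 0 →+ A :=
  QuotientAddGroup.lift (degenerateSimplices _ 0) (FreeAbelianGroup.lift f) bot_le

theorem liftZero_cls {S : SSet.{u}} {A : Type v} [AddCommGroup A]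
    (f : S.obj (Opposite.op (SimplexCategory.mk 0)) → A) (x) : liftZero f (cls x) = f x :=
  FreeAbelianGroup.lift_apply_of f x

theorem map_comp_apply {S T U : SSet.{u}} (φ : S ⟶ T) (ψ : T ⟶ U) {n : ℕ}
    (x : (normChains S).X n) : (map (φ ≫ ψ)).f n x = (map ψ).f n ((map φ).f n x) := by
  refine DFunLike.congr_fun (f := ((map (φ ≫ ψ)).f n).hom)
    (g := ((map ψ).f n).hom.comp ((map φ).f n).hom) (hom_ext fun y => ?_) x
  change (map (φ ≫ ψ)).f n (cls y) = (map ψ).f n ((map φ).f n (cls y))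
  rw [map_cls, map_cls, map_cls]
  rfl

theorem d_map {S T : SSet.{u}} (φ : S ⟶ T) {m n : ℕ} (x : (normChains S).X m) :
    (normChains T).d m n ((map φ).f m x) = (map φ).f n ((normChains S).d m n x) := by
  rw [← ConcreteCategory.comp_apply, ← ConcreteCategory.comp_apply, (map φ).comm]

end normChains

/-! ### Normalized cubical chains -/

namespace cubeNorm

variable {J : IntervalKind} {X Y : ClCat.{u}}

variable (J X) in
/-- The projection from cubical chains to normalized cubical chains. -/
def proj (n : ℕ) : FreeAbelianGroup (ContMap (J.cube n) X) →+ ((cubeNorm J).obj X).X n :=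
  QuotientAddGroup.mk' (degenerateCubes J X n)

/-- The class of a singular cube. -/
def cls {n : ℕ} (τ : ContMap (J.cube n) X) : ((cubeNorm J).obj X).X n :=
  proj J X n (FreeAbelianGroup.of τ)

theorem hom_ext {n : ℕ} {A : Type v} [AddCommGroup A]
    {f g : ((cubeNorm J).obj X).X n →+ A} (h : ∀ τ, f (cls τ) = g (cls τ)) : f = g := by
  refine QuotientAddGroup.addMonoidHom_ext _ ?_
  exact FreeAbelianGroup.lift_ext (f.comp (proj J X n)) (g.comp (proj J X n)) h

theorem map_cls (φ : X ⟶ Y) {n : ℕ} (τ : ContMap (J.cube n) X) :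
    ((cubeNorm J).map φ).f n (cls τ) = cls (ContMap.comp φ τ) :=
  congrArg (QuotientAddGroup.mk' (degenerateCubes J Y n)) (FreeAbelianGroup.map_of_apply τ)

theorem d_cls {n : ℕ} (τ : ContMap (J.cube (n + 1)) X) :
    ((cubeNorm J).obj X).d (n + 1) n (cls τ) = ∑ i : Fin (n + 1), (-1 : ℤ) ^ (i.val + 1) •
      (cls (τ.comp (J.cubeFace i J.zero)) - cls (τ.comp (J.cubeFace i J.one))) := by
  change proj J X n (((cubeComplex J X).d (n + 1) n).hom (FreeAbelianGroup.of τ)) = _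
  rw [cubeComplex_d]
  change proj J X n (cubeBoundary J X n (FreeAbelianGroup.of τ)) = _
  rw [cubeBoundary, AddMonoidHom.finsetSum_apply, map_sum]
  refine Finset.sum_congr rfl fun i _ => ?_
  rw [AddMonoidHom.smul_apply, map_zsmul, cubeFaceDiff, AddMonoidHom.sub_apply,
    FreeAbelianGroup.map_of_apply, FreeAbelianGroup.map_of_apply, map_sub]
  rfl

theorem cls_degen {n : ℕ} (i : Fin (n + 1)) (τ : ContMap (J.cube n) X) :
    cls (τ.comp (J.cubeDegen i)) = 0 :=
  (QuotientAddGroup.eq_zero_iff (N := degenerateCubes J X (n + 1)) _).mpr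
    (AddSubgroup.subset_closure ⟨i, τ, rfl⟩)

/-- A function on singular cubes which vanishes on degenerate cubes extends to normalized
chains. -/
def lift {n : ℕ} {A : Type v} [AddCommGroup A] (f : ContMap (J.cube n) X → A)
    (hf : ∀ (m : ℕ) (h : m + 1 = n) (i : Fin (m + 1)) (τ : ContMap (J.cube m) X),
      f (h ▸ τ.comp (J.cubeDegen i)) = 0) : ((cubeNorm J).obj X).X n →+ A :=
  QuotientAddGroup.lift (degenerateCubes J X n) (FreeAbelianGroup.lift f) (by
    cases n with
    | zero => exact bot_le
    | succ n =>
      refine (AddSubgroup.closure_le _).mpr ?_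
      rintro _ ⟨i, τ, rfl⟩
      exact (FreeAbelianGroup.lift_apply_of f _).trans (hf n rfl i τ))

theorem lift_cls {n : ℕ} {A : Type v} [AddCommGroup A] (f : ContMap (J.cube n) X → A) (hf)
    (τ : ContMap (J.cube n) X) : lift f hf (cls τ) = f τ :=
  FreeAbelianGroup.lift_apply_of f τ

end cubeNorm

/-! ### Nerves of partially ordered sets -/

/-- The nerve of a partially ordered set. -/
def posetNerve (P : Type) [PartialOrder P] : SSet.{u} where
  obj n := ULift.{u} (Fin (n.unop.len + 1) →o P)
  map α := ↾fun c => ⟨c.down.comp α.unop.toOrderHom⟩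

namespace posetNerve

variable {P R : Type} [PartialOrder P] [PartialOrder R]

/-- The map of nerves induced by a monotone map. -/
def map (φ : P →o R) : posetNerve.{u} P ⟶ posetNerve.{u} R where
  app _ := ↾fun c => ⟨φ.comp c.down⟩

/-- The class of a chain of elements. -/
noncomputable def cls {n : ℕ} (c : Fin (n + 1) →o P) : (normChains (posetNerve.{u} P)).X n :=
  normChains.cls (S := posetNerve.{u} P) ⟨c⟩

theorem hom_ext {n : ℕ} {A : Type v} [AddCommGroup A]
    {f g : (normChains (posetNerve.{u} P)).X n →+ A} (h : ∀ c, f (cls c) = g (cls c)) : f = g :=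
  normChains.hom_ext fun x => h x.down

theorem map_cls (φ : P →o R) {n : ℕ} (c : Fin (n + 1) →o P) :
    (normChains.map (map.{u} φ)).f n (cls c) = cls (φ.comp c) :=
  normChains.map_cls _ _

theorem map_map {Q : Type} [PartialOrder Q] (φ : P →o R) (ψ : R →o Q) {n : ℕ}
    (x : (normChains (posetNerve.{u} P)).X n) :
    (normChains.map (map.{u} ψ)).f n ((normChains.map (map.{u} φ)).f n x) =
      (normChains.map (map.{u} (ψ.comp φ))).f n x :=
  (normChains.map_comp_apply (map φ) (map ψ) x).symm

theorem d_cls {n : ℕ} (c : Fin (n + 2) →o P) :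
    (normChains (posetNerve.{u} P)).d (n + 1) n (cls c) =
      ∑ i : Fin (n + 2), (-1 : ℤ) ^ i.val • cls (c.comp (Fin.succAboveOrderEmb i).toOrderHom) :=
  normChains.d_cls (S := posetNerve.{u} P) ⟨c⟩

theorem cls_eq_zero {n : ℕ} (c : Fin (n + 2) →o P) (i : Fin (n + 1))
    (h : c i.castSucc = c i.succ) : cls.{u} c = 0 := by
  have e : (⟨c⟩ : (posetNerve.{u} P).obj (Opposite.op (SimplexCategory.mk (n + 1)))) =
      -- Deleting the entry `i + 1` and then repeating the entry `i` gives `c` back, since the two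
      -- entries agree.
      (posetNerve.{u} P).σ i ⟨c.comp (Fin.succAboveOrderEmb i.succ).toOrderHom⟩ := by
    refine ULift.ext _ _ (OrderHom.ext _ _ (funext fun j => ?_))
    change c j = c (i.succ.succAbove (i.predAbove j))
    by_cases hj : j = i.succ
    · subst hj
      rw [Fin.predAbove_succ_self, Fin.succAbove_of_castSucc_lt _ _ Fin.castSucc_lt_succ, h]
    · rw [Fin.succ_succAbove_predAbove hj]
  exact (congrArg (normChains.cls (S := posetNerve.{u} P)) e).trans (normChains.cls_σ i _)

/-- A chain with nonzero class is strictly increasing, so the rank grows by at least one at each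
step and the last of the `n + 1` elements has rank at least `n`. -/
theorem cls_eq_zero_of_rank {n : ℕ} (r : P → ℕ) (hr : StrictMono r) (c : Fin (n + 1) →o P)
    (h : r (c (Fin.last n)) < n) : cls.{u} c = 0 := by
  cases n with
  | zero => omega
  | succ n =>
    by_contra hc
    have hs : StrictMono c := Fin.strictMono_iff_lt_succ.mpr fun i =>
      lt_of_le_of_ne (c.monotone Fin.castSucc_lt_succ.le) fun hi => hc (cls_eq_zero c i hi)
    have key : ∀ i : Fin (n + 2), i.val ≤ r (c i) := by
      intro i
      induction i using Fin.induction with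
      | zero => exact Nat.zero_le _
      | succ i ih =>
        have := hr (hs (Fin.castSucc_lt_succ (i := i)))
        simp only [Fin.val_castSucc] at ih
        simp only [Fin.val_succ]
        omega
    have := key (Fin.last (n + 1))
    simp only [Fin.val_last] at this
    omega

theorem eq_zero_of_rank {n : ℕ} (r : P → ℕ) (hr : StrictMono r) (h : ∀ p, r p < n)
    (x : (normChains (posetNerve.{u} P)).X n) : x = 0 :=
  DFunLike.congr_fun (hom_ext (f := AddMonoidHom.id _) (g := 0)
    fun c => cls_eq_zero_of_rank r hr c (h _)) x

/-! #### The cone contraction -/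

variable [OrderBot P]

/-- The chain obtained by adding a least element. -/
def coneChain {n : ℕ} (c : Fin (n + 1) →o P) : Fin (n + 2) →o P where
  toFun := Fin.cons ⊥ c
  monotone' := by
    intro i j h
    induction i using Fin.cases with
    | zero => exact bot_le
    | succ i =>
      induction j using Fin.cases with
      | zero => exact absurd h (by simp)
      | succ j => exact c.monotone (Fin.succ_le_succ_iff.mp h)

theorem coneChain_face_zero {n : ℕ} (c : Fin (n + 1) →o P) :
    (coneChain c).comp (Fin.succAboveOrderEmb 0).toOrderHom = c := by
  refine OrderHom.ext _ _ (funext fun j => ?_)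
  change (Fin.cons ⊥ c : Fin (n + 2) → P) ((0 : Fin (n + 2)).succAbove j) = c j
  rw [Fin.zero_succAbove, Fin.cons_succ]

theorem coneChain_face_succ {n : ℕ} (c : Fin (n + 2) →o P) (i : Fin (n + 2)) :
    (coneChain c).comp (Fin.succAboveOrderEmb i.succ).toOrderHom =
      coneChain (c.comp (Fin.succAboveOrderEmb i).toOrderHom) := by
  refine OrderHom.ext _ _ (funext fun j => ?_)
  change (Fin.cons ⊥ c : Fin (n + 3) → P) (i.succ.succAbove j) =
    (Fin.cons ⊥ (fun l => c (i.succAbove l)) : Fin (n + 2) → P) j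
  induction j using Fin.cases with
  | zero => rw [Fin.succ_succAbove_zero]; rfl
  | succ j => rw [Fin.succ_succAbove_succ]; rfl

theorem cls_coneChain_σ {n : ℕ} (i : Fin (n + 1))
    (c : (posetNerve.{u} P).obj (Opposite.op (SimplexCategory.mk n))) :
    cls.{u} (coneChain (ULift.down ((posetNerve.{u} P).σ i c))) = 0 := by
  refine cls_eq_zero _ i.succ ?_
  change c.down (i.predAbove i.castSucc) = c.down (i.predAbove i.succ)
  rw [Fin.predAbove_castSucc_self, Fin.predAbove_succ_self]

/-- The cone operator on the normalized chains of the nerve of a partially ordered set with a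
least element. -/
noncomputable def cone : (n : ℕ) →
    (normChains (posetNerve.{u} P)).X n →+ (normChains (posetNerve.{u} P)).X (n + 1)
  | 0 => normChains.liftZero fun c => cls (coneChain c.down)
  | _ + 1 => normChains.lift (fun c => cls (coneChain c.down)) cls_coneChain_σ

theorem cone_cls {n : ℕ} (c : Fin (n + 1) →o P) : cone n (cls.{u} c) = cls (coneChain c) := by
  cases n with
  | zero => exact normChains.liftZero_cls _ _
  | succ n => exact normChains.lift_cls _ cls_coneChain_σ _

/-- Omitting the added bottom element returns the chain itself; the other faces are cones on its
faces, with signs reversed by the shift of the index. -/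
theorem d_cone {n : ℕ} (x : (normChains (posetNerve.{u} P)).X (n + 1)) :
    (normChains (posetNerve.{u} P)).d (n + 2) (n + 1) (cone (n + 1) x) =
      x - cone n ((normChains (posetNerve.{u} P)).d (n + 1) n x) := by
  refine DFunLike.congr_fun
    (f := ((normChains (posetNerve.{u} P)).d (n + 2) (n + 1)).hom.comp (cone (n + 1)))
    (g := AddMonoidHom.id _ - (cone n).comp ((normChains (posetNerve.{u} P)).d (n + 1) n).hom)
    (hom_ext fun c => ?_) x
  change (normChains (posetNerve.{u} P)).d (n + 2) (n + 1) (cone (n + 1) (cls c)) =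
    cls c - cone n ((normChains (posetNerve.{u} P)).d (n + 1) n (cls c))
  rw [cone_cls, d_cls, d_cls, Fin.sum_univ_succ, coneChain_face_zero, map_sum, sub_eq_add_neg,
    ← Finset.sum_neg_distrib]
  rw [Fin.val_zero, pow_zero, one_smul]
  refine congrArg (cls c + ·) (Finset.sum_congr rfl fun i _ => ?_)
  rw [coneChain_face_succ, map_zsmul, cone_cls, Fin.val_succ, pow_succ, mul_neg_one, neg_smul]

/-- In degree `0` the other face of the cone is the bottom vertex, so only chains of total
coefficient zero are filled. -/
theorem d_cone_zero (c : Fin 1 →o P) :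
    (normChains (posetNerve.{u} P)).d 1 0 (cone 0 (cls c)) = cls c - cls (OrderHom.const _ ⊥) := by
  rw [cone_cls, d_cls, Fin.sum_univ_two, coneChain_face_zero, sub_eq_add_neg]
  rw [Fin.val_zero, pow_zero, one_smul, Fin.val_one, pow_one, neg_smul, one_smul]
  refine congrArg (fun c' => cls c + -cls c') (OrderHom.ext _ _ (funext fun j => ?_))
  obtain rfl : j = (0 : Fin 1) := Subsingleton.elim (α := Fin 1) _ _
  rfl

end posetNerve

/-! ### Vertices of cubes -/

/-- The inclusion of a face in the poset of vertices of a cube. -/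
def faceHom {n : ℕ} (i : Fin (n + 1)) (b : Fin 2) : (Fin n → Fin 2) →o (Fin (n + 1) → Fin 2) where
  toFun a := i.insertNth (α := fun _ => Fin 2) b a
  monotone' a a' h := Fin.insertNth_le_iff.mpr (by simpa using h)

/-- For `J₊` the cube is the vertex poset itself and the collapse is `leadOnes`. The combinatorial
identities on vertices are therefore read off from the identities on cubes. -/
theorem Jplus_cubeFace_apply {n : ℕ} (i : Fin (n + 1)) (b : Fin 2) (a : Fin n → Fin 2) :
    (IntervalKind.Jplus.cubeFace i b).toFun a = faceHom i b a :=
  IntervalKind.Jplus.coords_cubeFace i b a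

theorem faceHom_comp {n : ℕ} {i j : Fin (n + 1)} (h : i ≤ j) (s t : Fin 2) :
    (faceHom j.succ s).comp (faceHom i t) = (faceHom i.castSucc t).comp (faceHom j s) := by
  refine OrderHom.ext _ _ (funext fun a => ?_)
  have e := congrFun (congrArg ContMap.toFun (IntervalKind.Jplus.cubeFace_comp h s t)) a
  change (IntervalKind.Jplus.cubeFace j.succ s).toFun ((IntervalKind.Jplus.cubeFace i t).toFun a) =
    (IntervalKind.Jplus.cubeFace i.castSucc t).toFun ((IntervalKind.Jplus.cubeFace j s).toFun a) at e
  rw [Jplus_cubeFace_apply i, Jplus_cubeFace_apply j, Jplus_cubeFace_apply,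
    Jplus_cubeFace_apply] at e
  exact e

/-- The projection forgetting a coordinate, on posets of vertices. -/
def dropHom {n : ℕ} (i : Fin (n + 1)) : (Fin (n + 1) → Fin 2) →o (Fin n → Fin 2) where
  toFun a j := a (i.succAbove j)
  monotone' _ _ h j := h (i.succAbove j)

theorem leadOnes_faceHom_one {n : ℕ} (i : Fin (n + 1)) :
    leadOnes.comp (faceHom i 1) =
      (Fin.succAboveOrderEmb i.castSucc).toOrderHom.comp leadOnes := by
  refine OrderHom.ext _ _ (funext fun a => ?_)
  have e := congrFun (congrArg ContMap.toFun
    (IntervalKind.Jplus.collapse_comp_cubeFace_one i)) a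
  refine Eq.trans ?_ e
  exact congrArg leadOnes (Jplus_cubeFace_apply i 1 a).symm

theorem leadOnes_faceHom_last_zero {n : ℕ} :
    leadOnes.comp (faceHom (Fin.last n) 0) =
      (Fin.succAboveOrderEmb (Fin.last (n + 1))).toOrderHom.comp leadOnes := by
  refine OrderHom.ext _ _ (funext fun a => ?_)
  have e := congrFun (congrArg ContMap.toFun
    (IntervalKind.Jplus.collapse_comp_cubeFace_last_zero (n := n))) a
  refine Eq.trans ?_ e
  exact congrArg leadOnes (Jplus_cubeFace_apply (Fin.last n) 0 a).symm

theorem leadOnes_faceHom_zero_le {n : ℕ} (i : Fin (n + 1)) (a : Fin n → Fin 2) :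
    (leadOnes (faceHom i 0 a)).val ≤ i.val := by
  by_contra h
  have h1 := (le_leadOnes_iff (k := i.val + 1) (faceHom i 0 a) (by omega)).mp (by omega)
  have h2 := leadInf_insertNth_bot (L := Fin 2) a i (i.val + 1)
  rw [if_neg (by omega)] at h2
  exact absurd (h1.symm.trans h2) (by decide)

/-! ### Triangulation of cubes -/

/-- The cubical boundary agrees with the simplicial one on the faces of a collapsed cube. -/
theorem sum_face_signs {M : Type u} [AddCommGroup M] {n : ℕ} {a b : Fin (n + 1) → M}
    {c : Fin (n + 2) → M} (h0 : ∀ i : Fin n, a i.castSucc = 0)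
    (hl : a (Fin.last n) = c (Fin.last (n + 1))) (h1 : ∀ i, b i = c i.castSucc) :
    ∑ i : Fin (n + 1), (-1 : ℤ) ^ (i.val + 1) • (a i - b i) =
      ∑ i : Fin (n + 2), (-1 : ℤ) ^ i.val • c i := by
  simp only [smul_sub, Finset.sum_sub_distrib]
  rw [Fin.sum_univ_castSucc, Fin.sum_univ_castSucc (n := n + 1), hl, sub_eq_add_neg,
    ← Finset.sum_neg_distrib]
  simp only [h0, h1, smul_zero, Finset.sum_const_zero, zero_add, Fin.val_last, Fin.val_castSucc]
  rw [add_comm]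
  refine congrArg (· + _) (Finset.sum_congr rfl fun i _ => ?_)
  rw [pow_succ, mul_neg_one, neg_smul, neg_neg]

namespace posetNerve

/-- The difference of the two maps on chains induced by opposite faces of a cube. -/
noncomputable def faceDiff {n : ℕ} (m : ℕ) (i : Fin (n + 1)) :
    (normChains (posetNerve.{u} (Fin n → Fin 2))).X m →+
      (normChains (posetNerve.{u} (Fin (n + 1) → Fin 2))).X m :=
  ((normChains.map (map.{u} (faceHom i 0))).f m).hom -
    ((normChains.map (map.{u} (faceHom i 1))).f m).hom

theorem faceDiff_apply {n m : ℕ} (i : Fin (n + 1))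
    (x : (normChains (posetNerve.{u} (Fin n → Fin 2))).X m) :
    faceDiff m i x = (normChains.map (map.{u} (faceHom i 0))).f m x -
      (normChains.map (map.{u} (faceHom i 1))).f m x := rfl

theorem faceDiff_comm {n m : ℕ} {i j : Fin (n + 1)} (h : i ≤ j)
    (x : (normChains (posetNerve.{u} (Fin n → Fin 2))).X m) :
    faceDiff m j.succ (faceDiff m i x) = faceDiff m i.castSucc (faceDiff m j x) := by
  simp only [faceDiff_apply, map_sub, map_map, faceHom_comp h]
  abel

/-- The signed sum of the faces of a cube. -/
noncomputable def faceSum {n : ℕ} (m : ℕ) :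
    (normChains (posetNerve.{u} (Fin n → Fin 2))).X m →+
      (normChains (posetNerve.{u} (Fin (n + 1) → Fin 2))).X m :=
  ∑ i : Fin (n + 1), (-1 : ℤ) ^ (i.val + 1) • faceDiff m i

theorem faceSum_apply {n m : ℕ} (x : (normChains (posetNerve.{u} (Fin n → Fin 2))).X m) :
    faceSum m x = ∑ i : Fin (n + 1), (-1 : ℤ) ^ (i.val + 1) • faceDiff m i x := by
  rw [faceSum, AddMonoidHom.finsetSum_apply]
  rfl

/-- The same cancellation as for the square of the cubical boundary, applied to inclusions of faces
instead of restrictions to them. -/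
theorem faceSum_faceSum {n m : ℕ} (x : (normChains (posetNerve.{u} (Fin n → Fin 2))).X m) :
    faceSum m (faceSum m x) = 0 := by
  rw [← alternating_double_sum (fun i j => faceDiff m i (faceDiff m j x))
    (fun i j h => faceDiff_comm h x), faceSum_apply]
  refine Finset.sum_congr rfl fun i _ => ?_
  rw [faceSum_apply, map_sum, Finset.smul_sum]
  refine Finset.sum_congr rfl fun j _ => ?_
  rw [map_zsmul, smul_smul]
  congr 1
  ring

theorem d_faceSum {n m k : ℕ} (x : (normChains (posetNerve.{u} (Fin n → Fin 2))).X m) :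
    (normChains (posetNerve.{u} (Fin (n + 1) → Fin 2))).d m k (faceSum m x) =
      faceSum k ((normChains (posetNerve.{u} (Fin n → Fin 2))).d m k x) := by
  simp only [faceSum_apply, map_sum, map_zsmul, faceDiff_apply, map_sub, normChains.d_map]

/-- The fundamental chain of the `n`-cube: the signed sum of the maximal chains of vertices. -/
noncomputable def fundChain : (n : ℕ) → (normChains (posetNerve.{u} (Fin n → Fin 2))).X n
  | 0 => cls (OrderHom.const _ ⊥)
  | n + 1 => cone n (faceSum n (fundChain n))

/-- The signed sum of the faces is a cycle in positive degrees, by induction and `faceSum_faceSum`,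
so the cone fills it. In the base case it is a difference of two vertices, and the two bottom
vertices produced by the cone cancel. -/
theorem d_fundChain (n : ℕ) :
    (normChains (posetNerve.{u} (Fin (n + 1) → Fin 2))).d (n + 1) n (fundChain (n + 1)) =
      faceSum n (fundChain n) := by
  induction n with
  | zero =>
    have h : ∀ c c' : Fin 1 →o (Fin 1 → Fin 2),
        (normChains (posetNerve.{u} (Fin 1 → Fin 2))).d 1 0 (cone 0 (cls c - cls c')) =
          cls c - cls c' := fun c c' => by
      rw [map_sub, map_sub, d_cone_zero, d_cone_zero, sub_sub_sub_cancel_right]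
    have e : faceSum.{u} 0 (fundChain 0) = cls ((faceHom 0 1).comp (OrderHom.const _ ⊥)) -
        cls ((faceHom 0 0).comp (OrderHom.const _ ⊥)) := by
      rw [faceSum_apply, Fin.sum_univ_one, faceDiff_apply, fundChain, map_cls, map_cls,
        Fin.val_zero, show (-1 : ℤ) ^ (0 + 1) = -1 from rfl, neg_smul, one_smul, neg_sub]
    change (normChains (posetNerve.{u} (Fin 1 → Fin 2))).d 1 0 (cone 0 (faceSum 0 (fundChain 0))) =
      _
    rw [e]
    exact h _ _
  | succ n ih =>
    rw [fundChain, d_cone, d_faceSum, ih, faceSum_faceSum, map_zero, sub_zero]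

/-- The number of ones is a strictly monotone rank on the `n`-cube with values at most `n`, so its
vertex poset has no nondegenerate chain of degree `n + 1`. This is why the triangulation kills
degenerate cubes. -/
theorem dropHom_fundChain {n : ℕ} (i : Fin (n + 1)) :
    (normChains.map (map.{u} (dropHom i))).f (n + 1) (fundChain (n + 1)) = 0 := by
  refine eq_zero_of_rank (fun a : Fin n → Fin 2 => ∑ j, (a j).val) ?_ (fun a => ?_) _
  · intro a b h
    obtain ⟨h1, j, hj⟩ := Pi.lt_def.mp h
    exact Finset.sum_lt_sum (fun j _ => h1 j) ⟨j, Finset.mem_univ j, hj⟩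
  · refine Nat.lt_succ_of_le ((Finset.sum_le_card_nsmul _ _ 1 fun j _ => ?_).trans ?_)
    · omega
    · simp

/-- An entry `0` at `i` bounds the number of leading ones by `i < n`, so the image of a chain of
degree `n` has a repetition. -/
theorem leadOnes_faceHom_zero_map {n : ℕ} (i : Fin (n + 1)) (hi : i.val < n)
    (x : (normChains (posetNerve.{u} (Fin n → Fin 2))).X n) :
    (normChains.map (map.{u} (leadOnes.comp (faceHom i 0)))).f n x = 0 := by
  refine DFunLike.congr_fun
    (f := ((normChains.map (map.{u} (leadOnes.comp (faceHom i 0)))).f n).hom) (g := 0)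
    (hom_ext fun c => ?_) x
  refine (map_cls _ c).trans ?_
  exact cls_eq_zero_of_rank Fin.val Fin.val_strictMono _
    ((leadOnes_faceHom_zero_le i _).trans_lt hi)

/-- Both sides are top-degree chains of a simplex, where the boundary is injective, so it suffices
to compare boundaries. By induction the faces of the cube give exactly the faces of the simplex,
apart from the faces that contribute zero. -/
theorem leadOnes_fundChain (n : ℕ) :
    (normChains.map (map.{u} leadOnes)).f n (fundChain n) = cls OrderHom.id := by
  induction n with
  | zero =>
    rw [fundChain, map_cls]
    refine congrArg cls (OrderHom.ext _ _ (funext fun j => ?_))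
    exact Subsingleton.elim (α := Fin 1) _ _
  | succ n ih =>
    -- The cone on a top-degree chain lives in a group that vanishes for reasons of rank, so
    -- `d_cone` leaves only `x`.
    have inj : ∀ x : (normChains (posetNerve.{u} (Fin (n + 2)))).X (n + 1),
        (normChains (posetNerve.{u} (Fin (n + 2)))).d (n + 1) n x = 0 → x = 0 := by
      intro x hx
      have h := d_cone x
      rw [hx, map_zero, sub_zero, eq_zero_of_rank Fin.val Fin.val_strictMono Fin.is_lt
        (cone (n + 1) x), map_zero] at h
      exact h.symm
    rw [← sub_eq_zero]
    refine inj _ ?_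
    have h0 : ∀ i : Fin n, (normChains.map (map.{u} (leadOnes.comp (faceHom i.castSucc 0)))).f n
        (fundChain n) = 0 := fun i => leadOnes_faceHom_zero_map i.castSucc i.is_lt _
    have h1 : ∀ i : Fin (n + 1), (normChains.map (map.{u} (leadOnes.comp (faceHom i 1)))).f n
        (fundChain n) = cls (Fin.succAboveOrderEmb i.castSucc).toOrderHom := fun i => by
      rw [leadOnes_faceHom_one, ← map_map, ih, map_cls]
      rfl
    have h2 : (normChains.map (map.{u} (leadOnes.comp (faceHom (Fin.last n) 0)))).f n
        (fundChain n) = cls (Fin.succAboveOrderEmb (Fin.last (n + 1))).toOrderHom := by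
      rw [leadOnes_faceHom_last_zero, ← map_map, ih, map_cls]
      rfl
    rw [map_sub, normChains.d_map, d_fundChain, d_cls, faceSum_apply, sub_eq_zero, map_sum]
    simp only [map_zsmul, faceDiff_apply, map_sub, map_map]
    exact sum_face_signs h0 h2 h1

end posetNerve

/-- A homomorphism between the underlying groups, as a morphism. -/
def addCommGrpHom {A B : AddCommGrpCat.{u}} (f : A →+ B) : A ⟶ B := AddCommGrpCat.ofHom f

/-! ### Vertex simplices in faces of a cube, and the collapse in low degrees -/

namespace IntervalKind

/-- The endpoints of the interval. -/
def endpoint (J : IntervalKind) (b : Fin 2) : J.space := if b = 0 then J.zero else J.one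

theorem cubeFace_comp_vert (J : IntervalKind) {m n : ℕ} (α : Fin (m + 1) →o (Fin n → Fin 2))
    (i : Fin (n + 1)) (b : Fin 2) :
    (J.cubeFace i (J.endpoint b)).comp (J.vert α) = J.vert ((faceHom i b).comp α) := by
  refine ContMap.ext (funext fun x => J.coords_injective (funext fun j => ?_))
  change J.coords ((J.cubeFace i (J.endpoint b)).toFun ((J.vert α).toFun x)) j = _
  rw [coords_cubeFace, coords_vert]
  refine Fin.succAboveCases i ?_ (fun k => ?_) j
  · rw [Fin.insertNth_apply_same]
    have e : ∀ j, ((Pi.evalOrderHom i).comp ((faceHom i b).comp α)) j = b := fun j =>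
      Fin.insertNth_apply_same (α := fun _ => Fin 2) i b (α j)
    by_cases hb : b = 0
    -- A constant coordinate `0` never reaches `1`, so its threshold is `m + 1`, past the last
    -- vertex; for a constant coordinate `1` it is `0`.
    · rw [J.tail_simplexMap (l := m + 1) _ (fun j => ?_) x, J.tail_of_lt (by omega)]
      · exact if_pos hb
      · rw [e j, hb]
        have := j.2
        simp only [Fin.val_zero]
        omega
    · have hb' : b = 1 := by omega
      rw [J.tail_simplexMap (l := 0) _ (fun j => ?_) x, J.tail_zero]
      · exact if_neg hb
      · rw [e j, hb']
        simp
  · rw [Fin.insertNth_apply_succAbove, coords_vert]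
    have e : (Pi.evalOrderHom (i.succAbove k)).comp ((faceHom i b).comp α) =
        (Pi.evalOrderHom k).comp α := OrderHom.ext _ _ (funext fun j =>
      Fin.insertNth_apply_succAbove (α := fun _ => Fin 2) i b (α j) k)
    rw [e]

theorem collapse_zero (J : IntervalKind) : J.collapse 0 = J.cubeIsoSimplexZero.hom := by
  refine ContMap.ext (funext fun a => J.tail_ext fun k hk => ?_)
  obtain rfl : k = 0 := by omega
  rw [tail_zero, tail_zero]

theorem collapse_one (J : IntervalKind) : J.collapse 1 = J.cubeIsoSimplexOne.hom := by
  refine ContMap.ext (funext fun a => J.tail_ext fun k hk => ?_)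
  rcases Nat.le_one_iff_eq_zero_or_eq_one.mp hk with rfl | rfl
  · rw [tail_zero, tail_zero]
  · rw [J.tail_collapse hk, J.tail_one_eq_inv]
    have e := congrFun (congrArg ContMap.toFun J.spaceIsoSimplexOne.hom_inv_id)
      ((J.cubeProj 0).toFun a)
    refine Eq.trans ?_ e.symm
    change leadInf (J.coords a) 1 = J.coords a 0
    simp [leadInf, Finset.filter_true]

end IntervalKind

/-! ### Triangulation of singular cubes -/

variable {J : IntervalKind}

/-- The simplices of the vertex poset of a cube, seen in a singular cube. -/
noncomputable def cubeSimplices {X : ClCat.{u}} {n : ℕ} (τ : ContMap (J.cube n) X) :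
    posetNerve.{u} (Fin n → Fin 2) ⟶ (singSSet J).obj X where
  app _ := ↾fun c => τ.comp (J.vert c.down)
  naturality _ _ α := by
    refine ConcreteCategory.hom_ext _ _ fun c => ?_
    exact congrArg τ.comp (J.vert_comp_simplexMap c.down α.unop.toOrderHom).symm

/-- The simplices of the vertex poset of a simplex, seen in a singular simplex. -/
noncomputable def simplexSimplices {X : ClCat.{u}} {n : ℕ} (σ : ContMap (J.simplex n) X) :
    posetNerve.{u} (Fin (n + 1)) ⟶ (singSSet J).obj X where
  app _ := ↾fun c => σ.comp (J.simplexMap c.down)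
  naturality _ _ α := by
    refine ConcreteCategory.hom_ext _ _ fun c => ?_
    exact congrArg σ.comp (J.simplexMap_comp c.down α.unop.toOrderHom)

section

variable {X Y : ClCat.{u}} {n : ℕ}

theorem cubeSimplices_face (τ : ContMap (J.cube (n + 1)) X) (i : Fin (n + 1)) (b : Fin 2) :
    cubeSimplices (τ.comp (J.cubeFace i (J.endpoint b))) =
      posetNerve.map (faceHom i b) ≫ cubeSimplices τ := by
  refine NatTrans.ext (funext fun m => ConcreteCategory.hom_ext _ _ fun c => ?_)
  exact congrArg τ.comp (J.cubeFace_comp_vert c.down i b)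

theorem cubeSimplices_degen (τ : ContMap (J.cube n) X) (i : Fin (n + 1)) :
    cubeSimplices (τ.comp (J.cubeDegen i)) =
      posetNerve.map (dropHom i) ≫ cubeSimplices τ := rfl

theorem cubeSimplices_comp (τ : ContMap (J.cube n) X) (φ : X ⟶ Y) :
    cubeSimplices (ContMap.comp φ τ) = cubeSimplices τ ≫ (singSSet J).map φ := rfl

theorem cubeSimplices_collapse (σ : ContMap (J.simplex n) X) :
    cubeSimplices (σ.comp (J.collapse n)) = posetNerve.map leadOnes ≫ simplexSimplices σ := by
  refine NatTrans.ext (funext fun m => ConcreteCategory.hom_ext _ _ fun c => ?_)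
  exact congrArg σ.comp (J.collapse_comp_vert c.down)

/-- The triangulation of singular cubes. -/
noncomputable def triangulation (J : IntervalKind) (X : ClCat.{u}) (n : ℕ) :
    ((cubeNorm J).obj X).X n →+ (normChains ((singSSet J).obj X)).X n :=
  cubeNorm.lift (fun τ => (normChains.map (cubeSimplices τ)).f n (posetNerve.fundChain n)) (by
    rintro m rfl i τ
    change (normChains.map (cubeSimplices (τ.comp (J.cubeDegen i)))).f _ _ = 0
    rw [cubeSimplices_degen, normChains.map_comp_apply, posetNerve.dropHom_fundChain, map_zero])

theorem triangulation_cls (τ : ContMap (J.cube n) X) :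
    triangulation J X n (cubeNorm.cls τ) =
      (normChains.map (cubeSimplices τ)).f n (posetNerve.fundChain n) :=
  cubeNorm.lift_cls _ _ τ

/-- The boundary is computed once, for the fundamental chain, and pushed forward along the cube; the
faces of the vertex poset correspond to the faces of the singular cube by `cubeSimplices_face`. -/
theorem d_triangulation (x : ((cubeNorm J).obj X).X (n + 1)) :
    (normChains ((singSSet J).obj X)).d (n + 1) n (triangulation J X (n + 1) x) =
      triangulation J X n (((cubeNorm J).obj X).d (n + 1) n x) := by
  refine DFunLike.congr_fun
    (f := ((normChains ((singSSet J).obj X)).d (n + 1) n).hom.comp (triangulation J X (n + 1)))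
    (g := (triangulation J X n).comp (((cubeNorm J).obj X).d (n + 1) n).hom)
    (cubeNorm.hom_ext fun τ => ?_) x
  change (normChains ((singSSet J).obj X)).d (n + 1) n (triangulation J X (n + 1) (cubeNorm.cls τ)) =
    triangulation J X n (((cubeNorm J).obj X).d (n + 1) n (cubeNorm.cls τ))
  rw [triangulation_cls, normChains.d_map, posetNerve.d_fundChain, posetNerve.faceSum_apply,
    cubeNorm.d_cls, map_sum, map_sum]
  refine Finset.sum_congr rfl fun i _ => ?_
  rw [map_zsmul, map_zsmul, posetNerve.faceDiff_apply, map_sub, map_sub, triangulation_cls,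
    triangulation_cls, ← normChains.map_comp_apply, ← normChains.map_comp_apply,
    ← cubeSimplices_face, ← cubeSimplices_face]
  rfl

end

/-- The natural chain map triangulating singular cubes. -/
noncomputable def triangulationMap (J : IntervalKind) : cubeNorm.{u} J ⟶ simpNorm.{u} J where
  app X :=
    { f := fun n => addCommGrpHom (triangulation J X n)
      -- The normalized chains of the singular simplicial set are by definition the complex
      -- `simpNorm`.
      comm' := by
        rintro _ n rfl
        exact ConcreteCategory.hom_ext _ _ fun x => d_triangulation x }
  naturality X Y φ := by
    ext n : 1
    refine ConcreteCategory.hom_ext _ _ fun x => ?_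
    refine DFunLike.congr_fun
      (f := (triangulation J Y n).comp (((cubeNorm J).map φ).f n).hom)
      (g := ((normChains.map ((singSSet J).map φ)).f n).hom.comp (triangulation J X n))
      (cubeNorm.hom_ext fun τ => ?_) x
    change triangulation J Y n (((cubeNorm J).map φ).f n (cubeNorm.cls τ)) =
      (normChains.map ((singSSet J).map φ)).f n (triangulation J X n (cubeNorm.cls τ))
    rw [cubeNorm.map_cls, triangulation_cls, triangulation_cls, cubeSimplices_comp,
      normChains.map_comp_apply]

/-! ### From simplices to cubes -/

section

variable {X Y : ClCat.{u}} {n : ℕ}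

/-- The homomorphism sending a singular simplex to the singular cube collapsing onto it. -/
noncomputable def collapseHom (J : IntervalKind) (X : ClCat.{u}) (n : ℕ) :
    FreeAbelianGroup (ContMap (J.simplex n) X) →+ ((cubeNorm J).obj X).X n :=
  FreeAbelianGroup.lift fun σ => cubeNorm.cls (σ.comp (J.collapse n))

theorem collapseHom_of (σ : ContMap (J.simplex n) X) :
    collapseHom J X n (FreeAbelianGroup.of σ) = cubeNorm.cls (σ.comp (J.collapse n)) :=
  FreeAbelianGroup.lift_apply_of _ σ

/-- The boundary of singular simplicial chains. -/
noncomputable def mooreBoundary (J : IntervalKind) (X : ClCat.{u}) (n : ℕ) :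
    FreeAbelianGroup (ContMap (J.simplex (n + 1)) X) →+
      FreeAbelianGroup (ContMap (J.simplex n) X) :=
  (((simpMoore J).obj X).d (n + 1) n).hom

theorem mooreBoundary_of (σ : ContMap (J.simplex (n + 1)) X) :
    mooreBoundary J X n (FreeAbelianGroup.of σ) = ∑ i : Fin (n + 2), (-1 : ℤ) ^ i.val •
      FreeAbelianGroup.of (σ.comp (J.simplexMap (Fin.succAboveOrderEmb i).toOrderHom)) := by
  refine (normChains.alternatingFaceMapComplex_d_apply ((singAb J).obj X)
    (FreeAbelianGroup.of σ)).trans (Finset.sum_congr rfl fun i _ => ?_)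
  exact congrArg ((-1 : ℤ) ^ i.val • ·) (FreeAbelianGroup.map_of_apply σ)

/-- Among the `2(n + 1)` faces of the collapsed cube, those with coordinate `0` other than the last
are degenerate, and the remaining `n + 2` are the collapsed faces of the simplex. Their signs agree
by `sum_face_signs`. -/
theorem d_collapseHom (x : FreeAbelianGroup (ContMap (J.simplex (n + 1)) X)) :
    ((cubeNorm J).obj X).d (n + 1) n (collapseHom J X (n + 1) x) =
      collapseHom J X n (mooreBoundary J X n x) := by
  refine DFunLike.congr_fun
    (f := (((cubeNorm J).obj X).d (n + 1) n).hom.comp (collapseHom J X (n + 1)))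
    (g := (collapseHom J X n).comp (mooreBoundary J X n))
    (FreeAbelianGroup.lift_ext _ _ fun σ => ?_) x
  change ((cubeNorm J).obj X).d (n + 1) n (collapseHom J X (n + 1) (FreeAbelianGroup.of σ)) =
    collapseHom J X n (mooreBoundary J X n (FreeAbelianGroup.of σ))
  rw [collapseHom_of, mooreBoundary_of, cubeNorm.d_cls, map_sum]
  simp only [map_zsmul, collapseHom_of]
  refine sum_face_signs (fun i => ?_) ?_ fun i => ?_
  · cases n with
    | zero => exact i.elim0
    | succ n =>
      refine (congrArg (fun ψ => cubeNorm.cls (σ.comp ψ))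
        (J.collapse_comp_cubeFace_zero i)).trans ?_
      exact cubeNorm.cls_degen (Fin.last n) (((σ.comp (J.collapse (n + 2))).comp
        (J.cubeFace i.castSucc J.zero)).comp (J.cubeFace (Fin.last n) J.zero))
  · exact congrArg (fun ψ => cubeNorm.cls (σ.comp ψ)) J.collapse_comp_cubeFace_last_zero
  · exact congrArg (fun ψ => cubeNorm.cls (σ.comp ψ)) (J.collapse_comp_cubeFace_one i)

end

/-- The natural chain map sending a singular simplex to the singular cube collapsing onto it. -/
noncomputable def collapseMap (J : IntervalKind) : simpMoore.{u} J ⟶ cubeNorm.{u} J where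
  app X :=
    { f := fun n => addCommGrpHom (collapseHom J X n)
      comm' := by
        rintro _ n rfl
        exact ConcreteCategory.hom_ext _ _ fun x => d_collapseHom x }
  naturality X Y φ := by
    ext n : 1
    refine ConcreteCategory.hom_ext _ _ fun x => ?_
    refine DFunLike.congr_fun
      (f := (collapseHom J Y n).comp (FreeAbelianGroup.map fun σ => ContMap.comp φ σ))
      (g := (((cubeNorm J).map φ).f n).hom.comp (collapseHom J X n))
      (FreeAbelianGroup.lift_ext _ _ fun σ => ?_) x
    change collapseHom J Y n (FreeAbelianGroup.map _ (FreeAbelianGroup.of σ)) =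
      ((cubeNorm J).map φ).f n (collapseHom J X n (FreeAbelianGroup.of σ))
    rw [FreeAbelianGroup.map_of_apply, collapseHom_of, collapseHom_of, cubeNorm.map_cls]
    rfl

/-- The projection from singular simplicial chains to normalized chains. -/
noncomputable def simpProj (J : IntervalKind) : simpMoore.{u} J ⟶ simpNorm.{u} J where
  app X := quotientProj ((simpMoore J).obj X) (degenerateSimplices _) (degenerateSimplices_le _)

/-- Triangulating a collapsed simplex pushes the fundamental chain forward along `leadOnes`, which
leaves the identity chain of the vertices of the simplex. -/
theorem collapseMap_triangulationMap (J : IntervalKind) :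
    collapseMap.{u} J ≫ triangulationMap J = simpProj J := by
  ext X n : 3
  refine ConcreteCategory.hom_ext _ _ fun x => ?_
  refine DFunLike.congr_fun
    (f := (triangulation J X n).comp (collapseHom J X n))
    (g := normChains.proj ((singSSet J).obj X) n)
    (FreeAbelianGroup.lift_ext _ _ fun σ => ?_) x
  change triangulation J X n (collapseHom J X n (FreeAbelianGroup.of σ)) =
    normChains.cls (S := (singSSet J).obj X) σ
  rw [collapseHom_of, triangulation_cls, cubeSimplices_collapse, normChains.map_comp_apply,
    posetNerve.leadOnes_fundChain]
  refine (normChains.map_cls (simplexSimplices σ) _).trans ?_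
  change normChains.cls (S := (singSSet J).obj X) (σ.comp (J.simplexMap OrderHom.id)) = _
  rw [J.simplexMap_id]
  rfl

/-! ### Splitting the normalization -/

section

open AlgebraicTopology AlgebraicTopology.DoldKan

/-- The homotopy is built recursively from the endomorphisms `P q` and the maps `hσ'`, both of which
are natural; the induction follows that recursion. -/
theorem homotopyPToId_naturality {C : Type u} [Category.{v} C] [Preadditive C]
    {X Y : SimplicialObject C} (f : X ⟶ Y) (q i j : ℕ) :
    (AlternatingFaceMapComplex.map f).f i ≫ (homotopyPToId Y q).hom i j =
      (homotopyPToId X q).hom i j ≫ (AlternatingFaceMapComplex.map f).f j := by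
  induction q with
  | zero => simp [homotopyPToId]
  | succ q ih =>
    simp only [homotopyPToId, Homotopy.trans_hom, Homotopy.ofEq_hom, Homotopy.add_hom,
      Pi.zero_apply, zero_add, add_zero, Preadditive.comp_add,
      Preadditive.add_comp, ih]
    refine congrArg (_ + ·) ?_
    by_cases h : (ComplexShape.down ℕ).Rel j i
    · have e : ∀ Z : SimplicialObject C,
          ((homotopyHσToZero (X := Z) q).compLeft (P q)).hom i j =
            (P q).f i ≫ hσ' q i j h := fun Z => congrArg ((P q).f i ≫ ·) (dif_pos h)
      rw [e X, e Y, Category.assoc]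
      have h1 := P_f_naturality q i f
      have h2 := hσ'_naturality q i j h f
      change f.app _ ≫ (P q).f i ≫ _ = (P q).f i ≫ hσ' q i j h ≫ f.app _
      rw [← h2, ← Category.assoc, ← Category.assoc]
      exact congrArg (· ≫ hσ' q i j h) h1
    · rw [Homotopy.zero _ i j h, Homotopy.zero _ i j h, Limits.comp_zero, Limits.zero_comp]

variable (A : SimplicialObject AddCommGrpCat.{u})

theorem PInfty_degenerateSimplices (n : ℕ) :
    degenerateSimplices A n ≤ ((PInfty : AlternatingFaceMapComplex.obj A ⟶ _).f n).hom.ker := by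
  cases n with
  | zero => exact bot_le
  | succ n =>
    refine iSup_le fun i => ?_
    rintro _ ⟨y, rfl⟩
    change (A.σ i ≫ PInfty.f (n + 1)).hom y = 0
    rw [σ_comp_PInfty]
    rfl

/-- The complementary idempotent `QInfty` is, in positive degrees, a sum of maps ending with a
degeneracy. Together with `PInfty_degenerateSimplices` this splits the normalization. -/
theorem sub_PInfty_mem (n : ℕ) (x : (AlternatingFaceMapComplex.obj A).X n) :
    (PInfty : AlternatingFaceMapComplex.obj A ⟶ _).f n x - x ∈ degenerateSimplices A n := by
  have h : (QInfty : AlternatingFaceMapComplex.obj A ⟶ _).f n x ∈ degenerateSimplices A n := by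
    cases n with
    | zero =>
      rw [QInfty_f_0]
      exact AddSubgroup.zero_mem _
    | succ n =>
      rw [QInfty_f, decomposition_Q]
      change (AddCommGrpCat.homAddEquiv (∑ i : Fin (n + 1) with i.val < n + 1,
        (P i).f (n + 1) ≫ A.δ i.rev.succ ≫ A.σ (Fin.rev i))) x ∈ _
      rw [map_sum, AddMonoidHom.finsetSum_apply]
      refine AddSubgroup.sum_mem _ fun i _ => ?_
      exact AddSubgroup.mem_iSup_of_mem (Fin.rev i) ⟨_, rfl⟩
  have e : (PInfty : AlternatingFaceMapComplex.obj A ⟶ _).f n x +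
      (QInfty : AlternatingFaceMapComplex.obj A ⟶ _).f n x = x :=
    congrArg (fun φ : A.obj _ ⟶ A.obj _ => φ.hom x) (PInfty_f_add_QInfty_f (X := A) n)
  rw [show (PInfty : AlternatingFaceMapComplex.obj A ⟶ _).f n x - x =
    -(QInfty : AlternatingFaceMapComplex.obj A ⟶ _).f n x by
      nth_rewrite 2 [← e]
      abel]
  exact AddSubgroup.neg_mem _ h

/-- The section of the projection to normalized chains given by the idempotent `PInfty`. -/
noncomputable def normalizedSection :
    quotientComplex (AlternatingFaceMapComplex.obj A) (degenerateSimplices A)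
      (degenerateSimplices_le A) ⟶ AlternatingFaceMapComplex.obj A where
  f n := addCommGrpHom (QuotientAddGroup.lift (degenerateSimplices A n)
    ((PInfty : AlternatingFaceMapComplex.obj A ⟶ _).f n).hom (PInfty_degenerateSimplices A n))
  comm' i j _ := by
    refine ConcreteCategory.hom_ext _ _ fun x => ?_
    obtain ⟨x, rfl⟩ := QuotientAddGroup.mk_surjective (s := degenerateSimplices A i) x
    exact congrArg (fun φ => φ.hom x) ((PInfty : AlternatingFaceMapComplex.obj A ⟶ _).comm i j)

end

/-- The natural section of the projection to normalized singular chains. -/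
noncomputable def simpSection (J : IntervalKind) : simpNorm.{u} J ⟶ simpMoore.{u} J where
  app X := normalizedSection ((singAb J).obj X)
  naturality X Y φ := by
    ext n : 1
    refine ConcreteCategory.hom_ext _ _ fun x => ?_
    obtain ⟨x, rfl⟩ := QuotientAddGroup.mk_surjective
      (s := degenerateSimplices ((singAb J).obj X) n) x
    exact congrArg (fun ψ => ψ.hom x)
      (AlgebraicTopology.DoldKan.PInfty_f_naturality n ((singAb J).map φ))

theorem simpSection_simpProj (J : IntervalKind) : simpSection.{u} J ≫ simpProj J = 𝟙 _ := by
  ext X n : 3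
  refine ConcreteCategory.hom_ext _ _ fun x => ?_
  obtain ⟨x, rfl⟩ := QuotientAddGroup.mk_surjective
    (s := degenerateSimplices ((singAb J).obj X) n) x
  refine (QuotientAddGroup.eq_iff_sub_mem (N := degenerateSimplices ((singAb J).obj X) n)).mpr ?_
  exact sub_PInfty_mem ((singAb J).obj X) n x

/-- The natural homotopy from the projection onto normalized chains to the identity. -/
noncomputable def simpSectionHomotopy (J : IntervalKind) :
    NaturalHomotopy (simpProj.{u} J ≫ simpSection J) (𝟙 _) where
  app X :=
    -- The projection followed by the section is `PInfty` by definition, so the Dold-Kan homotopy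
    -- has the required boundary.
    { hom := (AlgebraicTopology.DoldKan.homotopyPInftyToId ((singAb J).obj X)).hom
      zero := (AlgebraicTopology.DoldKan.homotopyPInftyToId ((singAb J).obj X)).zero
      comm := (AlgebraicTopology.DoldKan.homotopyPInftyToId ((singAb J).obj X)).comm }
  -- The component of the limit homotopy with target degree `j` is the one at stage `j + 1`.
  naturality φ i j := homotopyPToId_naturality ((singAb J).map φ) (j + 1) i j

/-! ### Extending natural maps and homotopies to augmented complexes -/

namespace ChainHelpers

variable {C C' : ChainComplex AddCommGrpCat.{u} ℕ} {Z : AddCommGrpCat.{u}}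
    {ε : C.X 0 ⟶ Z} {w : C.d 1 0 ≫ ε = 0} {ε' : C'.X 0 ⟶ Z} {w' : C'.d 1 0 ≫ ε' = 0}

/-- The components of a homotopy, extended by zero to augmented complexes. -/
def augmentHomotopyHom {φ ψ : C ⟶ C'} (H : Homotopy φ ψ) :
    ∀ i j : ℕ, (C.augment ε w).X i ⟶ (C'.augment ε' w').X j
  | 0, _ => 0
  | _ + 1, 0 => 0
  | i + 1, j + 1 => H.hom i j

/-- A homotopy extends by zero to augmented complexes. -/
noncomputable def augmentHomotopy {φ ψ : C ⟶ C'} (H : Homotopy φ ψ)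
    {α β : C.augment ε w ⟶ C'.augment ε' w'} (h0 : α.f 0 = β.f 0)
    (hα : ∀ n, α.f (n + 1) = φ.f n) (hβ : ∀ n, β.f (n + 1) = ψ.f n) : Homotopy α β where
  hom := augmentHomotopyHom H
  zero
    | 0, _, _ => rfl
    | _ + 1, 0, _ => rfl
    | i + 1, j + 1, h => H.zero i j fun h' => h (congrArg (· + 1) h')
  comm
    | 0 => by
      rw [Homotopy.dNext_zero_chainComplex, Homotopy.prevD_chainComplex, h0]
      have key (b : Z ⟶ Z) : b = 0 + (0 : Z ⟶ C'.X 0) ≫ ε' + b := by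
        rw [Limits.zero_comp, zero_add, zero_add]
      exact key (β.f 0)
    | 1 => by
      rw [Homotopy.dNext_succ_chainComplex, Homotopy.prevD_chainComplex, hα, hβ]
      have h := H.comm 0
      rw [Homotopy.dNext_zero_chainComplex, Homotopy.prevD_chainComplex, zero_add] at h
      change φ.f 0 = (ε ≫ (0 : Z ⟶ C'.X 0) + H.hom 0 1 ≫ C'.d 1 0 + ψ.f 0 : C.X 0 ⟶ C'.X 0)
      rw [Limits.comp_zero, zero_add, h]
    | i + 2 => by
      rw [Homotopy.dNext_succ_chainComplex, Homotopy.prevD_chainComplex, hα, hβ]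
      have h := H.comm (i + 1)
      rw [Homotopy.dNext_succ_chainComplex, Homotopy.prevD_chainComplex] at h
      exact h

end ChainHelpers

/-! ### Model cubes in an arbitrary universe -/

/-- The cubes live in universe `0`, while naturality is tested on spaces of universe `u`; the lifted
cubes serve as models there. -/
instance instClosureSpaceULift (X : Type v) [ClosureSpace X] : ClosureSpace (ULift.{u} X) where
  cl A := ULift.down ⁻¹' ClosureSpace.cl (ULift.down '' A)
  cl_empty := by simp [ClosureSpace.cl_empty]
  subset_cl A x hx := ClosureSpace.subset_cl _ ⟨x, hx, rfl⟩
  cl_union A B := by rw [Set.image_union, ClosureSpace.cl_union, Set.preimage_union]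

namespace ContMap

/-- The identification of a space with its lift to a larger universe. -/
def up (X : Type v) [ClosureSpace X] : ContMap X (ULift.{u} X) where
  toFun := ULift.up
  image_cl_subset A := by
    rintro _ ⟨x, hx, rfl⟩
    change x ∈ ClosureSpace.cl (ULift.down '' (ULift.up '' A))
    rwa [Set.image_image, Set.image_id']

/-- The identification of a space lifted to a larger universe with the original one. -/
def down (X : Type v) [ClosureSpace X] : ContMap (ULift.{u} X) X where
  toFun := ULift.down
  image_cl_subset A := by
    rintro _ ⟨x, hx, rfl⟩
    exact hx

end ContMap

namespace IntervalKind

/-- The cube as an object of the category of closure spaces of a given universe. -/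
def modelCube (J : IntervalKind) (n : ℕ) : ClCat.{u} := ⟨ULift.{u} (J.cube n)⟩

/-- The tautological singular cube of a model cube. -/
def modelPoint (J : IntervalKind) (n : ℕ) : ContMap (J.cube n) (J.modelCube.{u} n) :=
  ContMap.up (J.cube n)

/-- The map from a model cube determined by a singular cube. -/
def modelMap (J : IntervalKind) {n : ℕ} {X : ClCat.{u}} (τ : ContMap (J.cube n) X) :
    J.modelCube.{u} n ⟶ X :=
  ContMap.comp τ (ContMap.down (J.cube n))

/-- The Yoneda principle: every singular cube is the image of the tautological one, so natural
transformations on cubes are determined by the latter. -/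
theorem modelMap_comp_modelPoint (J : IntervalKind) {n : ℕ} {X : ClCat.{u}}
    (τ : ContMap (J.cube n) X) : ContMap.comp (J.modelMap τ) (J.modelPoint n) = τ := rfl

/-- The idempotent of a cube replacing the coordinates in a given set by `0`. -/
def cubeZeroOn (J : IntervalKind) {n : ℕ} (S : Finset (Fin n)) : ContMap (J.cube n) (J.cube n) :=
  J.cubeLift fun j => if j ∈ S then ContMap.const (J.cube n) J.zero else J.cubeProj j

theorem coords_cubeZeroOn (J : IntervalKind) {n : ℕ} (S : Finset (Fin n)) (a : J.cube n)
    (j : Fin n) :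
    J.coords ((J.cubeZeroOn S).toFun a) j = if j ∈ S then J.zero else J.coords a j := by
  change ContMap.toFun (if j ∈ S then ContMap.const (J.cube n) J.zero else J.cubeProj j) a = _
  split_ifs <;> rfl

theorem cubeZeroOn_empty (J : IntervalKind) {n : ℕ} :
    J.cubeZeroOn (∅ : Finset (Fin n)) = ContMap.id (J.cube n) := by
  refine ContMap.ext (funext fun a => J.coords_injective (funext fun j => ?_))
  rw [coords_cubeZeroOn, if_neg (Finset.notMem_empty j)]
  rfl

/-- Once the `k`-th coordinate is replaced by `0`, its original value is irrelevant; so for nonempty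
`S` every cube composed with `J.cubeZeroOn S` is degenerate. -/
theorem cubeZeroOn_of_mem (J : IntervalKind) {n : ℕ} {S : Finset (Fin (n + 1))}
    {k : Fin (n + 1)} (h : k ∈ S) :
    J.cubeZeroOn S = ((J.cubeZeroOn S).comp (J.cubeFace k J.zero)).comp (J.cubeDegen k) := by
  refine ContMap.ext (funext fun a => J.coords_injective (funext fun j => ?_))
  change _ = J.coords ((J.cubeZeroOn S).toFun
    ((J.cubeFace k J.zero).toFun ((J.cubeDegen k).toFun a))) j
  rw [coords_cubeZeroOn, coords_cubeZeroOn, coords_cubeFace]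
  split_ifs with hj
  · rfl
  · obtain ⟨l, rfl⟩ := Fin.exists_succAbove_eq (x := j) (y := k) (fun e => hj (e ▸ h))
    rw [Fin.insertNth_apply_succAbove]
    rfl

theorem cubeDegen_comp_cubeZeroOn (J : IntervalKind) {n : ℕ} {S T : Finset (Fin (n + 1))}
    (k : Fin (n + 1)) (h : ∀ j, j ≠ k → (j ∈ S ↔ j ∈ T)) :
    (J.cubeDegen k).comp (J.cubeZeroOn S) = (J.cubeDegen k).comp (J.cubeZeroOn T) := by
  refine ContMap.ext (funext fun a => J.coords_injective (funext fun j => ?_))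
  change J.coords ((J.cubeZeroOn S).toFun a) (k.succAbove j) =
    J.coords ((J.cubeZeroOn T).toFun a) (k.succAbove j)
  rw [coords_cubeZeroOn, coords_cubeZeroOn]
  exact if_congr (h _ (Fin.succAbove_ne k j)) rfl rfl

/-! ### Contraction of the cubical chains of a model cube -/

/-- The cube contracting a singular cube of a model cube to the origin. -/
noncomputable def cubeCone (J : IntervalKind) {m n : ℕ} (τ : ContMap (J.cube n) (J.modelCube.{u} m)) :
    ContMap (J.cube (n + 1)) (J.modelCube.{u} m) :=
  (J.modelPoint m).comp (J.cubeLift fun i => J.infMap (J.cubeProj 0)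
    ((J.cubeProj i).comp (((ContMap.down (J.cube m)).comp τ).comp (J.cubeDegen 0))))

/-- The coordinates of a point of a model cube. -/
def modelCoords (J : IntervalKind) {m : ℕ} (x : J.modelCube.{u} m) : Fin m → J.space :=
  J.coords ((ContMap.down (J.cube m)).toFun x)

theorem modelCoords_injective (J : IntervalKind) {m : ℕ} :
    Function.Injective (J.modelCoords (m := m)) :=
  J.coords_injective.comp ULift.down_injective

theorem modelCoords_cubeCone (J : IntervalKind) {m n : ℕ}
    (τ : ContMap (J.cube n) (J.modelCube.{u} m)) (a : J.cube (n + 1)) (i : Fin m) :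
    J.modelCoords ((J.cubeCone τ).toFun a) i =
      J.coords a 0 ⊓ J.modelCoords (τ.toFun ((J.cubeDegen 0).toFun a)) i :=
  J.infMap_apply _ _ a

theorem cubeCone_comp_face_one (J : IntervalKind) {m n : ℕ}
    (τ : ContMap (J.cube n) (J.modelCube.{u} m)) :
    (J.cubeCone τ).comp (J.cubeFace 0 J.one) = τ := by
  refine ContMap.ext (funext fun a => J.modelCoords_injective (funext fun i => ?_))
  change J.modelCoords ((J.cubeCone τ).toFun ((J.cubeFace 0 J.one).toFun a)) i = _
  rw [modelCoords_cubeCone, coords_cubeFace, Fin.insertNth_apply_same, ← top_eq_one, top_inf_eq]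
  exact congrArg (fun ψ : ContMap (J.cube n) (J.cube n) => J.modelCoords (τ.toFun (ψ.toFun a)) i)
    (J.cubeDegen_comp_cubeFace_self 0 J.one)

/-- At parameter `0` the cone is constant at the origin. A constant cube is degenerate as soon as
its dimension is positive, hence the dimension `n + 1` of `τ`. -/
theorem cubeCone_comp_face_zero (J : IntervalKind) {m n : ℕ}
    (τ : ContMap (J.cube (n + 1)) (J.modelCube.{u} m)) :
    (J.cubeCone τ).comp (J.cubeFace 0 J.zero) =
      (((J.cubeCone τ).comp (J.cubeFace 0 J.zero)).comp (J.cubeFace 0 J.zero)).comp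
        (J.cubeDegen 0) := by
  refine ContMap.ext (funext fun a => J.modelCoords_injective (funext fun i => ?_))
  change J.modelCoords ((J.cubeCone τ).toFun ((J.cubeFace 0 J.zero).toFun a)) i =
    J.modelCoords ((J.cubeCone τ).toFun ((J.cubeFace 0 J.zero).toFun
      ((J.cubeFace 0 J.zero).toFun ((J.cubeDegen 0).toFun a)))) i
  rw [modelCoords_cubeCone, modelCoords_cubeCone, coords_cubeFace, coords_cubeFace,
    Fin.insertNth_apply_same, Fin.insertNth_apply_same, ← bot_eq_zero, bot_inf_eq, bot_inf_eq]

theorem cubeDegen_comp_face_succ (J : IntervalKind) {n : ℕ} (j : Fin (n + 1)) (t : J.space)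
    (a : J.cube (n + 1)) :
    (J.cubeDegen 0).toFun ((J.cubeFace j.succ t).toFun a) =
      (J.cubeFace j t).toFun ((J.cubeDegen 0).toFun a) := by
  refine J.coords_injective (funext fun k => ?_)
  rw [coords_cubeFace]
  change J.coords ((J.cubeFace j.succ t).toFun a) ((0 : Fin (n + 2)).succAbove k) = _
  rw [coords_cubeFace, Fin.zero_succAbove]
  refine Fin.succAboveCases j ?_ (fun l => ?_) k
  · rw [Fin.insertNth_apply_same, Fin.insertNth_apply_same]
  · rw [Fin.insertNth_apply_succAbove, ← Fin.succ_succAbove_succ, Fin.insertNth_apply_succAbove]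
    exact congrArg (J.coords a) (Fin.zero_succAbove l).symm

theorem cubeCone_comp_face_succ (J : IntervalKind) {m n : ℕ}
    (τ : ContMap (J.cube (n + 1)) (J.modelCube.{u} m)) (j : Fin (n + 1)) (t : J.space) :
    (J.cubeCone τ).comp (J.cubeFace j.succ t) = J.cubeCone (τ.comp (J.cubeFace j t)) := by
  refine ContMap.ext (funext fun a => J.modelCoords_injective (funext fun i => ?_))
  change J.modelCoords ((J.cubeCone τ).toFun ((J.cubeFace j.succ t).toFun a)) i = _
  rw [modelCoords_cubeCone, modelCoords_cubeCone, cubeDegen_comp_face_succ]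
  have e : J.coords ((J.cubeFace j.succ t).toFun a) 0 = J.coords a 0 := by
    rw [coords_cubeFace, ← Fin.succ_succAbove_zero j, Fin.insertNth_apply_succAbove]
  rw [e]
  rfl

theorem cubeCone_comp_degen (J : IntervalKind) {m n : ℕ}
    (τ : ContMap (J.cube n) (J.modelCube.{u} m)) (j : Fin (n + 1)) :
    J.cubeCone (τ.comp (J.cubeDegen j)) = (J.cubeCone τ).comp (J.cubeDegen j.succ) := by
  refine ContMap.ext (funext fun a => J.modelCoords_injective (funext fun i => ?_))
  change _ = J.modelCoords ((J.cubeCone τ).toFun ((J.cubeDegen j.succ).toFun a)) i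
  rw [modelCoords_cubeCone, modelCoords_cubeCone]
  have e0 : J.coords ((J.cubeDegen j.succ).toFun a) 0 = J.coords a 0 := by
    change J.coords a (j.succ.succAbove 0) = _
    rw [Fin.succ_succAbove_zero]
  have e1 : (J.cubeDegen 0).toFun ((J.cubeDegen j.succ).toFun a) =
      (J.cubeDegen j).toFun ((J.cubeDegen 0).toFun a) := by
    refine J.coords_injective (funext fun k => ?_)
    change J.coords a (j.succ.succAbove ((0 : Fin (n + 1)).succAbove k)) =
      J.coords a ((0 : Fin (n + 2)).succAbove (j.succAbove k))
    rw [Fin.zero_succAbove, Fin.zero_succAbove, Fin.succ_succAbove_succ]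
  rw [e0, e1]
  rfl

end IntervalKind

namespace cubeNorm

variable {J : IntervalKind}

/-- The contraction of the cubical chains of a model cube. -/
noncomputable def cone (J : IntervalKind) (m n : ℕ) :
    ((cubeNorm J).obj (J.modelCube.{u} m)).X n →+
      ((cubeNorm J).obj (J.modelCube.{u} m)).X (n + 1) :=
  lift (fun τ => cls (J.cubeCone τ)) (by
    rintro m rfl i τ
    change cls (J.cubeCone (τ.comp (J.cubeDegen i))) = 0
    rw [J.cubeCone_comp_degen, cls_degen])

theorem cone_cls {m n : ℕ} (τ : ContMap (J.cube n) (J.modelCube.{u} m)) :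
    cone J m n (cls τ) = cls (J.cubeCone τ) :=
  lift_cls _ _ τ

/-- The face at parameter `1` returns `τ`, the face at parameter `0` is degenerate, and the others
are cones on the faces of `τ` with opposite sign, the cone parameter being the first coordinate. -/
theorem d_cone {m n : ℕ} (x : ((cubeNorm J).obj (J.modelCube.{u} m)).X (n + 1)) :
    ((cubeNorm J).obj (J.modelCube m)).d (n + 2) (n + 1) (cone J m (n + 1) x) =
      x - cone J m n (((cubeNorm J).obj (J.modelCube m)).d (n + 1) n x) := by
  refine DFunLike.congr_fun
    (f := (((cubeNorm J).obj (J.modelCube m)).d (n + 2) (n + 1)).hom.comp (cone J m (n + 1)))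
    (g := AddMonoidHom.id _ -
      (cone J m n).comp (((cubeNorm J).obj (J.modelCube m)).d (n + 1) n).hom)
    (hom_ext fun τ => ?_) x
  change ((cubeNorm J).obj (J.modelCube m)).d (n + 2) (n + 1) (cone J m (n + 1) (cls τ)) =
    cls τ - cone J m n (((cubeNorm J).obj (J.modelCube m)).d (n + 1) n (cls τ))
  rw [cone_cls, d_cls, d_cls, Fin.sum_univ_succ, J.cubeCone_comp_face_one,
    J.cubeCone_comp_face_zero, cls_degen, map_sum, sub_eq_add_neg (cls τ),
    ← Finset.sum_neg_distrib]
  rw [Fin.val_zero, show (-1 : ℤ) ^ (0 + 1) = -1 from rfl, neg_smul, one_smul, zero_sub, neg_neg]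
  refine congrArg (cls τ + ·) (Finset.sum_congr rfl fun i _ => ?_)
  rw [J.cubeCone_comp_face_succ, J.cubeCone_comp_face_succ, map_zsmul, map_sub, cone_cls, cone_cls,
    Fin.val_succ, pow_succ, mul_neg_one, neg_smul]

/-! ### Natural operations on cubical chains -/

/-- The natural operation on cubical chains determined by a chain of the model cube. -/
noncomputable def operation {n k : ℕ} (w : ((cubeNorm J).obj (J.modelCube.{u} n)).X k)
    (X : ClCat.{u}) : ((cubeNorm J).obj X).X n →+ ((cubeNorm J).obj X).X k :=
  -- The term for `S = ∅` alone need not vanish on degenerate cubes; the alternating sum over all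
  -- `S` makes the operation well defined on the quotient.
  lift (fun τ => ∑ S : Finset (Fin n), (-1 : ℤ) ^ S.card •
      ((cubeNorm J).map (J.modelMap (τ.comp (J.cubeZeroOn S)))).f k w) (by
    rintro m rfl i τ
    change ∑ S : Finset (Fin (m + 1)), (-1 : ℤ) ^ S.card • ((cubeNorm J).map
      (J.modelMap ((τ.comp (J.cubeDegen i)).comp (J.cubeZeroOn S)))).f k w = 0
    -- The cube does not depend on the coordinate `i`, so adding `i` to `S` or removing it leaves
    -- the map unchanged and reverses the sign: the terms cancel in pairs.
    refine Finset.sum_involution (fun S _ => if i ∈ S then S.erase i else insert i S) ?_ ?_ ?_ ?_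
    · intro S _
      have e : (τ.comp (J.cubeDegen i)).comp (J.cubeZeroOn S) = (τ.comp (J.cubeDegen i)).comp
          (J.cubeZeroOn (if i ∈ S then S.erase i else insert i S)) :=
        congrArg τ.comp (J.cubeDegen_comp_cubeZeroOn i fun j hj => by split_ifs <;> simp [hj])
      rw [← e, ← add_smul]
      convert zero_smul ℤ _
      split_ifs with hi
      · rw [← Finset.card_erase_add_one hi, pow_succ]
        ring
      · rw [Finset.card_insert_of_notMem hi, pow_succ]
        ring
    · intro S _ _ h
      split_ifs at h with hi
      · exact Finset.notMem_erase i S (h.symm ▸ hi)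
      · exact hi (h ▸ Finset.mem_insert_self i S)
    · intro S _
      exact Finset.mem_univ _
    · intro S _
      by_cases hi : i ∈ S
      · simp [hi]
      · simp [hi])

theorem operation_cls {n k : ℕ} (w : ((cubeNorm J).obj (J.modelCube.{u} n)).X k) {X : ClCat.{u}}
    (τ : ContMap (J.cube n) X) :
    operation w X (cls τ) = ∑ S : Finset (Fin n), (-1 : ℤ) ^ S.card •
      ((cubeNorm J).map (J.modelMap (τ.comp (J.cubeZeroOn S)))).f k w :=
  lift_cls _ _ τ

theorem operation_map {n k : ℕ} (w : ((cubeNorm J).obj (J.modelCube.{u} n)).X k) {X Y : ClCat.{u}}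
    (φ : X ⟶ Y) (x : ((cubeNorm J).obj X).X n) :
    operation w Y (((cubeNorm J).map φ).f n x) = ((cubeNorm J).map φ).f k (operation w X x) := by
  refine DFunLike.congr_fun (f := (operation w Y).comp (((cubeNorm J).map φ).f n).hom)
    (g := (((cubeNorm J).map φ).f k).hom.comp (operation w X)) (hom_ext fun τ => ?_) x
  change operation w Y (((cubeNorm J).map φ).f n (cls τ)) =
    ((cubeNorm J).map φ).f k (operation w X (cls τ))
  rw [map_cls, operation_cls, operation_cls, map_sum]
  refine Finset.sum_congr rfl fun S _ => ?_
  rw [map_zsmul]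
  refine congrArg ((-1 : ℤ) ^ S.card • ·) ?_
  exact congrArg (fun ψ : (cubeNorm J).obj (J.modelCube n) ⟶ (cubeNorm J).obj Y => (ψ.f k).hom w)
    ((cubeNorm J).map_comp (J.modelMap (τ.comp (J.cubeZeroOn S))) φ)

theorem d_operation {n k l : ℕ} (w : ((cubeNorm J).obj (J.modelCube.{u} n)).X k) {X : ClCat.{u}}
    (x : ((cubeNorm J).obj X).X n) :
    ((cubeNorm J).obj X).d k l (operation w X x) =
      operation (((cubeNorm J).obj (J.modelCube n)).d k l w) X x := by
  refine DFunLike.congr_fun (f := (((cubeNorm J).obj X).d k l).hom.comp (operation w X))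
    (g := operation (((cubeNorm J).obj (J.modelCube n)).d k l w) X) (hom_ext fun τ => ?_) x
  change ((cubeNorm J).obj X).d k l (operation w X (cls τ)) = operation _ X (cls τ)
  rw [operation_cls, operation_cls, map_sum]
  refine Finset.sum_congr rfl fun S _ => ?_
  rw [map_zsmul, ← ConcreteCategory.comp_apply, ← ConcreteCategory.comp_apply,
    HomologicalComplex.Hom.comm]

theorem operation_zero {n k : ℕ} (X : ClCat.{u}) (x : ((cubeNorm J).obj X).X n) :
    operation (0 : ((cubeNorm J).obj (J.modelCube.{u} n)).X k) X x = 0 := by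
  refine DFunLike.congr_fun (g := 0) (hom_ext fun τ => ?_) x
  rw [operation_cls]
  exact Finset.sum_eq_zero fun S _ => by rw [map_zero, smul_zero]

/-- A natural operation is determined by its value on the tautological cube. -/
theorem operation_modelPoint {n k : ℕ}
    (T : ∀ X : ClCat.{u}, ((cubeNorm J).obj X).X n →+ ((cubeNorm J).obj X).X k)
    (hT : ∀ {X Y : ClCat.{u}} (φ : X ⟶ Y) (x : ((cubeNorm J).obj X).X n),
      T Y (((cubeNorm J).map φ).f n x) = ((cubeNorm J).map φ).f k (T X x))
    (X : ClCat.{u}) (x : ((cubeNorm J).obj X).X n) :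
    operation (T _ (cls (J.modelPoint n))) X x = T X x := by
  refine DFunLike.congr_fun (hom_ext fun τ => ?_) x
  have e : ∀ ψ : ContMap (J.cube n) X, ((cubeNorm J).map (J.modelMap ψ)).f k
      (T _ (cls (J.modelPoint n))) = T X (cls ψ) := fun ψ => by
    rw [← hT, map_cls, J.modelMap_comp_modelPoint]
  -- For nonempty `S` the term is `T` evaluated at a degenerate cube, so only the term of the cube
  -- itself survives.
  rw [operation_cls, Finset.sum_eq_single ∅]
  · rw [e, J.cubeZeroOn_empty, Finset.card_empty, pow_zero, one_smul]
    rfl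
  · intro S _ hS
    obtain ⟨i, hi⟩ := Finset.nonempty_iff_ne_empty.mpr hS
    rw [e]
    cases n with
    | zero => exact i.elim0
    | succ n =>
      have h := cls_degen i ((τ.comp (J.cubeZeroOn S)).comp (J.cubeFace i J.zero))
      rw [show ((τ.comp (J.cubeZeroOn S)).comp (J.cubeFace i J.zero)).comp (J.cubeDegen i) =
        τ.comp (J.cubeZeroOn S) from congrArg τ.comp (J.cubeZeroOn_of_mem hi).symm] at h
      rw [h, map_zero, smul_zero]
  · exact fun h => absurd (Finset.mem_univ _) h

end cubeNorm

/-! ### Natural endomorphisms of cubical chains are homotopic to the identity -/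

namespace cubeNorm

variable {J : IntervalKind}

/-- The chains of model cubes defining the homotopy from a natural endomorphism, the identity in
degrees below two, to the identity. -/
noncomputable def homotopyChain (Φ : cubeNorm.{u} J ⟶ cubeNorm J) :
    (n : ℕ) → ((cubeNorm J).obj (J.modelCube.{u} n)).X (n + 1)
  | 0 => 0
  | 1 => 0
  -- The chain being coned is the defect of the homotopy relation on the tautological cube, with the
  -- homotopy already constructed in one degree less. This defect is a cycle, so the cone fills it.
  | n + 2 => cone J (n + 2) (n + 2) ((Φ.app (J.modelCube (n + 2))).f (n + 2) (cls (J.modelPoint (n + 2))) -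
      cls (J.modelPoint (n + 2)) - operation (homotopyChain Φ (n + 1)) _
        (((cubeNorm J).obj _).d (n + 2) (n + 1) (cls (J.modelPoint (n + 2)))))

/-- Acyclic models: the relation one degree lower makes the defect `T` a cycle, naturality reduces
it to the tautological cube, and there the cone fills it. In degree `1` both operations are zero and
the relation is the hypothesis on `Φ`. -/
theorem operation_homotopyChain (Φ : cubeNorm.{u} J ⟶ cubeNorm J)
    (h1 : ∀ X, (Φ.app X).f 1 = 𝟙 _) (n : ℕ) (X : ClCat.{u}) (x : ((cubeNorm J).obj X).X (n + 1)) :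
    ((cubeNorm J).obj X).d (n + 2) (n + 1) (operation (homotopyChain Φ (n + 1)) X x) +
      operation (homotopyChain Φ n) X (((cubeNorm J).obj X).d (n + 1) n x) =
        (Φ.app X).f (n + 1) x - x := by
  induction n generalizing X with
  | zero =>
    change ((cubeNorm J).obj X).d 2 1 (operation 0 X x) +
      operation 0 X (((cubeNorm J).obj X).d 1 0 x) = (Φ.app X).f 1 x - x
    rw [operation_zero, operation_zero, map_zero, h1]
    exact (zero_add _).trans (sub_self x).symm
  | succ n ih =>
    let T (X : ClCat.{u}) : ((cubeNorm J).obj X).X (n + 2) →+ ((cubeNorm J).obj X).X (n + 2) :=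
      ((Φ.app X).f (n + 2)).hom - AddMonoidHom.id _ -
        (operation (homotopyChain Φ (n + 1)) X).comp (((cubeNorm J).obj X).d (n + 2) (n + 1)).hom
    have hT : ∀ X x, T X x = (Φ.app X).f (n + 2) x - x -
      operation (homotopyChain Φ (n + 1)) X (((cubeNorm J).obj X).d (n + 2) (n + 1) x) :=
        fun _ _ => rfl
    have dd : ∀ X (y : ((cubeNorm J).obj X).X (n + 2)), ((cubeNorm J).obj X).d (n + 1) n
        (((cubeNorm J).obj X).d (n + 2) (n + 1) y) = 0 := fun X y => by
      rw [← ConcreteCategory.comp_apply, HomologicalComplex.d_comp_d]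
      rfl
    -- By the induction hypothesis at the boundary of `x`, the homotopy term has boundary equal to
    -- `Φ` minus the identity applied to that boundary.
    have hd : ∀ X x, ((cubeNorm J).obj X).d (n + 2) (n + 1) (T X x) = 0 := fun X x => by
      have h := ih X (((cubeNorm J).obj X).d (n + 2) (n + 1) x)
      rw [dd, map_zero, add_zero] at h
      rw [hT, map_sub, map_sub, h, ← ConcreteCategory.comp_apply, ← ConcreteCategory.comp_apply,
        HomologicalComplex.Hom.comm, sub_self]
    have nat : ∀ {X Y : ClCat.{u}} (φ : X ⟶ Y) (x : ((cubeNorm J).obj X).X (n + 2)),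
        T Y (((cubeNorm J).map φ).f (n + 2) x) = ((cubeNorm J).map φ).f (n + 2) (T X x) := by
      intro X Y φ x
      have e1 : (Φ.app Y).f (n + 2) (((cubeNorm J).map φ).f (n + 2) x) =
          ((cubeNorm J).map φ).f (n + 2) ((Φ.app X).f (n + 2) x) :=
        congrArg (fun ψ : (cubeNorm J).obj X ⟶ (cubeNorm J).obj Y => (ψ.f (n + 2)).hom x)
          (Φ.naturality φ)
      have e2 : ((cubeNorm J).obj Y).d (n + 2) (n + 1) (((cubeNorm J).map φ).f (n + 2) x) =
          ((cubeNorm J).map φ).f (n + 1) (((cubeNorm J).obj X).d (n + 2) (n + 1) x) := by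
        rw [← ConcreteCategory.comp_apply, ← ConcreteCategory.comp_apply,
          HomologicalComplex.Hom.comm]
      rw [hT, hT, e1, e2, operation_map, map_sub, map_sub]
    have e : homotopyChain Φ (n + 2) = cone J (n + 2) (n + 2) (T _ (cls (J.modelPoint (n + 2)))) :=
      rfl
    rw [d_operation, e, d_cone, hd, map_zero, sub_zero, operation_modelPoint T nat, hT,
      sub_add_cancel]

/-- The natural homotopy from a natural endomorphism, the identity in degrees below two, to the
identity. -/
noncomputable def naturalHomotopy (Φ : cubeNorm.{u} J ⟶ cubeNorm J)
    (h0 : ∀ X, (Φ.app X).f 0 = 𝟙 _) (h1 : ∀ X, (Φ.app X).f 1 = 𝟙 _) :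
    NaturalHomotopy Φ (𝟙 (cubeNorm J)) where
  app X :=
    { hom := fun i j => if h : i + 1 = j then
        h ▸ addCommGrpHom (operation (homotopyChain Φ i) X) else 0
      zero := fun i j h => dif_neg h
      comm := by
        rintro (_ | n)
        · rw [Homotopy.dNext_zero_chainComplex, Homotopy.prevD_chainComplex, dif_pos rfl, h0]
          refine ConcreteCategory.hom_ext _ _ fun x => ?_
          change x = (0 : ((cubeNorm J).obj X).X 0) +
            ((cubeNorm J).obj X).d 1 0 (operation 0 X x) + x
          rw [operation_zero, map_zero, add_zero, zero_add]
        · rw [Homotopy.dNext_succ_chainComplex, Homotopy.prevD_chainComplex, dif_pos rfl,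
            dif_pos rfl]
          refine ConcreteCategory.hom_ext _ _ fun x => ?_
          have h := operation_homotopyChain Φ h1 n X x
          rw [eq_sub_iff_add_eq] at h
          exact h.symm.trans (congrArg (· + x) (add_comm _ _)) }
  naturality φ i j := by
    by_cases h : i + 1 = j
    · subst h
      refine ConcreteCategory.hom_ext _ _ fun x => ?_
      simp only [dite_true]
      exact operation_map (homotopyChain Φ i) φ x
    · simp only [dif_neg h, Limits.comp_zero, Limits.zero_comp]

theorem naturalHomotopy_hom (Φ : cubeNorm.{u} J ⟶ cubeNorm J)
    (h0 : ∀ X, (Φ.app X).f 0 = 𝟙 _) (h1 : ∀ X, (Φ.app X).f 1 = 𝟙 _) (X : ClCat.{u}) {i : ℕ}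
    (hi : i < 2) (j : ℕ) : ((naturalHomotopy Φ h0 h1).app X).hom i j = 0 := by
  by_cases h : i + 1 = j
  · subst h
    refine (dif_pos rfl).trans ?_
    refine ConcreteCategory.hom_ext _ _ fun x => ?_
    obtain rfl | rfl : i = 0 ∨ i = 1 := by omega
    · exact operation_zero X x
    · exact operation_zero X x
  · exact dif_neg h

end cubeNorm

/-! ### The comparison of normalized chains -/

/-- The natural chain map from normalized simplicial to cubical chains. -/
noncomputable def simpToCube (J : IntervalKind) : simpNorm.{u} J ⟶ cubeNorm.{u} J :=
  simpSection J ≫ collapseMap J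

theorem simpToCube_triangulationMap (J : IntervalKind) :
    simpToCube.{u} J ≫ triangulationMap J = 𝟙 _ := by
  rw [simpToCube, Category.assoc, collapseMap_triangulationMap, simpSection_simpProj]

/-! ### The comparison maps on generators of degree at most one -/

section

variable {J : IntervalKind} {X : ClCat.{u}}

/-- A degenerate `1`-simplex factors through a point, so the cube collapsing onto it is constant.
From degree `2` on this fails: the degeneracy of `|Δ¹|` repeating the vertex `0` gives the square
`min(a₁, a₂)`. -/
theorem collapseHom_degenerate {n : ℕ} (hn : n ≤ 1) :
    degenerateSimplices ((singAb J).obj X) n ≤ (collapseHom J X n).ker := by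
  obtain rfl | rfl := Nat.le_one_iff_eq_zero_or_eq_one.mp hn
  · exact bot_le
  · refine normChains.degenerateSimplices_le_ker_lift (S := (singSSet J).obj X) _
      fun i (σ : ContMap (J.simplex 0) X) => ?_
    let p : ContMap (J.cube 1) (J.simplex 0) :=
      (J.simplexMap (SimplexCategory.σ i).toOrderHom).comp (J.collapse 1)
    have hp : p = (p.comp (J.cubeFace 0 J.zero)).comp (J.cubeDegen 0) := by
      refine ContMap.ext (funext fun a => J.tail_ext fun k hk => ?_)
      obtain rfl : k = 0 := by omega
      rw [J.tail_zero, J.tail_zero]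
    change cubeNorm.cls (σ.comp p) = 0
    rw [hp]
    exact cubeNorm.cls_degen 0 (σ.comp (p.comp (J.cubeFace 0 J.zero)))

/-- The idempotent `PInfty` alters a simplex only by degenerate chains, which the collapse kills in
these degrees. -/
theorem simpToCube_cls {n : ℕ} (hn : n ≤ 1) (σ : ContMap (J.simplex n) X) :
    ((simpToCube J).app X).f n (normChains.cls (S := (singSSet J).obj X) σ) =
      cubeNorm.cls (σ.comp (J.collapse n)) := by
  let y : (AlgebraicTopology.AlternatingFaceMapComplex.obj ((singAb J).obj X)).X n :=
    FreeAbelianGroup.of (α := ContMap (J.simplex n) X) σ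
  have h : collapseHom J X n
      ((AlgebraicTopology.DoldKan.PInfty (X := (singAb J).obj X)).f n y - y) = 0 :=
    collapseHom_degenerate hn (sub_PInfty_mem ((singAb J).obj X) n y)
  refine (sub_eq_zero.mp ((map_sub (collapseHom J X n) _ _).symm.trans h)).trans ?_
  exact collapseHom_of σ

/-- Here the collapse is invertible, so `τ` is the collapse of the simplex `τ.comp e.inv`, and
`simpToCube_triangulationMap` gives the value without computing the fundamental chain. -/
theorem triangulationMap_cls {n : ℕ} (hn : n ≤ 1) (e : J.cube n ≅ J.simplex n)
    (he : J.collapse n = e.hom) (τ : ContMap (J.cube n) X) :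
    ((triangulationMap J).app X).f n (cubeNorm.cls τ) =
      normChains.cls (S := (singSSet J).obj X) (τ.comp e.inv) := by
  have h := simpToCube_cls hn (τ.comp e.inv)
  have h' : (τ.comp e.inv).comp (J.collapse n) = τ := by
    rw [he]
    exact congrArg τ.comp e.hom_inv_id
  rw [h'] at h
  rw [← h]
  exact congrArg (fun ψ : simpNorm J ⟶ simpNorm J => ((ψ.app X).f n).hom _)
    (simpToCube_triangulationMap J)

theorem triangulationMap_simpToCube_low {n : ℕ} (hn : n ≤ 1) (e : J.cube n ≅ J.simplex n)
    (he : J.collapse n = e.hom) (X : ClCat.{u}) :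
    ((triangulationMap J ≫ simpToCube J).app X).f n = 𝟙 _ := by
  refine ConcreteCategory.hom_ext _ _ fun x => ?_
  refine DFunLike.congr_fun (f := (((triangulationMap J ≫ simpToCube J).app X).f n).hom)
    (g := AddMonoidHom.id _) (cubeNorm.hom_ext fun τ => ?_) x
  change ((simpToCube J).app X).f n (((triangulationMap J).app X).f n (cubeNorm.cls τ)) =
    cubeNorm.cls τ
  rw [triangulationMap_cls hn e he, simpToCube_cls hn, he]
  exact congrArg (fun ψ => cubeNorm.cls (τ.comp ψ)) e.hom_inv_id

end

/-- The natural homotopy from the composite cubical comparison map to the identity. -/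
noncomputable def cubeComparisonHomotopy (J : IntervalKind) :
    NaturalHomotopy (triangulationMap.{u} J ≫ simpToCube J) (𝟙 (cubeNorm J)) :=
  cubeNorm.naturalHomotopy _
    (triangulationMap_simpToCube_low zero_le_one J.cubeIsoSimplexZero J.collapse_zero)
    (triangulationMap_simpToCube_low le_rfl J.cubeIsoSimplexOne J.collapse_one)

theorem cubeComparisonHomotopy_hom (J : IntervalKind) (X : ClCat.{u}) {i : ℕ} (hi : i < 2)
    (j : ℕ) : ((cubeComparisonHomotopy J).app X).hom i j = 0 :=
  cubeNorm.naturalHomotopy_hom _ _ _ X hi j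

/-! ### The comparison of reduced chains -/

theorem simpToCube_aug (J : IntervalKind) (X : ClCat.{u}) :
    ((simpToCube J).app X).f 0 ≫ cubeNormAug J X = simpNormAug J X := by
  refine ConcreteCategory.hom_ext _ _ fun x => ?_
  refine DFunLike.congr_fun (f := (((simpToCube J).app X).f 0 ≫ cubeNormAug J X).hom)
    (g := (simpNormAug J X).hom)
    (normChains.hom_ext (S := (singSSet J).obj X) fun (σ : ContMap (J.simplex 0) X) => ?_) x
  refine (congrArg (cubeNormAug J X).hom (simpToCube_cls zero_le_one σ)).trans ?_
  exact (FreeAbelianGroup.lift_apply_of _ _).trans (FreeAbelianGroup.lift_apply_of _ _).symm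

theorem triangulationMap_aug (J : IntervalKind) (X : ClCat.{u}) :
    ((triangulationMap J).app X).f 0 ≫ simpNormAug J X = cubeNormAug J X := by
  refine ConcreteCategory.hom_ext _ _ fun x => ?_
  refine DFunLike.congr_fun (f := (((triangulationMap J).app X).f 0 ≫ simpNormAug J X).hom)
    (g := (cubeNormAug J X).hom) (cubeNorm.hom_ext fun τ => ?_) x
  refine (congrArg (simpNormAug J X).hom
    (triangulationMap_cls zero_le_one J.cubeIsoSimplexZero J.collapse_zero τ)).trans ?_
  exact (FreeAbelianGroup.lift_apply_of _ _).trans (FreeAbelianGroup.lift_apply_of _ _).symm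

theorem simpSection_aug (J : IntervalKind) (X : ClCat.{u}) :
    ((simpSection J).app X).f 0 ≫ simpAug J X = simpNormAug J X := by
  refine ConcreteCategory.hom_ext _ _ fun x => ?_
  obtain ⟨x, rfl⟩ := QuotientAddGroup.mk_surjective
    (s := degenerateSimplices ((singAb J).obj X) 0) x
  -- In degree `0` the idempotent `PInfty` is the identity.
  rfl

/-- The natural chain map from reduced normalized simplicial to reduced cubical chains. -/
noncomputable def simpToCubeRed (J : IntervalKind) : simpRed.{u} J ⟶ cubeRed.{u} J where
  app X := augmentMap _ (quotientComplex_d_comp_quotientAug _ _ _ _ _ (simpMoore_d_comp_simpAug J X)) _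
    (quotientComplex_d_comp_quotientAug _ _ _ _ _ (cubeComplex_d_comp_cubeAug J X))
    ((simpToCube J).app X) (simpToCube_aug J X)
  naturality X Y φ := by
    ext (_ | n) : 1
    · rfl
    · exact congrArg (fun ψ => HomologicalComplex.Hom.f ψ n) ((simpToCube J).naturality φ)

/-- The natural chain map from reduced cubical to reduced normalized simplicial chains. -/
noncomputable def cubeToSimpRed (J : IntervalKind) : cubeRed.{u} J ⟶ simpRed.{u} J where
  app X := augmentMap _ (quotientComplex_d_comp_quotientAug _ _ _ _ _ (cubeComplex_d_comp_cubeAug J X)) _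
    (quotientComplex_d_comp_quotientAug _ _ _ _ _ (simpMoore_d_comp_simpAug J X))
    ((triangulationMap J).app X) (triangulationMap_aug J X)
  naturality X Y φ := by
    ext (_ | n) : 1
    · rfl
    · exact congrArg (fun ψ => HomologicalComplex.Hom.f ψ n) ((triangulationMap J).naturality φ)

/-- The natural section of the projection to reduced normalized simplicial chains. -/
noncomputable def simpSectionRed (J : IntervalKind) : simpRed.{u} J ⟶ simpMooreRed.{u} J where
  app X := augmentMap _ (quotientComplex_d_comp_quotientAug _ _ _ _ _ (simpMoore_d_comp_simpAug J X)) _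
    (simpMoore_d_comp_simpAug J X)
    ((simpSection J).app X) (simpSection_aug J X)
  naturality X Y φ := by
    ext (_ | n) : 1
    · rfl
    · exact congrArg (fun ψ => HomologicalComplex.Hom.f ψ n) ((simpSection J).naturality φ)

theorem simpToCubeRed_cubeToSimpRed (J : IntervalKind) :
    simpToCubeRed.{u} J ≫ cubeToSimpRed J = 𝟙 _ := by
  ext X (_ | n) : 3
  · rfl
  · exact congrArg (fun ψ : simpNorm J ⟶ simpNorm J => (ψ.app X).f n)
      (simpToCube_triangulationMap J)

theorem simpSectionRed_simpRedProj (J : IntervalKind) :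
    simpSectionRed.{u} J ≫ simpRedProj J = 𝟙 _ := by
  ext X (_ | n) : 3
  · rfl
  · exact congrArg (fun ψ : simpNorm J ⟶ simpNorm J => (ψ.app X).f n) (simpSection_simpProj J)

theorem comp_zero_eq_zero_comp {V : Type*} [Category V] [Limits.HasZeroMorphisms V] {A B C D : V}
    (a : A ⟶ B) (b : C ⟶ D) : a ≫ (0 : B ⟶ D) = (0 : A ⟶ C) ≫ b :=
  Limits.comp_zero.trans Limits.zero_comp.symm

/-- The natural homotopy from the composite reduced cubical comparison map to the identity. -/
noncomputable def cubeComparisonHomotopyRed (J : IntervalKind) :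
    NaturalHomotopy (cubeToSimpRed.{u} J ≫ simpToCubeRed J) (𝟙 (cubeRed J)) where
  app X := augmentHomotopy
    (w := (quotientComplex_d_comp_quotientAug _ _ _ _ _ (cubeComplex_d_comp_cubeAug J X)))
    (w' := (quotientComplex_d_comp_quotientAug _ _ _ _ _ (cubeComplex_d_comp_cubeAug J X)))
    ((cubeComparisonHomotopy J).app X) rfl (fun _ => rfl) (fun _ => rfl)
  naturality {X Y} φ := by
    rintro (_ | i) (_ | j)
    · exact comp_zero_eq_zero_comp _ _
    · exact comp_zero_eq_zero_comp _ _
    · exact comp_zero_eq_zero_comp _ _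
    · exact (cubeComparisonHomotopy J).naturality φ i j

/-- The natural homotopy from the projection onto reduced normalized chains to the identity. -/
noncomputable def simpSectionHomotopyRed (J : IntervalKind) :
    NaturalHomotopy (simpRedProj.{u} J ≫ simpSectionRed J) (𝟙 (simpMooreRed J)) where
  app X := augmentHomotopy (w := (simpMoore_d_comp_simpAug J X))
    (w' := (simpMoore_d_comp_simpAug J X)) ((simpSectionHomotopy J).app X) rfl (fun _ => rfl) (fun _ => rfl)
  naturality {X Y} φ := by
    rintro (_ | i) (_ | j)
    · exact comp_zero_eq_zero_comp _ _
    · exact comp_zero_eq_zero_comp _ _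
    · exact comp_zero_eq_zero_comp _ _
    · exact (simpSectionHomotopy J).naturality φ i j

/-! ### Isomorphisms in homology and the final assembly -/

/-- The zero homotopy between equal natural maps. -/
def NaturalHomotopy.ofEq {F G : ClCat.{u} ⥤ ChainComplex AddCommGrpCat.{u} ℕ} {a b : F ⟶ G}
    (h : a = b) : NaturalHomotopy a b where
  app X := Homotopy.ofEq (congrArg (fun c => c.app X) h)
  naturality _ _ _ := comp_zero_eq_zero_comp _ _

theorem NaturalHomotopy.isIso_homologyMap {F G : ClCat.{u} ⥤ ChainComplex AddCommGrpCat.{u} ℕ}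
    {a : F ⟶ G} {b : G ⟶ F} (H : NaturalHomotopy (a ≫ b) (𝟙 F))
    (K : NaturalHomotopy (b ≫ a) (𝟙 G)) (X : ClCat.{u}) (n : ℕ) :
    IsIso (HomologicalComplex.homologyMap (a.app X) n) :=
  (HomotopyEquiv.toHomologyIso (⟨a.app X, b.app X, H.app X, K.app X⟩ :
    HomotopyEquiv (F.obj X) (G.obj X)) n).isIso_hom

theorem theorem1p2 (J : IntervalKind) :
    ∃ (f : simpRed.{u} J ⟶ cubeRed.{u} J) (g : cubeRed.{u} J ⟶ simpRed.{u} J)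
      (H : NaturalHomotopy (f ≫ g) (𝟙 (simpRed.{u} J)))
      (G : NaturalHomotopy (g ≫ f) (𝟙 (cubeRed.{u} J))),
      SimpToCubeIdBelowTwo J f ∧ CubeToSimpIdBelowTwo J g ∧ H.ZeroBelowTwo ∧ G.ZeroBelowTwo ∧
      (∃ g' : cubeRed.{u} J ⟶ simpMooreRed.{u} J,
        g' ≫ simpRedProj.{u} J = g ∧
        Nonempty (NaturalHomotopy ((simpRedProj.{u} J ≫ f) ≫ g') (𝟙 (simpMooreRed.{u} J)))) ∧
      (∀ (X : ClCat.{u}) (n : ℕ),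
        IsIso (HomologicalComplex.homologyMap ((simpRedProj.{u} J ≫ f).app X) n)) ∧
      ∃ (f₀ : simpMoore.{u} J ⟶ cubeNorm.{u} J) (g₀ : cubeNorm.{u} J ⟶ simpMoore.{u} J),
        (∀ (X : ClCat.{u}) (n : ℕ),
          (f₀.app X).f n = ((simpRedProj.{u} J ≫ f).app X).f (n + 1)) ∧
        Nonempty (NaturalHomotopy (f₀ ≫ g₀) (𝟙 (simpMoore.{u} J))) ∧
        Nonempty (NaturalHomotopy (g₀ ≫ f₀) (𝟙 (cubeNorm.{u} J))) ∧
        ∀ (X : ClCat.{u}) (n : ℕ), IsIso (HomologicalComplex.homologyMap (f₀.app X) n) := by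
  -- Since `gf` is the identity and the section splits the projection, the inner maps cancel in each
  -- of the four composites. Each homotopy needed is thus one of those already constructed.
  have e1 : (simpRedProj.{u} J ≫ simpToCubeRed J) ≫ cubeToSimpRed J ≫ simpSectionRed J =
      simpRedProj J ≫ simpSectionRed J := by
    rw [Category.assoc, ← Category.assoc (simpToCubeRed J), simpToCubeRed_cubeToSimpRed,
      Category.id_comp]
  have e2 : (cubeToSimpRed.{u} J ≫ simpSectionRed J) ≫ simpRedProj J ≫ simpToCubeRed J =
      cubeToSimpRed J ≫ simpToCubeRed J := by
    rw [Category.assoc, ← Category.assoc (simpSectionRed J), simpSectionRed_simpRedProj,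
      Category.id_comp]
  have e3 : (simpProj.{u} J ≫ simpToCube J) ≫ triangulationMap J ≫ simpSection J =
      simpProj J ≫ simpSection J := by
    rw [Category.assoc, ← Category.assoc (simpToCube J), simpToCube_triangulationMap,
      Category.id_comp]
  have e4 : (triangulationMap.{u} J ≫ simpSection J) ≫ simpProj J ≫ simpToCube J =
      triangulationMap J ≫ simpToCube J := by
    rw [Category.assoc, ← Category.assoc (simpSection J), simpSection_simpProj, Category.id_comp]
  have H1 := simpSectionHomotopyRed.{u} J
  have H2 := cubeComparisonHomotopyRed.{u} J
  have H3 := simpSectionHomotopy.{u} J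
  have H4 := cubeComparisonHomotopy.{u} J
  rw [← e1] at H1
  rw [← e2] at H2
  rw [← e3] at H3
  rw [← e4] at H4
  refine ⟨simpToCubeRed J, cubeToSimpRed J, .ofEq (simpToCubeRed_cubeToSimpRed J),
    cubeComparisonHomotopyRed J, fun X => ⟨fun _ => rfl, fun σ => ?_, fun σ => ?_⟩,
    fun X => ⟨fun _ => rfl, fun τ => ?_, fun τ => ?_⟩, fun _ _ _ _ => rfl, ?_,
    ⟨cubeToSimpRed J ≫ simpSectionRed J, ?_, ⟨H1⟩⟩, H1.isIso_homologyMap H2,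
    simpProj J ≫ simpToCube J, triangulationMap J ≫ simpSection J, fun _ _ => rfl, ⟨H3⟩, ⟨H4⟩,
    H3.isIso_homologyMap H4⟩
  · rw [← J.collapse_zero]
    exact simpToCube_cls zero_le_one σ
  · rw [← J.collapse_one]
    exact simpToCube_cls le_rfl σ
  · exact triangulationMap_cls zero_le_one _ J.collapse_zero τ
  · exact triangulationMap_cls le_rfl _ J.collapse_one τ
  -- Positions are degrees shifted by one: position `0` is the augmentation, where the homotopy is
  -- zero by construction, and positions `1` and `2` are degrees `0` and `1`.
  · rintro X (_ | i) (_ | j) hi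
    · rfl
    · rfl
    · rfl
    · exact cubeComparisonHomotopy_hom J X (by omega) j
  · rw [Category.assoc, simpSectionRed_simpRedProj, Category.comp_id]
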